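/- Setting. Let $\mathcal A$ be the quasi-local C*-algebra of an infinite quantum spin chain, i.e. the norm closure of $\bigcup_{N\ge 0}\mathcal A_{[-N,N]}$ with $\mathcal A_{[-N,N]}=\bigotimes_{k=-N}^N M_p(\mathbb C)$; write $a^{(k)}$ for $a\in M_p(\mathbb C)$ placed at site $k$ and $\tau$ for the translation automorphism, $\tau(a^{(k)})=a^{(k+1)}$. Let $\omega$ be a state on $\mathcal A$ (a positive linear functional with $\omega(1)=1$), translation invariant ($\omega\circ\tau=\omega$) and clustering ($\lim_{|k|\to\infty}\omega(\tau^k(A)B)=\omega(A)\omega(B)$ for all $A,B\in\mathcal A$), and let $\chi=\{x_1,\dots,x_d\}\subset M_p(\mathbb C)$ be Hermitian single-site observables. Put $\omega(x_i)=\omega(x_i^{(0)})$, $N_T=2N+1$, and $$F_N(x_i)=\frac1{\sqrt{N_T}}\sum_{k=-N}^N\big(x_i^{(k)}-\omega(x_i)\big),\qquad (r,F_N)=\sum_{i=1}^d r_iF_N(x_i),\qquad W_N(r)=e^{i(r,F_N)}\quad(r\in\mathbb R^d).$$ Assume that $(\omega,\chi)$ has normal quantum fluctuations: for all $i,j$,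 $\sum_{k\in\mathbb Z}|\omega(x_i^{(0)}\tau^k(x_j^{(0)}))-\omega(x_i)\omega(x_j)|<\infty$, and for all $i$ the limit $v_i=\lim_N\omega(F_N(x_i)^2)$ exists and $\lim_N\omega(e^{i\alpha F_N(x_i)})=e^{-\alpha^2v_i/2}$ for all $\alpha\in\mathbb R$. Let $$\mathbb L_N[X]=i\Big[\sum_{k=-N}^N h^{(k)},X\Big]+\sum_{k,\ell=-N}^N J(k-\ell)\sum_{\mu,\nu=1}^m D_{\mu\nu}\Big(v_\mu^{(k)}X(v_\nu^\dagger)^{(\ell)}-\tfrac12\big\{v_\mu^{(k)}(v_\nu^\dagger)^{(\ell)},X\big\}\Big),$$ where $h=h^\dagger,v_1,\dots,v_m\in M_p(\mathbb C)$, the matrix $D$ is positive semidefinite, the matrices $(J(k-\ell))_{-N\le k,\ell\le N}$ are positive semidefinite for every $N$, $J(0)>0$ and $\sum_{k\in\mathbb Z}|J(k)|<\infty$. Let $\Phi^N_t=e^{t\mathbb L_N}$, $t\ge0$. Assume that there is a real $d\times d$ matrix $\mathcal L$ with $$\mathbb L_N[x_i^{(k)}]=\sum_{j=1}^d\mathcal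 L_{ij}\,x_j^{(k)}\qquad\text{for all } i,\ \text{all } N\ge0 \text{ and all } k\in[-N,N],$$ and that $\omega(\Phi^N_t[X])=\omega(X)$ for all $N$, $t\ge0$, $X\in\mathcal A_{[-N,N]}$. Theorem. The limits $$\Sigma_\omega^{ij}=\lim_{N\to\infty}\tfrac12\,\omega\big(\{F_N(x_i),F_N(x_j)\}\big),\qquad \sigma_\omega^{ij}=-i\lim_{N\to\infty}\omega\big([F_N(x_i),F_N(x_j)]\big)$$ exist and are real. Put $\mathcal X_t=e^{t\mathcal L}$, $\mathcal Y_t=\frac12(\Sigma_\omega-\mathcal X_t\Sigma_\omega\mathcal X_t^{tr})$, and $$\Psi_t[W_N(r)]=e^{-(r,\mathcal Y_tr)}\,W_N(\mathcal X_t^{tr}r),\qquad \Delta_N(t,r)=\Psi_t[W_N(r)]-\Phi_t^N[W_N(r)].$$ Then for all $a,r\in\mathbb R^d$ and $t\ge0$, $$\lim_{N\to\infty}\omega\big(W_N(a)\,\Delta_N(t,r)\,\Delta_N(t,r)^\dagger\,W_N(a)^\dagger\big)=0 .$$ Consequently, for all $a,b,r\in\mathbb R^d$ and $t\ge0$, $$\lim_{N\to\infty}\Big(\omega\big(W_N(a)\,\Phi^N_t[W_N(r)]\,W_N(b)\big)-e^{-(r,\mathcal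 Y_tr)}\,\omega\big(W_N(a)\,W_N(\mathcal X_t^{tr}r)\,W_N(b)\big)\Big)=0 .$$ Moreover, on the Weyl $*$-algebra spanned by linearly independent symbols $W(r)$, $r\in\mathbb R^d$, with $W(r)W(r')=e^{-\frac i2(r,\sigma_\omega r')}W(r+r')$ and $W(r)^\dagger=W(-r)$, the linear maps defined by $\Phi_t[W(r)]=e^{-(r,\mathcal Y_tr)}W(\mathcal X_t^{tr}r)$ satisfy $\Phi_0=\mathrm{id}$, $\Phi_{t+u}=\Phi_t\circ\Phi_u$ for $t,u\ge0$, and for every $t\ge0$ the map $\Phi_t$ is unital and completely positive: for all finite families $(a_i),(b_i)$ in the Weyl algebra, $\sum_{i,j}b_i^\dagger\,\Phi_t[a_i^\dagger a_j]\,b_j$ is a finite sum of elements of the form $c^\dagger c$. -/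

import Mathlib

open Filter Topology
open scoped ComplexOrder Matrix

noncomputable section

namespace SpinChain

/-! ## The quasi-local algebra of the chain

The algebra is realised on the Hilbert space `ℓ²(ℤ → Fin p)` with orthonormal basis the spin
configurations of the chain.  A matrix at site `k` acts on the `k`-th spin alone, so that the
operators supported in `[-N, N]` form a copy of `⨂_{k=-N}^{N} M_p(ℂ)`, with its operator norm. -/

/-- Spin configurations of the infinite chain. -/
abbrev Config (p : ℕ) : Type := ℤ → Fin p

/-- The Hilbert space `ℓ²(ℤ → Fin p)`. -/
abbrev ChainSpace (p : ℕ) : Type := lp (fun _ : Config p => ℂ) 2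

/-- The unitary `ψ ↦ ψ ∘ e` of a permutation `e` of the configurations. -/
def permOp {p : ℕ} (e : Config p ≃ Config p) : ChainSpace p ≃ₗᵢ[ℂ] ChainSpace p where
  toFun ψ := ⟨fun s => ψ (e s), by
    have h := (lp.memℓp ψ).summable (by norm_num)
    exact memℓp_gen (h.comp_injective e.injective)⟩
  invFun ψ := ⟨fun s => ψ (e.symm s), by
    have h := (lp.memℓp ψ).summable (by norm_num)
    exact memℓp_gen (h.comp_injective e.symm.injective)⟩
  map_add' ψ φ := by ext s; rfl
  map_smul' c ψ := by ext s; rfl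
  left_inv ψ := by
    ext s
    change ψ (e (e.symm s)) = ψ s
    rw [e.apply_symm_apply]
  right_inv ψ := by
    ext s
    change ψ (e.symm (e s)) = ψ s
    rw [e.symm_apply_apply]
  norm_map' ψ := by
    rw [lp.norm_eq_tsum_rpow (by norm_num), lp.norm_eq_tsum_rpow (by norm_num)]
    congr 1
    exact e.tsum_eq (fun s => ‖ψ s‖ ^ (2 : ENNReal).toReal)

@[simp] lemma permOp_apply {p : ℕ} (e : Config p ≃ Config p) (ψ : ChainSpace p) (s : Config p) :
    permOp e ψ s = ψ (e s) := rfl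

@[simp] lemma permOp_symm_apply {p : ℕ} (e : Config p ≃ Config p) (ψ : ChainSpace p)
    (s : Config p) : (permOp e).symm ψ s = ψ (e.symm s) := rfl

/-- The projection onto the configurations whose `k`-th spin is in level `i`. -/
def levelProj {p : ℕ} (k : ℤ) (i : Fin p) : ChainSpace p →L[ℂ] ChainSpace p :=
  LinearMap.mkContinuous
    { toFun := fun ψ => ⟨fun s => if s k = i then ψ s else 0, by
        refine Memℓp.mono' (lp.memℓp ψ) fun s => ?_
        split_ifs <;> simp⟩
      map_add' := fun ψ φ => by
        ext s
        change (if s k = i then ψ s + φ s else 0) =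
          (if s k = i then ψ s else 0) + (if s k = i then φ s else 0)
        split_ifs <;> simp
      map_smul' := fun c ψ => by
        ext s
        change (if s k = i then c * ψ s else 0) = c * (if s k = i then ψ s else 0)
        split_ifs <;> simp } 1 fun ψ => by
      rw [one_mul]
      refine lp.norm_mono (by norm_num) fun s => ?_
      change ‖if s k = i then ψ s else 0‖ ≤ ‖ψ s‖
      split_ifs <;> simp

@[simp] lemma levelProj_apply {p : ℕ} (k : ℤ) (i : Fin p) (ψ : ChainSpace p) (s : Config p) :
    levelProj k i ψ s = if s k = i then ψ s else 0 := rfl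

/-- Exchange of the levels `i` and `j` of the `k`-th spin. -/
def levelSwap {p : ℕ} (k : ℤ) (i j : Fin p) : Config p ≃ Config p where
  toFun s := Function.update s k (Equiv.swap i j (s k))
  invFun s := Function.update s k (Equiv.swap i j (s k))
  left_inv s := by simp
  right_inv s := by simp

/-- The operator `a^{(k)}`: the matrix `a` acting on the `k`-th spin
(see `siteOp_apply` for its action on wave functions). -/
def siteOp {p : ℕ} (k : ℤ) (a : Matrix (Fin p) (Fin p) ℂ) : ChainSpace p →L[ℂ] ChainSpace p :=
  ∑ i, ∑ j, a i j • (levelProj k i ∘L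
    ((permOp (levelSwap k i j)).toContinuousLinearEquiv : ChainSpace p →L[ℂ] ChainSpace p))

lemma siteOp_apply {p : ℕ} (k : ℤ) (a : Matrix (Fin p) (Fin p) ℂ) (ψ : ChainSpace p)
    (s : Config p) : siteOp k a ψ s = ∑ j, a (s k) j * ψ (Function.update s k j) := by
  have key : ∀ i j, (a i j • (levelProj k i ∘L ((permOp (levelSwap k i j)).toContinuousLinearEquiv :
      ChainSpace p →L[ℂ] ChainSpace p))) ψ s =
      if s k = i then a i j * ψ (Function.update s k j) else 0 := by
    intro i j
    change a i j * (if s k = i then ψ (levelSwap k i j s) else 0) = _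
    split_ifs with h
    · subst h
      simp [levelSwap]
    · simp
  have hsum : siteOp k a ψ s = ∑ i, ∑ j, (a i j • (levelProj k i ∘L
      ((permOp (levelSwap k i j)).toContinuousLinearEquiv :
        ChainSpace p →L[ℂ] ChainSpace p))) ψ s := by
    simp only [siteOp, sum_apply, lp.coeFn_sum, Finset.sum_apply]
  rw [hsum, Finset.sum_eq_single (s k)]
  · refine Finset.sum_congr rfl fun j _ => ?_
    rw [key, if_pos rfl]
  · intro i _ hi
    refine Finset.sum_eq_zero fun j _ => ?_
    rw [key, if_neg (Ne.symm hi)]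
  · simp

/-- The local algebra `𝒜_{[-N,N]}`. -/
def localAlgebra (p N : ℕ) : StarSubalgebra ℂ (ChainSpace p →L[ℂ] ChainSpace p) :=
  StarAlgebra.adjoin ℂ
    {T | ∃ k ∈ Finset.Icc (-(N : ℤ)) N, ∃ a : Matrix (Fin p) (Fin p) ℂ, T = siteOp k a}

/-- The quasi-local algebra `𝒜`, the norm closure of `⋃_N 𝒜_{[-N,N]}`, inside the bounded
operators. -/
def quasiLocalAlgebra (p : ℕ) : StarSubalgebra ℂ (ChainSpace p →L[ℂ] ChainSpace p) :=
  (⨆ N : ℕ, localAlgebra p N).topologicalClosure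

/-- The quasi-local C*-algebra `𝒜` as a type. -/
def QuasiLocal (p : ℕ) : Type := quasiLocalAlgebra p

instance (p : ℕ) : CStarAlgebra (QuasiLocal p) :=
  haveI : IsClosed (quasiLocalAlgebra p : Set (ChainSpace p →L[ℂ] ChainSpace p)) :=
    StarSubalgebra.isClosed_topologicalClosure _
  inferInstanceAs (CStarAlgebra (quasiLocalAlgebra p))

/-- The inclusion of `𝒜` into the bounded operators. -/
def toOp {p : ℕ} : QuasiLocal p →⋆ₐ[ℂ] (ChainSpace p →L[ℂ] ChainSpace p) :=
  (quasiLocalAlgebra p).subtype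

lemma siteOp_mem_iSup {p : ℕ} (k : ℤ) (a : Matrix (Fin p) (Fin p) ℂ) :
    siteOp k a ∈ ⨆ N : ℕ, localAlgebra p N := by
  refine (le_iSup (fun N : ℕ => localAlgebra p N) k.natAbs) ?_
  refine StarAlgebra.subset_adjoin ℂ _ ⟨k, ?_, a, rfl⟩
  rw [Finset.mem_Icc]
  omega

/-- The single-site operator `a^{(k)}` as an element of `𝒜`. -/
def site {p : ℕ} (k : ℤ) (a : Matrix (Fin p) (Fin p) ℂ) : QuasiLocal p :=
  ⟨siteOp k a, StarSubalgebra.le_topologicalClosure _ (siteOp_mem_iSup k a)⟩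

/-- The shift of configurations by `n` sites. -/
def shift {p : ℕ} (n : ℤ) : Config p ≃ Config p where
  toFun s := fun k => s (k + n)
  invFun s := fun k => s (k - n)
  left_inv s := by ext k; simp
  right_inv s := by ext k; simp

/-- The lattice translation by `n` sites on all bounded operators. -/
def translationAux {p : ℕ} (n : ℤ) :
    (ChainSpace p →L[ℂ] ChainSpace p) ≃⋆ₐ[ℂ] (ChainSpace p →L[ℂ] ChainSpace p) :=
  (permOp (shift n)).conjStarAlgEquiv

lemma translationAux_siteOp {p : ℕ} (n k : ℤ) (a : Matrix (Fin p) (Fin p) ℂ) :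
    translationAux n (siteOp k a) = siteOp (k + n) a := by
  ext ψ s
  rw [translationAux, LinearIsometryEquiv.conjStarAlgEquiv_apply_apply, permOp_apply,
    siteOp_apply, siteOp_apply]
  refine Finset.sum_congr rfl fun j _ => ?_
  rw [permOp_symm_apply]
  have hs : (shift n).symm (Function.update (shift n s) k j) = Function.update s (k + n) j := by
    funext l
    by_cases h : l = k + n
    · subst h
      simp [shift]
    · have h' : l - n ≠ k := fun h'' => h (by omega)
      simp [shift, Function.update_of_ne h, Function.update_of_ne h']
  rw [hs]
  rfl

lemma translationAux_mem {p : ℕ} (n : ℤ) {T : ChainSpace p →L[ℂ] ChainSpace p}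
    (hT : T ∈ quasiLocalAlgebra p) : translationAux n T ∈ quasiLocalAlgebra p := by
  let φ : (ChainSpace p →L[ℂ] ChainSpace p) →⋆ₐ[ℂ] (ChainSpace p →L[ℂ] ChainSpace p) :=
    StarAlgHomClass.toStarAlgHom (translationAux (p := p) n)
  have hc : Continuous φ := by
    change Continuous fun T : ChainSpace p →L[ℂ] ChainSpace p => translationAux n T
    simp only [translationAux, LinearIsometryEquiv.conjStarAlgEquiv_apply]
    fun_prop
  have key : quasiLocalAlgebra p ≤ (quasiLocalAlgebra p).comap φ := by
    refine StarSubalgebra.topologicalClosure_minimal (iSup_le fun N => ?_)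
      ((StarSubalgebra.isClosed_topologicalClosure _).preimage hc)
    refine StarAlgebra.adjoin_le ?_
    rintro _ ⟨k, -, a, rfl⟩
    refine StarSubalgebra.le_topologicalClosure _ ?_
    change translationAux n (siteOp k a) ∈ _
    rw [translationAux_siteOp]
    exact siteOp_mem_iSup _ a
  exact key hT

/-- The translation automorphism `τⁿ` of `𝒜`, with `τⁿ(a^{(k)}) = a^{(k+n)}`. -/
def translation {p : ℕ} (n : ℤ) (A : QuasiLocal p) : QuasiLocal p :=
  ⟨translationAux n (toOp A), translationAux_mem n A.2⟩

lemma translation_site {p : ℕ} (n k : ℤ) (a : Matrix (Fin p) (Fin p) ℂ) :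
    translation n (site k a) = site (k + n) a :=
  Subtype.ext (translationAux_siteOp n k a)

/-! ## States and fluctuations -/

/-- Positive normalised linear functionals on `𝒜`. -/
structure IsState {p : ℕ} (ω : QuasiLocal p →ₗ[ℂ] ℂ) : Prop where
  nonneg : ∀ A : QuasiLocal p, 0 ≤ ω (star A * A)
  map_one : ω 1 = 1

/-- Translation invariance of a functional on `𝒜`. -/
def IsTranslationInvariant {p : ℕ} (ω : QuasiLocal p →ₗ[ℂ] ℂ) : Prop :=
  ∀ A : QuasiLocal p, ω (translation 1 A) = ω A

/-- `lim_{|k| → ∞} ω(τᵏ(A) B) = ω(A) ω(B)` for all `A, B ∈ 𝒜`. -/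
def IsClustering {p : ℕ} (ω : QuasiLocal p →ₗ[ℂ] ℂ) : Prop :=
  ∀ A B : QuasiLocal p,
    Tendsto (fun k : ℤ => ω (translation k A * B)) cofinite (𝓝 (ω A * ω B))

/-- The local fluctuation
`F_N(x) = (2N+1)^{-1/2} ∑_{k=-N}^{N} (x^{(k)} - ω(x))`. -/
def fluct {p : ℕ} (ω : QuasiLocal p →ₗ[ℂ] ℂ) (N : ℕ) (x : Matrix (Fin p) (Fin p) ℂ) :
    QuasiLocal p :=
  ((1 / Real.sqrt (2 * N + 1) : ℝ) : ℂ) •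
    ∑ k ∈ Finset.Icc (-(N : ℤ)) N, (site k x - ω (site 0 x) • (1 : QuasiLocal p))

/-- The system `(ω, χ)`, `χ = {x₁, …, x_d}`, has normal quantum fluctuations: `ω` is a
translation invariant clustering state, two-point correlations are absolutely summable, and each
`F_N(x_i)` satisfies a central limit theorem. -/
structure HasNormalFluctuations {p d : ℕ} (ω : QuasiLocal p →ₗ[ℂ] ℂ)
    (x : Fin d → Matrix (Fin p) (Fin p) ℂ) : Prop where
  isState : IsState ω
  translationInvariant : IsTranslationInvariant ω
  clustering : IsClustering ω
  summable : ∀ i j, Summable fun k : ℤ =>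
    ‖ω (site 0 (x i) * translation k (site 0 (x j))) - ω (site 0 (x i)) * ω (site 0 (x j))‖
  normal : ∀ i, ∃ v : ℝ,
    Tendsto (fun N : ℕ => ω (fluct ω N (x i) ^ 2)) atTop (𝓝 (v : ℂ)) ∧
    ∀ α : ℝ, Tendsto
      (fun N : ℕ => ω (NormedSpace.exp ((Complex.I * (α : ℂ)) • fluct ω N (x i))))
      atTop (𝓝 (Complex.exp (-((α : ℂ) ^ 2 / 2) * (v : ℂ))))

/-- `(r, F_N) = ∑_i r_i F_N(x_i)`. -/
def fluctVec {p d : ℕ} (ω : QuasiLocal p →ₗ[ℂ] ℂ) (x : Fin d → Matrix (Fin p) (Fin p) ℂ)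
    (N : ℕ) (r : Fin d → ℝ) : QuasiLocal p :=
  ∑ i, (r i : ℂ) • fluct ω N (x i)

/-- The local Weyl-like operator `W_N(r) = exp(i (r, F_N))`. -/
def localWeyl {p d : ℕ} (ω : QuasiLocal p →ₗ[ℂ] ℂ) (x : Fin d → Matrix (Fin p) (Fin p) ℂ)
    (N : ℕ) (r : Fin d → ℝ) : QuasiLocal p :=
  NormedSpace.exp (Complex.I • fluctVec ω x N r)

/-- `S = Σ_ω`: `S_{ij} = lim_N ½ ω({F_N(x_i), F_N(x_j)})`. -/
def IsCovariance {p d : ℕ} (ω : QuasiLocal p →ₗ[ℂ] ℂ) (x : Fin d → Matrix (Fin p) (Fin p) ℂ)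
    (S : Matrix (Fin d) (Fin d) ℝ) : Prop :=
  ∀ i j, Tendsto (fun N : ℕ => (1 / 2 : ℂ) *
    ω (fluct ω N (x i) * fluct ω N (x j) + fluct ω N (x j) * fluct ω N (x i)))
    atTop (𝓝 (S i j : ℂ))

/-- `s = σ_ω`: `s_{ij} = -i lim_N ω([F_N(x_i), F_N(x_j)])`. -/
def IsSymplecticForm {p d : ℕ} (ω : QuasiLocal p →ₗ[ℂ] ℂ)
    (x : Fin d → Matrix (Fin p) (Fin p) ℂ) (s : Matrix (Fin d) (Fin d) ℝ) : Prop :=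
  ∀ i j, Tendsto (fun N : ℕ => -Complex.I *
    ω (fluct ω N (x i) * fluct ω N (x j) - fluct ω N (x j) * fluct ω N (x i)))
    atTop (𝓝 (s i j : ℂ))

/-! ## The microscopic dissipative dynamics -/

/-- The data of a translation invariant Lindblad generator on a chain of `p`-level spins:
a single-site Hamiltonian, `m` single-site Kraus operators, and a Kossakowski matrix `J ⊗ D`
with `J_{kl} = J(k - l)` summable. -/
structure LindbladData (p m : ℕ) where
  h : Matrix (Fin p) (Fin p) ℂ
  h_hermitian : h.IsHermitian
  v : Fin m → Matrix (Fin p) (Fin p) ℂ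
  D : Matrix (Fin m) (Fin m) ℂ
  D_posSemidef : D.PosSemidef
  J : ℤ → ℂ
  J_posSemidef : ∀ N : ℕ, (Matrix.of fun k l : Finset.Icc (-(N : ℤ)) (N : ℤ) =>
    J ((k : ℤ) - (l : ℤ))).PosSemidef
  J_zero_pos : 0 < J 0
  J_summable : Summable fun k : ℤ => ‖J k‖

/-- The map `X ↦ a X b`. -/
def sandwich {p : ℕ} (a b : QuasiLocal p) : QuasiLocal p →L[ℂ] QuasiLocal p :=
  ContinuousLinearMap.mulLeftRight ℂ (QuasiLocal p) a b

/-- `H_N = ∑_{k=-N}^{N} h^{(k)}`. -/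
def LindbladData.hamiltonian {p m : ℕ} (G : LindbladData p m) (N : ℕ) : QuasiLocal p :=
  ∑ k ∈ Finset.Icc (-(N : ℤ)) N, site k G.h

/-- The local Lindblad generator `𝕃_N = ℍ_N + 𝔻_N` (see `generator_apply`).  The formula makes
sense on all of `𝒜` and maps `𝒜_{[-N,N]}` into itself. -/
def LindbladData.generator {p m : ℕ} (G : LindbladData p m) (N : ℕ) :
    QuasiLocal p →L[ℂ] QuasiLocal p :=
  Complex.I • (sandwich (G.hamiltonian N) 1 - sandwich 1 (G.hamiltonian N)) +
  ∑ k ∈ Finset.Icc (-(N : ℤ)) N, ∑ l ∈ Finset.Icc (-(N : ℤ)) N, G.J (k - l) •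
    ∑ μ, ∑ ν, G.D μ ν •
      (sandwich (site k (G.v μ)) (site l (G.v ν)ᴴ) - (1 / 2 : ℂ) •
        (sandwich (site k (G.v μ) * site l (G.v ν)ᴴ) 1 +
          sandwich 1 (site k (G.v μ) * site l (G.v ν)ᴴ)))

lemma LindbladData.generator_apply {p m : ℕ} (G : LindbladData p m) (N : ℕ) (X : QuasiLocal p) :
    G.generator N X =
      Complex.I • (G.hamiltonian N * X - X * G.hamiltonian N) +
      ∑ k ∈ Finset.Icc (-(N : ℤ)) N, ∑ l ∈ Finset.Icc (-(N : ℤ)) N, G.J (k - l) •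
        ∑ μ, ∑ ν, G.D μ ν •
          (site k (G.v μ) * X * site l (G.v ν)ᴴ - (1 / 2 : ℂ) •
            (site k (G.v μ) * site l (G.v ν)ᴴ * X + X * (site k (G.v μ) * site l (G.v ν)ᴴ))) := by
  simp [LindbladData.generator, sandwich, sum_apply]

/-- The microscopic dissipative dynamics `Φ_t^N = exp(t 𝕃_N)`. -/
def LindbladData.evolution {p m : ℕ} (G : LindbladData p m) (N : ℕ) (t : ℝ) :
    QuasiLocal p →L[ℂ] QuasiLocal p :=
  NormedSpace.exp ((t : ℂ) • G.generator N)

/-- The locality condition: `𝕃_N[x_i^{(k)}] = ∑_j 𝓛_{ij} x_j^{(k)}` for all `N` and all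
`k ∈ [-N, N]`. -/
def LindbladData.IsLocalOn {p m d : ℕ} (G : LindbladData p m)
    (x : Fin d → Matrix (Fin p) (Fin p) ℂ) (𝓛 : Matrix (Fin d) (Fin d) ℝ) : Prop :=
  ∀ (N : ℕ), ∀ k ∈ Finset.Icc (-(N : ℤ)) N, ∀ i,
    G.generator N (site k (x i)) = ∑ j, (𝓛 i j : ℂ) • site k (x j)

/-- The state `ω` is left invariant by the microscopic dynamics:
`ω(Φ_t^N[X]) = ω(X)` for all `X ∈ 𝒜_{[-N,N]}` and `t ≥ 0`. -/
def LindbladData.Preserves {p m : ℕ} (G : LindbladData p m) (ω : QuasiLocal p →ₗ[ℂ] ℂ) : Prop :=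
  ∀ (N : ℕ) (t : ℝ), 0 ≤ t → ∀ X : QuasiLocal p,
    toOp X ∈ localAlgebra p N → ω (G.evolution N t X) = ω X

/-! ## The mesoscopic dynamics -/

/-- `𝒳_t = exp(t 𝓛)`. -/
def mesoX {d : ℕ} (𝓛 : Matrix (Fin d) (Fin d) ℝ) (t : ℝ) : Matrix (Fin d) (Fin d) ℝ :=
  NormedSpace.exp (t • 𝓛)

/-- `𝒴_t = ½ (Σ - 𝒳_t Σ 𝒳_tᵗʳ)`. -/
def mesoY {d : ℕ} (𝓛 S : Matrix (Fin d) (Fin d) ℝ) (t : ℝ) : Matrix (Fin d) (Fin d) ℝ :=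
  (1 / 2 : ℝ) • (S - mesoX 𝓛 t * S * (mesoX 𝓛 t)ᵀ)

/-- The real factor `exp(-(r, 𝒴_t r))`. -/
def damping {d : ℕ} (𝓛 S : Matrix (Fin d) (Fin d) ℝ) (t : ℝ) (r : Fin d → ℝ) : ℝ :=
  Real.exp (-(r ⬝ᵥ (mesoY 𝓛 S t *ᵥ r)))

/-- `Ψ_t[W_N(r)] = exp(-(r, 𝒴_t r)) W_N(𝒳_tᵗʳ r)`. -/
def interpolating {p d : ℕ} (ω : QuasiLocal p →ₗ[ℂ] ℂ)
    (x : Fin d → Matrix (Fin p) (Fin p) ℂ) (𝓛 S : Matrix (Fin d) (Fin d) ℝ)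
    (N : ℕ) (t : ℝ) (r : Fin d → ℝ) : QuasiLocal p :=
  (damping 𝓛 S t r : ℂ) • localWeyl ω x N ((mesoX 𝓛 t)ᵀ *ᵥ r)

/-- `Δ_N(t, r) = Ψ_t[W_N(r)] - Φ_t^N[W_N(r)]`. -/
def deviation {p m d : ℕ} (G : LindbladData p m) (ω : QuasiLocal p →ₗ[ℂ] ℂ)
    (x : Fin d → Matrix (Fin p) (Fin p) ℂ) (𝓛 S : Matrix (Fin d) (Fin d) ℝ)
    (N : ℕ) (t : ℝ) (r : Fin d → ℝ) : QuasiLocal p :=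
  interpolating ω x 𝓛 S N t r - G.evolution N t (localWeyl ω x N r)

/-! ### The Weyl algebra of fluctuations -/

/-- The Weyl algebra of the form `s` on `ℝᵈ`: the complex linear span of linearly independent
symbols `W(r)`, `r ∈ ℝᵈ`, with `W(r) W(r') = exp(-i s(r, r') / 2) W(r + r')` and
`W(r)† = W(-r)`. -/
def WeylAlgebra {d : ℕ} (_s : Matrix (Fin d) (Fin d) ℝ) : Type := (Fin d → ℝ) →₀ ℂ

namespace WeylAlgebra

variable {d : ℕ} {s : Matrix (Fin d) (Fin d) ℝ}

instance : AddCommGroup (WeylAlgebra s) := inferInstanceAs (AddCommGroup ((Fin d → ℝ) →₀ ℂ))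

instance : Module ℂ (WeylAlgebra s) := inferInstanceAs (Module ℂ ((Fin d → ℝ) →₀ ℂ))

/-- The Weyl operator `W(r)`. -/
def W (s : Matrix (Fin d) (Fin d) ℝ) (r : Fin d → ℝ) : WeylAlgebra s :=
  Finsupp.single r (1 : ℂ)

/-- The linear map out of the Weyl algebra with prescribed values on the `W(r)`. -/
def lift {M : Type*} [AddCommGroup M] [Module ℂ M] (f : (Fin d → ℝ) → M) :
    WeylAlgebra s →ₗ[ℂ] M :=
  Finsupp.linearCombination ℂ f

@[simp] lemma lift_W {M : Type*} [AddCommGroup M] [Module ℂ M] (f : (Fin d → ℝ) → M)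
    (r : Fin d → ℝ) : lift f (W s r) = f r := by
  exact (Finsupp.linearCombination_single ℂ 1 r).trans (one_smul ℂ (f r))

lemma hom_ext {M : Type*} [AddCommGroup M] [Module ℂ M] {f g : WeylAlgebra s →ₗ[ℂ] M}
    (h : ∀ r, f (W s r) = g (W s r)) : f = g :=
  Finsupp.lhom_ext' fun r => LinearMap.ext_ring (h r)

/-- The Weyl phase `exp(-i s(r, r') / 2)`. -/
def phase (s : Matrix (Fin d) (Fin d) ℝ) (r r' : Fin d → ℝ) : ℂ :=
  Complex.exp (-(Complex.I / 2) * ((r ⬝ᵥ (s *ᵥ r') : ℝ) : ℂ))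

/-- The multiplication as a bilinear map. -/
def mulMap (s : Matrix (Fin d) (Fin d) ℝ) :
    WeylAlgebra s →ₗ[ℂ] WeylAlgebra s →ₗ[ℂ] WeylAlgebra s :=
  lift fun r => lift fun r' => phase s r r' • W s (r + r')

instance : Mul (WeylAlgebra s) := ⟨fun a b => mulMap s a b⟩

instance : One (WeylAlgebra s) := ⟨W s 0⟩

instance : Star (WeylAlgebra s) :=
  ⟨fun a => Finsupp.mapRange star (star_zero ℂ) (Finsupp.mapDomain (fun r => -r) a)⟩

lemma W_mul_W (r r' : Fin d → ℝ) : W s r * W s r' = phase s r r' • W s (r + r') := by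
  change mulMap s (W s r) (W s r') = _
  simp [mulMap]

lemma star_W (r : Fin d → ℝ) : star (W s r) = W s (-r) := by
  change Finsupp.mapRange star (star_zero ℂ) (Finsupp.mapDomain (fun r => -r) (W s r)) = _
  simp [W]

lemma phase_cocycle (a b c : Fin d → ℝ) :
    phase s a b * phase s (a + b) c = phase s b c * phase s a (b + c) := by
  simp only [phase, ← Complex.exp_add, Matrix.mulVec_add, add_dotProduct, dotProduct_add]
  congr 1
  push_cast
  ring

lemma induction_W {P : WeylAlgebra s → Prop} (a : WeylAlgebra s)
    (zero : P 0) (add : ∀ a b, P a → P b → P (a + b))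
    (smul : ∀ (c : ℂ) (r : Fin d → ℝ), P (c • W s r)) : P a := by
  refine Finsupp.induction_linear (motive := fun a : (Fin d → ℝ) →₀ ℂ => P a) a zero add ?_
  intro r c
  have h : (Finsupp.single r c : (Fin d → ℝ) →₀ ℂ) = c • (Finsupp.single r (1 : ℂ)) := by simp
  rw [h]
  exact smul c r

lemma mulMap_W (r r' : Fin d → ℝ) : mulMap s (W s r) (W s r') = phase s r r' • W s (r + r') :=
  W_mul_W r r'

lemma mulMap_assoc (a b c : WeylAlgebra s) :
    mulMap s (mulMap s a b) c = mulMap s a (mulMap s b c) := by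
  induction a using induction_W with
  | zero => simp
  | add _ _ h h' => simp [h, h']
  | smul α r =>
    induction b using induction_W with
    | zero => simp
    | add _ _ h h' => simp only [map_add, LinearMap.add_apply, h, h']
    | smul β r' =>
      induction c using induction_W with
      | zero => simp
      | add _ _ h h' => simp only [map_add, h, h']
      | smul γ r'' =>
        simp only [map_smul, LinearMap.smul_apply, mulMap_W, smul_smul, add_assoc]
        congr 1
        have h := phase_cocycle (s := s) r r' r''
        linear_combination (α * β * γ) * h

lemma one_mulMap (a : WeylAlgebra s) : mulMap s (W s 0) a = a := by
  induction a using induction_W with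
  | zero => simp
  | add _ _ h h' => simp [h, h']
  | smul α r => simp [mulMap_W, phase]

lemma mulMap_one (a : WeylAlgebra s) : mulMap s a (W s 0) = a := by
  induction a using induction_W with
  | zero => simp
  | add _ _ h h' => simp [h, h']
  | smul α r => simp [mulMap_W, phase]

instance : Ring (WeylAlgebra s) where
  left_distrib a b c := map_add (mulMap s a) b c
  right_distrib a b c := by
    change mulMap s (a + b) c = mulMap s a c + mulMap s b c
    simp
  zero_mul a := by
    change mulMap s 0 a = 0
    simp
  mul_zero a := map_zero (mulMap s a)
  mul_assoc := mulMap_assoc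
  one_mul := one_mulMap
  mul_one := mulMap_one
  zsmul := fun n a => n • a
  zsmul_zero' := fun a => zero_smul ℤ a
  zsmul_succ' := fun n a => SubNegMonoid.zsmul_succ' n a
  zsmul_neg' := fun n a => SubNegMonoid.zsmul_neg' n a
  sub_eq_add_neg := sub_eq_add_neg
  neg_add_cancel := neg_add_cancel

/-- The quasi-free map `Φ_t[W(r)] = exp(-(r, 𝒴_t r)) W(𝒳_tᵗʳ r)`. -/
def quasiFreeMap (s 𝓛 S : Matrix (Fin d) (Fin d) ℝ) (t : ℝ) : WeylAlgebra s →ₗ[ℂ] WeylAlgebra s :=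
  lift fun r => (damping 𝓛 S t r : ℂ) • W s ((mesoX 𝓛 t)ᵀ *ᵥ r)

/-- Complete positivity on the Weyl `*`-algebra: `∑_{ij} b_i† Φ(a_i† a_j) b_j` is always a sum of
elements of the form `c† c`. -/
def IsCompletelyPositive (Φ : WeylAlgebra s →ₗ[ℂ] WeylAlgebra s) : Prop :=
  ∀ (n : ℕ) (a b : Fin n → WeylAlgebra s), ∃ (m : ℕ) (c : Fin m → WeylAlgebra s),
    ∑ i, ∑ j, star (b i) * Φ (star (a i) * a j) * b j = ∑ l, star (c l) * c l

end WeylAlgebra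

end SpinChain

end

open SpinChain

/-!
# Mesoscopic limit of dissipative quantum fluctuations

**Convergence.**  Write `F_N(r)` for the fluctuation `(r, F_N)`, `r_s = 𝒳_sᵗʳ r` and `Ψ_s` for
`damping(s) • W_N(r_s)`.  The deviation `Δ_s = Ψ_s - Φ_s^N[W_N(r)]` vanishes at `s = 0` and solves
`Δ' = 𝕃_N Δ + R` with source `R_s = ∂_s Ψ_s - 𝕃_N Ψ_s`.  A Lindblad generator is dissipative,
`L[Z] Z† + Z L[Z]† ≤ L[Z Z†]`, so for a positive functional `φ` the function
`s ↦ φ(exp((t - s) L)[Δ_s Δ_s†])` satisfies a Grönwall inequality, and `φ(Δ_t Δ_t†)` is controlled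
by `φ(exp((t - s) L)[R_s R_s†])` (`lindblad_perturbation_le`).  This is used with
`φ(X) = ω(W_N(a) X W_N(a)†)`.

The source is expanded in commutators of `F_N` (`exists_hasDerivAt_exp`, `exists_lindblad_exp`).
The first-order term `i 𝕃_N[F_N(r_s)]` is cancelled by `i F_N(𝓛ᵗʳ r_s)`.  The second-order terms are
averages over the box of products of single-site operators; by clustering they have vanishing
variance (`isIntensive_pairAverage`).  Each further commutator costs a factor `N^{-1/2}`, so the
remainder is small in norm.  There remains the expectation of the second-order terms.  The
invariance of the state gives `ω ∘ 𝕃_N = 0`, which expresses it through the two-point functions of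
the fluctuations, and the damping factor is such that it is cancelled in the limit
(`LindbladData.exists_rightNorm_source_le`).

The smallness in `ω` of a centred intensive observable `Y` has to be transferred to
`X ↦ ω(W_N(a) Φ_u^N[X] W_N(a)†)`.  Without `W_N(a)` this is the invariance of `ω`.  Conjugation by
`W_N(a)` moves `Φ_u^N[Y Y†]` by at most a multiple of `N^{-1/2}` times its total oscillation, the
sum over the sites of the norms of its commutators with matrix units, and the oscillation grows at
a rate that is independent of `N` because `J` is summable (`LindbladData.totalOsc_evolution_le`).

**The limits and complete positivity.**  `M_{ij} = lim ω(F_N(x_i) F_N(x_j)) = Σ + (i/2) σ` exists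
because correlations are summable.  Dissipativity and invariance applied to linear combinations of
the `F_N(x_i)` give `𝓛 M + M 𝓛ᵗʳ ≤ 0`, hence `𝒳_t M 𝒳_tᵗʳ ≤ M`.  The kernel that decides on the
complete positivity of `Φ_t` is a rank-one factor times the entrywise exponential of
`(r, (M - 𝒳_t M 𝒳_tᵗʳ) r')`, and Hadamard products preserve positive semidefiniteness.
-/

set_option maxSynthPendingDepth 3

noncomputable section

namespace SpinChain

/-! ### Lindblad semigroups on a C*-algebra -/

section AbstractLindblad

variable {A : Type*} [CStarAlgebra A]

/-- The semigroup `exp(t L)`. -/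
def semigroup (L : A →L[ℂ] A) (t : ℝ) : A →L[ℂ] A := NormedSpace.exp ((t : ℂ) • L)

lemma semigroup_zero (L : A →L[ℂ] A) : semigroup L 0 = 1 := by
  rw [semigroup, Complex.ofReal_zero, zero_smul, NormedSpace.exp_zero]

lemma hasDerivAt_semigroup (L : A →L[ℂ] A) (t : ℝ) :
    HasDerivAt (semigroup L) (L * semigroup L t) t := by
  have h := hasDerivAt_exp_smul_const' (𝕂 := ℂ) L (t : ℂ)
  have h2 := h.scomp t (Complex.ofRealCLM.hasDerivAt (x := t))
  exact h2.congr_deriv (one_smul ℂ _)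

lemma semigroup_commute (L : A →L[ℂ] A) (t : ℝ) (X : A) :
    semigroup L t (L X) = L (semigroup L t X) := by
  have h : Commute L (semigroup L t) := ((Commute.refl L).smul_right (t : ℂ)).exp_right
  exact (DFunLike.congr_fun h.eq X).symm

lemma hasDerivAt_semigroup_apply (L : A →L[ℂ] A) (X : A) (t : ℝ) :
    HasDerivAt (fun s : ℝ => semigroup L s X) (semigroup L t (L X)) t := by
  rw [semigroup_commute]
  have h := ((ContinuousLinearMap.apply ℂ A X).restrictScalars ℝ).hasFDerivAt.comp_hasDerivAt t
    (hasDerivAt_semigroup L t)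
  exact h

/-- Product rule for `s ↦ exp((T - s) L) (f s)`. -/
lemma hasDerivAt_semigroup_sub_apply (L : A →L[ℂ] A) (T : ℝ) {f : ℝ → A} {f' : A} {s : ℝ}
    (hf : HasDerivAt f f' s) :
    HasDerivAt (fun s : ℝ => semigroup L (T - s) (f s))
      (semigroup L (T - s) (f' - L (f s))) s := by
  have h1 : HasDerivAt (fun s : ℝ => semigroup L (T - s)) (-(L * semigroup L (T - s))) s := by
    exact ((hasDerivAt_semigroup L (T - s)).scomp s ((hasDerivAt_id s).const_sub T)).congr_deriv
      (neg_one_smul ℝ _)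
  have h2 : HasDerivAt (fun s : ℝ => (semigroup L (T - s)).restrictScalars ℝ)
      ((-(L * semigroup L (T - s))).restrictScalars ℝ) s :=
    (ContinuousLinearMap.restrictScalarsL ℂ A A ℝ ℝ).hasFDerivAt.comp_hasDerivAt s h1
  refine (h2.clm_apply hf).congr_deriv ?_
  have := semigroup_commute L (T - s) (f s)
  simp only [map_sub, this]
  simp
  abel

variable {ι : Type*} [Fintype ι]

/-- The Lindblad generator with Hamiltonian `H`, Kossakowski matrix `c` and Kraus operators `V`,
in the Heisenberg picture. -/
def lindblad (H : A) (c : Matrix ι ι ℂ) (V : ι → A) : A →L[ℂ] A :=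
  Complex.I • (ContinuousLinearMap.mulLeftRight ℂ A H 1 -
      ContinuousLinearMap.mulLeftRight ℂ A 1 H) +
    ∑ a, ∑ b, c a b • (ContinuousLinearMap.mulLeftRight ℂ A (V a) (star (V b)) - (1 / 2 : ℂ) •
      (ContinuousLinearMap.mulLeftRight ℂ A (V a * star (V b)) 1 +
        ContinuousLinearMap.mulLeftRight ℂ A 1 (V a * star (V b))))

lemma lindblad_apply (H : A) (c : Matrix ι ι ℂ) (V : ι → A) (X : A) :
    lindblad H c V X = Complex.I • (H * X - X * H) +
      ∑ a, ∑ b, c a b • (V a * X * star (V b) - (1 / 2 : ℂ) •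
        (V a * star (V b) * X + X * (V a * star (V b)))) := by
  simp [lindblad, sum_apply]

lemma lindblad_one (H : A) (c : Matrix ι ι ℂ) (V : ι → A) : lindblad H c V 1 = 0 := by
  rw [lindblad_apply]
  have : ∀ a b, V a * 1 * star (V b) - (1 / 2 : ℂ) •
        (V a * star (V b) * 1 + 1 * (V a * star (V b))) = 0 := by
    intro a b
    simp only [mul_one, one_mul]
    module
  simp only [this]
  simp

lemma lindblad_star {H : A} (hH : IsSelfAdjoint H) {c : Matrix ι ι ℂ} (hc : c.IsHermitian)
    (V : ι → A) (X : A) : lindblad H c V (star X) = star (lindblad H c V X) := by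
  simp only [lindblad_apply, star_add, star_sum, star_smul, star_sub, star_mul, star_star,
    hH.star_eq]
  congr 1
  · simp only [Complex.star_def, Complex.conj_I]
    module
  · rw [Finset.sum_comm]
    refine Finset.sum_congr rfl fun a _ => Finset.sum_congr rfl fun b _ => ?_
    rw [hc.apply b a]
    simp only [mul_assoc]
    congr 2
    rw [add_comm]
    simp

lemma semigroup_lindblad_one (H : A) (c : Matrix ι ι ℂ) (V : ι → A) (t : ℝ) :
    semigroup (lindblad H c V) t 1 = 1 := by
  have h : ∀ s : ℝ, HasDerivAt (fun s : ℝ => semigroup (lindblad H c V) s 1) 0 s := fun s => by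
    simpa [lindblad_one] using hasDerivAt_semigroup_apply (lindblad H c V) 1 s
  have := is_const_of_deriv_eq_zero (fun s => (h s).differentiableAt) (fun s => (h s).deriv) t 0
  simpa [semigroup_zero] using this

variable [PartialOrder A] [StarOrderedRing A]

lemma sum_posSemidef_smul_nonneg {c : Matrix ι ι ℂ} (hc : c.PosSemidef) (T : ι → A) :
    0 ≤ ∑ a, ∑ b, c a b • (T a * star (T b)) := by
  classical
  open scoped MatrixOrder in
  obtain ⟨B, hB⟩ := CStarAlgebra.nonneg_iff_eq_star_mul_self.mp hc.nonneg
  rw [Matrix.star_eq_conjTranspose] at hB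
  subst hB
  have : ∑ a, ∑ b, (Bᴴ * B) a b • (T a * star (T b)) =
      ∑ l, (∑ a, star (B l a) • T a) * star (∑ a, star (B l a) • T a) := by
    simp only [Matrix.mul_apply, Matrix.conjTranspose_apply, star_sum, star_smul, star_star,
      Finset.sum_mul_sum, Finset.sum_smul, smul_mul_smul_comm]
    rw [Finset.sum_congr rfl fun a _ => Finset.sum_comm, Finset.sum_comm]
  rw [this]
  exact Finset.sum_nonneg fun l _ => mul_star_self_nonneg _

/-- Dissipativity of a Lindblad generator: `L[Z Z†] - L[Z] Z† - Z L[Z]†` equals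
`∑ c_{ab} [V_a, Z] [V_b, Z]†`. -/
lemma lindblad_dissipative {H : A} (hH : IsSelfAdjoint H) {c : Matrix ι ι ℂ} (hc : c.PosSemidef)
    (V : ι → A) (Z : A) :
    lindblad H c V Z * star Z + Z * star (lindblad H c V Z) ≤ lindblad H c V (Z * star Z) := by
  rw [← sub_nonneg]
  have h := sum_posSemidef_smul_nonneg hc (fun a => V a * Z - Z * V a)
  refine h.trans_eq ?_
  rw [← lindblad_star hH hc.isHermitian]
  simp only [lindblad_apply, add_mul, mul_add, Finset.sum_mul, Finset.mul_sum]
  have e : ∀ a b, c a b • ((V a * Z - Z * V a) * star (V b * Z - Z * V b)) =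
      c a b • (V a * (Z * star Z) * star (V b) - (1 / 2 : ℂ) •
        (V a * star (V b) * (Z * star Z) + Z * star Z * (V a * star (V b)))) -
      (c a b • (V a * Z * star (V b) - (1 / 2 : ℂ) •
        (V a * star (V b) * Z + Z * (V a * star (V b))))) * star Z -
      Z * (c a b • (V a * star Z * star (V b) - (1 / 2 : ℂ) •
        (V a * star (V b) * star Z + star Z * (V a * star (V b))))) := by
    intro a b
    simp only [smul_mul_assoc, mul_smul_comm, ← smul_sub, star_sub, star_mul]
    congr 1
    simp only [sub_mul, mul_sub, add_mul, mul_add, smul_mul_assoc, mul_smul_comm, smul_add,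
      mul_assoc]
    module
  have e2 : Complex.I • (H * (Z * star Z) - Z * star Z * H) =
      Complex.I • (H * Z - Z * H) * star Z + Z * (Complex.I • (H * star Z - star Z * H)) := by
    simp only [smul_mul_assoc, mul_smul_comm, ← smul_add, sub_mul, mul_sub, mul_assoc]
    congr 1
    abel
  simp only [e, Finset.sum_sub_distrib, e2]
  abel

lemma exp_apply_nonneg {P : A →L[ℂ] A} (hP : ∀ X, 0 ≤ X → 0 ≤ P X) {X : A} (hX : 0 ≤ X) :
    0 ≤ NormedSpace.exp P X := by
  have h := NormedSpace.exp_series_hasSum_exp' (𝕂 := ℂ) P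
  have h2 := (ContinuousLinearMap.apply ℂ A X).hasSum h
  refine h2.nonneg fun n => ?_
  have hn : ∀ n : ℕ, 0 ≤ (P ^ n) X := by
    intro n
    induction n with
    | zero => simpa using hX
    | succ n ih => rw [pow_succ']; exact hP _ ih
  have : ((n.factorial : ℂ)⁻¹ • P ^ n) X = ((n.factorial : ℝ)⁻¹ : ℝ) • (P ^ n) X := by
    rw [← Complex.coe_smul]; simp
  change 0 ≤ ((n.factorial : ℂ)⁻¹ • P ^ n) X
  rw [this]
  exact smul_nonneg (by positivity) (hn n)

/-- A Lindblad semigroup is positive.  With `K = i H - ½ ∑ c_{ab} V_a V_b†`, the map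
`τ⁻¹ + L + τ K · K†` is completely positive for every `τ > 0`, hence so is
`exp(t (L + τ K · K†))`, and `τ → 0`. -/
theorem semigroup_lindblad_nonneg {H : A} (hH : IsSelfAdjoint H) {c : Matrix ι ι ℂ}
    (hc : c.PosSemidef) (V : ι → A) {t : ℝ} (ht : 0 ≤ t) {X : A} (hX : 0 ≤ X) :
    0 ≤ semigroup (lindblad H c V) t X := by
  set L := lindblad H c V with hL
  set Q : A := ∑ a, ∑ b, c a b • (V a * star (V b)) with hQ
  have hQs : star Q = Q := (IsSelfAdjoint.of_nonneg (sum_posSemidef_smul_nonneg hc V)).star_eq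
  set K : A := Complex.I • H - (1 / 2 : ℂ) • Q with hK
  have hKs : star K = -(Complex.I • H) - (1 / 2 : ℂ) • Q := by
    simp [hK, hQs, hH.star_eq]
  set S : A →L[ℂ] A := ContinuousLinearMap.mulLeftRight ℂ A K (star K) with hS
  have hLX : ∀ X, L X = K * X + X * star K + ∑ a, ∑ b, c a b • (V a * X * star (V b)) := by
    intro X
    rw [hKs, hK, hL, lindblad_apply, hQ]
    simp only [smul_sub, Finset.sum_sub_distrib, sub_mul, mul_sub, smul_add,
      Finset.sum_add_distrib, Finset.sum_mul, Finset.mul_sum, Finset.smul_sum, smul_mul_assoc,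
      mul_smul_comm, smul_comm (1 / 2 : ℂ), mul_neg]
    abel
  let _ : NormedAlgebra ℚ (A →L[ℂ] A) := .restrictScalars ℚ ℂ _
  have key : ∀ τ : ℝ, 0 < τ → 0 ≤ NormedSpace.exp ((t : ℂ) • (L + (τ : ℂ) • S)) X := by
    intro τ hτ
    have hpos : ∀ Y, 0 ≤ Y → 0 ≤ ((t : ℂ) • (L + (τ : ℂ) • S) + ((t / τ : ℝ) : ℂ) • 1) Y := by
      intro Y hY
      have e : ((t : ℂ) • (L + (τ : ℂ) • S) + ((t / τ : ℝ) : ℂ) • 1) Y =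
          t • (τ⁻¹ • ((1 + (τ : ℂ) • K) * Y * star (1 + (τ : ℂ) • K)) +
            ∑ a, ∑ b, c a b • (V a * Y * star (V b))) := by
        have hτ' : (τ : ℂ) ≠ 0 := by exact_mod_cast hτ.ne'
        simp only [add_apply, smul_apply,
          one_apply_eq_self, hLX, hS, ContinuousLinearMap.mulLeftRight_apply,
          ← Complex.coe_smul, star_add, star_one, star_smul, Complex.star_def, Complex.conj_ofReal,
          add_mul, mul_add, one_mul, mul_one, smul_mul_assoc, mul_smul_comm, smul_add, smul_smul,
          Complex.ofReal_div, Complex.ofReal_inv]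
        have e1 : (t : ℂ) * ((τ : ℂ)⁻¹ * τ) = t := by field_simp
        have e2 : (t : ℂ) * ((τ : ℂ)⁻¹ * (τ * τ)) = t * τ := by field_simp
        simp only [mul_assoc, e1, e2, ← div_eq_mul_inv]
        simp only [← mul_assoc]
        abel
      rw [e]
      refine smul_nonneg ht (add_nonneg (smul_nonneg (by positivity) ?_) ?_)
      · exact star_right_conjugate_nonneg hY _
      · obtain ⟨y, rfl⟩ := CStarAlgebra.nonneg_iff_eq_mul_star_self.mp hY
        have := sum_posSemidef_smul_nonneg hc (fun a => V a * y)
        simpa [mul_assoc] using this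
    have hexp : NormedSpace.exp ((t : ℂ) • (L + (τ : ℂ) • S) + ((t / τ : ℝ) : ℂ) • 1) X =
        Real.exp (t / τ) • NormedSpace.exp ((t : ℂ) • (L + (τ : ℂ) • S)) X := by
      rw [NormedSpace.exp_add_of_commute ((Commute.one_right _).smul_right _)]
      have : NormedSpace.exp (((t / τ : ℝ) : ℂ) • (1 : A →L[ℂ] A)) =
          ((Real.exp (t / τ) : ℝ) : ℂ) • 1 := by
        rw [← Algebra.algebraMap_eq_smul_one, ← NormedSpace.algebraMap_exp_comm (𝕂 := ℂ),
          ← Complex.exp_eq_exp_ℂ, ← Complex.ofReal_exp, Algebra.algebraMap_eq_smul_one]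
      rw [this, mul_smul_comm, mul_one, smul_apply, Complex.coe_smul]
    have h0 := exp_apply_nonneg hpos hX
    rw [hexp] at h0
    have h1 := smul_nonneg (Real.exp_pos (-(t / τ))).le h0
    rwa [smul_smul, ← Real.exp_add, neg_add_cancel, Real.exp_zero, one_smul] at h1
  have hcont : Continuous fun τ : ℝ => NormedSpace.exp ((t : ℂ) • (L + (τ : ℂ) • S)) X := by
    have : Continuous fun τ : ℝ => NormedSpace.exp ((t : ℂ) • (L + (τ : ℂ) • S)) :=
      NormedSpace.exp_continuous.comp (by fun_prop)
    exact (ContinuousLinearMap.apply ℂ A X).continuous.comp this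
  have hlim := (hcont.tendsto 0).mono_left (nhdsWithin_le_nhds (s := Set.Ioi 0))
  have := ge_of_tendsto hlim (eventually_mem_nhdsWithin.mono fun τ hτ => key τ hτ)
  rwa [Complex.ofReal_zero, zero_smul, add_zero] at this

end AbstractLindblad

/-! ### Seminorms of positive functionals -/

section Functional

lemma re_apply_mono {A : Type*} [CStarAlgebra A] [PartialOrder A] (φ : A →ₚ[ℂ] ℂ) {X Y : A}
    (h : X ≤ Y) : (φ X).re ≤ (φ Y).re :=
  (Complex.le_def.mp (OrderHomClass.mono φ h)).1

variable {A : Type*} [CStarAlgebra A] [PartialOrder A] [StarOrderedRing A]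

/-- The seminorm `X ↦ φ(X X†)^{1/2}` of a positive functional `φ`. -/
def rightNorm (φ : A →ₚ[ℂ] ℂ) (X : A) : ℝ := ‖φ.toPreGNS (star X)‖

lemma rightNorm_nonneg (φ : A →ₚ[ℂ] ℂ) (X : A) : 0 ≤ rightNorm φ X := norm_nonneg _

lemma rightNorm_sq (φ : A →ₚ[ℂ] ℂ) (X : A) : ((rightNorm φ X ^ 2 : ℝ) : ℂ) = φ (X * star X) := by
  have := φ.preGNS_norm_sq (φ.toPreGNS (star X))
  simpa [rightNorm] using this

lemma rightNorm_sq_re (φ : A →ₚ[ℂ] ℂ) (X : A) : rightNorm φ X ^ 2 = (φ (X * star X)).re := by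
  rw [← rightNorm_sq, Complex.ofReal_re]

lemma rightNorm_add_le (φ : A →ₚ[ℂ] ℂ) (X Y : A) :
    rightNorm φ (X + Y) ≤ rightNorm φ X + rightNorm φ Y := by
  simp only [rightNorm, star_add, map_add]
  exact norm_add_le _ _

lemma rightNorm_sum_le (φ : A →ₚ[ℂ] ℂ) {ι : Type*} (s : Finset ι) (f : ι → A) :
    rightNorm φ (∑ i ∈ s, f i) ≤ ∑ i ∈ s, rightNorm φ (f i) := by
  simp only [rightNorm, star_sum, map_sum]
  exact norm_sum_le _ _

lemma rightNorm_smul (φ : A →ₚ[ℂ] ℂ) (z : ℂ) (X : A) :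
    rightNorm φ (z • X) = ‖z‖ * rightNorm φ X := by
  simp only [rightNorm, star_smul, map_smul, norm_smul, norm_star]

lemma rightNorm_mul_unitary (φ : A →ₚ[ℂ] ℂ) (X : A) {U : A} (hU : U * star U = 1) :
    rightNorm φ (X * U) = rightNorm φ X := by
  rw [← sq_eq_sq₀ (rightNorm_nonneg _ _) (rightNorm_nonneg _ _), rightNorm_sq_re, rightNorm_sq_re]
  congr 2
  rw [star_mul, mul_assoc, ← mul_assoc U, hU, one_mul]

/-- Cauchy–Schwarz inequality. -/
lemma norm_apply_mul_le (φ : A →ₚ[ℂ] ℂ) (X Y : A) :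
    ‖φ (X * Y)‖ ≤ rightNorm φ X * rightNorm φ (star Y) := by
  have h := norm_inner_le_norm (𝕜 := ℂ) (φ.toPreGNS (star X)) (φ.toPreGNS Y)
  rw [φ.preGNS_inner_def] at h
  simpa [rightNorm] using h

lemma rightNorm_le_norm (φ : A →ₚ[ℂ] ℂ) (hφ : φ 1 = 1) (X : A) : rightNorm φ X ≤ ‖X‖ := by
  rw [← sq_le_sq₀ (rightNorm_nonneg _ _) (norm_nonneg _), rightNorm_sq_re]
  have h := φ.norm_apply_le_of_nonneg (X * star X) (mul_star_self_nonneg X)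
  rw [hφ, norm_one, one_mul, CStarRing.norm_self_mul_star, ← sq] at h
  exact (Complex.re_le_norm _).trans h

lemma norm_apply_le_norm (φ : A →ₚ[ℂ] ℂ) (hφ : φ 1 = 1) (X : A) : ‖φ X‖ ≤ ‖X‖ := by
  have h := norm_apply_mul_le φ X 1
  rw [mul_one, star_one] at h
  have h1 : rightNorm φ 1 = 1 := by
    rw [← sq_eq_sq₀ (rightNorm_nonneg _ _) zero_le_one, rightNorm_sq_re]
    simp [hφ]
  rw [h1, mul_one] at h
  exact h.trans (rightNorm_le_norm φ hφ X)

/-- The positive functional `X ↦ φ(U P(X) U†)` for a positive map `P`. -/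
def conjFunctional (φ : A →ₚ[ℂ] ℂ) (P : A →L[ℂ] A) (hP : ∀ X, 0 ≤ X → 0 ≤ P X) (U : A) :
    A →ₚ[ℂ] ℂ :=
  PositiveLinearMap.mk₀
    (φ.toLinearMap ∘ₗ (ContinuousLinearMap.mulLeftRight ℂ A U (star U)).toLinearMap ∘ₗ
      P.toLinearMap)
    fun X hX => φ.map_nonneg (star_right_conjugate_nonneg (hP X hX) U)

lemma conjFunctional_apply (φ : A →ₚ[ℂ] ℂ) (P : A →L[ℂ] A) (hP : ∀ X, 0 ≤ X → 0 ≤ P X) (U X : A) :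
    conjFunctional φ P hP U X = φ (U * P X * star U) := rfl

end Functional

/-! ### Perturbations of a Lindblad evolution -/

section LindbladEstimates

variable {A : Type*} [CStarAlgebra A] [PartialOrder A] [StarOrderedRing A]
variable {ι : Type*} [Fintype ι]

/-- A positive unital map is bounded by `4`: decompose into four positive parts. -/
lemma norm_le_four_of_positive_unital {P : A →L[ℂ] A} (hP : ∀ X, 0 ≤ X → 0 ≤ P X)
    (h1 : P 1 = 1) (X : A) : ‖P X‖ ≤ 4 * ‖X‖ := by
  nontriviality A
  have h0 : ∀ Y : A, 0 ≤ Y → ‖P Y‖ ≤ ‖Y‖ := by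
    intro Y hY
    have := (PositiveLinearMap.mk₀ P.toLinearMap hP).norm_apply_le_of_nonneg Y hY
    change ‖P Y‖ ≤ ‖P 1‖ * ‖Y‖ at this
    rwa [h1, norm_one, one_mul] at this
  obtain ⟨y, hy, hyn, e⟩ := CStarAlgebra.exists_sum_four_nonneg X
  conv_lhs => rw [e]
  rw [map_sum]
  refine (norm_sum_le _ _).trans ?_
  refine (Finset.sum_le_card_nsmul _ _ ‖X‖ fun i _ => ?_).trans_eq (by simp)
  rw [map_smul, norm_smul, norm_pow, Complex.norm_I, one_pow, one_mul]
  exact (h0 _ (hy i)).trans (hyn i)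

/-- Stability of `f' = L f` under a perturbation `R`, in the seminorm of a positive functional
`φ`.  By dissipativity, `g(s) = φ(exp((t-s)L)[f(s) f(s)†])` satisfies
`g' ≤ g + φ(exp((t-s)L)[R R†])`. -/
theorem lindblad_perturbation_le {H : A} (hH : IsSelfAdjoint H) {c : Matrix ι ι ℂ}
    (hc : c.PosSemidef) (V : ι → A) (φ : A →ₚ[ℂ] ℂ) (hφ : Continuous φ) {t : ℝ} (ht : 0 ≤ t)
    {f R : ℝ → A} (hf : ∀ s, HasDerivAt f (lindblad H c V (f s) + R s) s) (hf0 : f 0 = 0)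
    {C : ℝ} (hR : ∀ s ∈ Set.Icc 0 t,
      (φ (semigroup (lindblad H c V) (t - s) (R s * star (R s)))).re ≤ C) :
    (φ (f t * star (f t))).re ≤ C * t * Real.exp t := by
  set L := lindblad H c V with hL
  set φr : A →L[ℝ] ℝ := Complex.reCLM.comp
    ((⟨φ.toLinearMap, hφ⟩ : A →L[ℂ] ℂ).restrictScalars ℝ) with hφr
  have hφr_apply : ∀ X, φr X = (φ X).re := fun X => rfl
  set g : ℝ → ℝ := fun s => φr (semigroup L (t - s) (f s * star (f s))) with hg
  set D : ℝ → A := fun s => (L (f s) + R s) * star (f s) + f s * star (L (f s) + R s) with hD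
  have hgd : ∀ s, HasDerivAt g (φr (semigroup L (t - s) (D s - L (f s * star (f s))))) s := by
    intro s
    have h1 : HasDerivAt (fun s => star (f s)) (star (L (f s) + R s)) s :=
      (starL' ℝ (A := A)).hasFDerivAt.comp_hasDerivAt s (hf s)
    exact φr.hasFDerivAt.comp_hasDerivAt s
      (hasDerivAt_semigroup_sub_apply L t ((hf s).mul h1))
  have hbound : ∀ s ∈ Set.Icc 0 t,
      φr (semigroup L (t - s) (D s - L (f s * star (f s)))) ≤ g s + C := by
    intro s hs
    have h2 : D s - L (f s * star (f s)) ≤ f s * star (f s) + R s * star (R s) := by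
      have hd := lindblad_dissipative hH hc V (f s)
      rw [← hL] at hd
      have hsq : 0 ≤ (f s - R s) * star (f s - R s) := mul_star_self_nonneg _
      have e : f s * star (f s) + R s * star (R s) - (D s - L (f s * star (f s))) =
          (L (f s * star (f s)) - (L (f s) * star (f s) + f s * star (L (f s)))) +
          (f s - R s) * star (f s - R s) := by
        simp only [hD, star_add, star_sub]
        noncomm_ring
      rw [← sub_nonneg, e]
      exact add_nonneg (sub_nonneg.mpr hd) hsq
    have h3 : semigroup L (t - s) (D s - L (f s * star (f s))) ≤
        semigroup L (t - s) (f s * star (f s) + R s * star (R s)) := by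
      rw [← sub_nonneg, ← map_sub]
      exact semigroup_lindblad_nonneg hH hc V (sub_nonneg.mpr hs.2) (sub_nonneg.mpr h2)
    have h4 := re_apply_mono φ h3
    rw [map_add, map_add, Complex.add_re] at h4
    have h5 := hR s hs
    simp only [hg, hφr_apply]
    linarith
  have hC : 0 ≤ C := by
    refine le_trans ?_ (hR 0 ⟨le_rfl, ht⟩)
    have := φ.map_nonneg (semigroup_lindblad_nonneg hH hc V (sub_nonneg.mpr ht)
      (mul_star_self_nonneg (R 0)))
    exact (Complex.le_def.mp this).1
  -- `exp(-s) g(s) - C s` is nonincreasing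
  set k : ℝ → ℝ := fun s => Real.exp (-s) * g s - C * s with hk
  have hkd : ∀ s, HasDerivAt k (Real.exp (-s) *
      (φr (semigroup L (t - s) (D s - L (f s * star (f s)))) - g s) - C) s := by
    intro s
    have h1 : HasDerivAt (fun s : ℝ => Real.exp (-s)) (-Real.exp (-s)) s := by
      exact ((Real.hasDerivAt_exp (-s)).comp s (hasDerivAt_neg s)).congr_deriv (by ring)
    refine ((h1.mul (hgd s)).sub ((hasDerivAt_id s).const_mul C)).congr_deriv ?_
    ring
  have hanti : AntitoneOn k (Set.Icc 0 t) := by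
    refine antitoneOn_of_deriv_nonpos (convex_Icc 0 t)
      (fun s _ => (hkd s).continuousAt.continuousWithinAt)
      (fun s _ => (hkd s).differentiableAt.differentiableWithinAt) fun s hs => ?_
    rw [interior_Icc] at hs
    rw [(hkd s).deriv]
    have h1 := hbound s ⟨hs.1.le, hs.2.le⟩
    have h2 : Real.exp (-s) ≤ 1 := Real.exp_le_one_iff.mpr (by linarith [hs.1])
    nlinarith [Real.exp_pos (-s)]
  have h := hanti ⟨le_rfl, ht⟩ ⟨ht, le_rfl⟩ ht
  have hg0 : g 0 = 0 := by simp [hg, hf0]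
  have hgt : g t = (φ (f t * star (f t))).re := by
    simp [hg, hφr_apply, semigroup_zero]
  simp only [hk, hg0, hgt, mul_zero, sub_zero] at h
  have h3 : Real.exp (-t) * (φ (f t * star (f t))).re ≤ C * t := by linarith
  calc (φ (f t * star (f t))).re
      = Real.exp t * (Real.exp (-t) * (φ (f t * star (f t))).re) := by
        rw [← mul_assoc, ← Real.exp_add, add_neg_cancel, Real.exp_zero, one_mul]
    _ ≤ Real.exp t * (C * t) := by gcongr
    _ = C * t * Real.exp t := by ring

end LindbladEstimates

/-! ### Exponentials of skew-adjoint elements -/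

section ExpEstimates

variable {A : Type*} [CStarAlgebra A]

lemma hasDerivAt_exp_real_smul (a : A) (θ : ℝ) :
    HasDerivAt (fun θ : ℝ => NormedSpace.exp (θ • a)) (NormedSpace.exp (θ • a) * a) θ :=
  hasDerivAt_exp_smul_const (𝕂 := ℝ) a θ

lemma exp_smul_mul_exp_neg (a : A) (θ : ℝ) :
    NormedSpace.exp (θ • a) * NormedSpace.exp (-(θ • a)) = 1 := by
  let _ : NormedAlgebra ℚ A := .restrictScalars ℚ ℂ A
  rw [← NormedSpace.exp_add_of_commute (Commute.refl _).neg_right, add_neg_cancel,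
    NormedSpace.exp_zero]

lemma exp_mul_exp_neg (a : A) : NormedSpace.exp a * NormedSpace.exp (-a) = 1 := by
  simpa using exp_smul_mul_exp_neg a 1

lemma exp_neg_mul_exp (a : A) : NormedSpace.exp (-a) * NormedSpace.exp a = 1 := by
  simpa using exp_mul_exp_neg (-a)

lemma star_exp_of_skew {a : A} (ha : star a = -a) :
    star (NormedSpace.exp a) = NormedSpace.exp (-a) := by
  rw [NormedSpace.star_exp, ha]

/-- The exponential of a skew-adjoint element, as a unitary. -/
def expUnitary (a : A) (ha : star a = -a) : unitary A :=
  ⟨NormedSpace.exp a, by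
    rw [Unitary.mem_iff, star_exp_of_skew ha]
    exact ⟨exp_neg_mul_exp a, exp_mul_exp_neg a⟩⟩

lemma norm_exp_mul {a : A} (ha : star a = -a) (X : A) : ‖NormedSpace.exp a * X‖ = ‖X‖ :=
  CStarRing.norm_coe_unitary_mul (expUnitary a ha) X

lemma norm_mul_exp {a : A} (ha : star a = -a) (X : A) : ‖X * NormedSpace.exp a‖ = ‖X‖ :=
  CStarRing.norm_mul_coe_unitary X (expUnitary a ha)

lemma star_smul_skew {a : A} (ha : star a = -a) (θ : ℝ) : star (θ • a) = -(θ • a) := by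
  simp [ha]

/-- The one-parameter automorphism group `H ↦ e^{θ a} H e^{-θ a}`. -/
def expConj (a : A) (θ : ℝ) (H : A) : A :=
  NormedSpace.exp (θ • a) * H * NormedSpace.exp (-(θ • a))

lemma expConj_zero (a H : A) : expConj a 0 H = H := by
  simp [expConj, NormedSpace.exp_zero]

lemma norm_expConj {a : A} (ha : star a = -a) (θ : ℝ) (H : A) : ‖expConj a θ H‖ = ‖H‖ := by
  have h2 : star (-(θ • a)) = - -(θ • a) := by rw [star_neg, star_smul_skew ha]
  rw [expConj, norm_mul_exp h2, norm_exp_mul (star_smul_skew ha θ)]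

lemma hasDerivAt_exp_mul_exp (a b H : A) (θ : ℝ) :
    HasDerivAt (fun θ : ℝ => NormedSpace.exp (θ • b) * H * NormedSpace.exp (-(θ • a)))
      (NormedSpace.exp (θ • b) * (b * H - H * a) * NormedSpace.exp (-(θ • a))) θ := by
  have h1 := hasDerivAt_exp_real_smul b θ
  have h2 : HasDerivAt (fun θ : ℝ => NormedSpace.exp (-(θ • a)))
      (-a * NormedSpace.exp (-(θ • a))) θ := by
    have := hasDerivAt_exp_smul_const' (𝕂 := ℝ) (-a) θ
    simpa only [smul_neg] using this
  refine ((h1.mul_const H).mul h2).congr_deriv ?_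
  noncomm_ring

lemma hasDerivAt_expConj (a H : A) (θ : ℝ) :
    HasDerivAt (fun θ : ℝ => expConj a θ H) (expConj a θ ⁅a, H⁆) θ :=
  hasDerivAt_exp_mul_exp a a H θ

lemma norm_sub_le_of_hasDerivAt {f f' : ℝ → A} (hf : ∀ θ, HasDerivAt f (f' θ) θ) {C : ℝ}
    (hC : ∀ θ ∈ Set.Icc (0 : ℝ) 1, ‖f' θ‖ ≤ C) {θ : ℝ} (hθ : θ ∈ Set.Icc (0 : ℝ) 1) :
    ‖f θ - f 0‖ ≤ C := by
  have h := norm_image_sub_le_of_norm_deriv_le_segment' (a := 0) (b := 1) (C := C)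
    (fun s _ => (hf s).hasDerivWithinAt) (fun s hs => hC s ⟨hs.1, hs.2.le⟩) θ hθ
  have hC0 : 0 ≤ C := (norm_nonneg _).trans (hC 0 ⟨le_rfl, zero_le_one⟩)
  nlinarith [hθ.1, hθ.2]

lemma norm_expConj_sub_le {a : A} (ha : star a = -a) (H : A) {θ : ℝ}
    (hθ : θ ∈ Set.Icc (0 : ℝ) 1) : ‖expConj a θ H - H‖ ≤ ‖⁅a, H⁆‖ := by
  have h := norm_sub_le_of_hasDerivAt (fun θ => hasDerivAt_expConj a H θ)
    (fun θ _ => (norm_expConj ha θ _).le) hθ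
  rwa [expConj_zero] at h

lemma norm_expConj_sub_sub_le {a : A} (ha : star a = -a) (H : A) {θ : ℝ}
    (hθ : θ ∈ Set.Icc (0 : ℝ) 1) :
    ‖expConj a θ H - H - θ • ⁅a, H⁆‖ ≤ ‖⁅a, ⁅a, H⁆⁆‖ := by
  have hd : ∀ θ : ℝ, HasDerivAt (fun θ : ℝ => expConj a θ H - θ • ⁅a, H⁆)
      (expConj a θ ⁅a, H⁆ - ⁅a, H⁆) θ := by
    intro θ
    simpa using (hasDerivAt_expConj a H θ).fun_sub ((hasDerivAt_id θ).smul_const ⁅a, H⁆)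
  have h := norm_sub_le_of_hasDerivAt hd
    (fun θ hθ => norm_expConj_sub_le ha ⁅a, H⁆ hθ) hθ
  rw [expConj_zero, zero_smul, sub_zero] at h
  rwa [sub_right_comm]

/-- Second order expansion of `e^a H e^{-a}`. -/
lemma norm_expConj_taylor_le {a : A} (ha : star a = -a) (H : A) :
    ‖expConj a 1 H - H - ⁅a, H⁆ - (1 / 2 : ℝ) • ⁅a, ⁅a, H⁆⁆‖ ≤ ‖⁅a, ⁅a, ⁅a, H⁆⁆⁆‖ := by
  have hd : ∀ θ : ℝ, HasDerivAt
      (fun θ : ℝ => expConj a θ H - θ • ⁅a, H⁆ - (θ ^ 2 / 2) • ⁅a, ⁅a, H⁆⁆)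
      (expConj a θ ⁅a, H⁆ - ⁅a, H⁆ - θ • ⁅a, ⁅a, H⁆⁆) θ := by
    intro θ
    have h2 : HasDerivAt (fun θ : ℝ => θ ^ 2 / 2) θ θ := by
      simpa using ((hasDerivAt_id θ).fun_pow 2).div_const 2
    simpa using ((hasDerivAt_expConj a H θ).fun_sub
      ((hasDerivAt_id θ).smul_const ⁅a, H⁆)).fun_sub (h2.smul_const ⁅a, ⁅a, H⁆⁆)
  have h := norm_sub_le_of_hasDerivAt hd
    (fun θ hθ => norm_expConj_sub_sub_le ha ⁅a, H⁆ hθ) (θ := 1) ⟨zero_le_one, le_rfl⟩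
  convert h using 2
  simp only [expConj_zero, one_smul, zero_smul, sub_zero]
  norm_num
  abel

lemma norm_exp_sub_exp_le {a b : A} (ha : star a = -a) (hb : star b = -b) :
    ‖NormedSpace.exp b - NormedSpace.exp a‖ ≤ ‖b - a‖ := by
  have hd : ∀ θ : ℝ, HasDerivAt
      (fun θ : ℝ => NormedSpace.exp (θ • b) * NormedSpace.exp (-(θ • a)))
      (NormedSpace.exp (θ • b) * (b - a) * NormedSpace.exp (-(θ • a))) θ := fun θ => by
    simpa using hasDerivAt_exp_mul_exp a b 1 θ
  have h := norm_sub_le_of_hasDerivAt hd (C := ‖b - a‖) (fun θ _ => by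
    have h2 : star (-(θ • a)) = - -(θ • a) := by rw [star_neg, star_smul_skew ha]
    rw [norm_mul_exp h2, norm_exp_mul (star_smul_skew hb θ)]) (θ := 1) ⟨zero_le_one, le_rfl⟩
  simp only [one_smul, zero_smul, neg_zero, NormedSpace.exp_zero, mul_one] at h
  have e : NormedSpace.exp b - NormedSpace.exp a =
      (NormedSpace.exp b * NormedSpace.exp (-a) - 1) * NormedSpace.exp a := by
    rw [sub_mul, mul_assoc, exp_neg_mul_exp, mul_one, one_mul]
  rw [e, norm_mul_exp ha]
  exact h

/-- Increment of the exponential in the direction `b`, up to a double commutator and terms of order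
`h ^ 2`.  The bound involves `a` only through its commutators with `b`, so it is useful also when
`‖a‖` is large. -/
lemma norm_exp_add_smul_sub_le {a b : A} (ha : star a = -a) (hb : star b = -b) {h : ℝ}
    (hh : 0 ≤ h) :
    ‖NormedSpace.exp (a + h • b) - NormedSpace.exp a -
      h • ((b + (1 / 2 : ℝ) • ⁅a, b⁆) * NormedSpace.exp a)‖ ≤
      h * (‖⁅a, ⁅a, b⁆⁆‖ + h * ‖b‖ * ‖b‖) := by
  set w := a + h • b with hw
  have hws : star w = -w := by simp [hw, ha, hb, add_comm]
  have hd : ∀ θ : ℝ, HasDerivAt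
      (fun θ : ℝ => NormedSpace.exp (θ • w) * NormedSpace.exp (-(θ • a)) -
        h • (θ • b + (θ ^ 2 / 2) • ⁅a, b⁆))
      (h • ((expConj a θ b - b - θ • ⁅a, b⁆) +
        (NormedSpace.exp (θ • w) - NormedSpace.exp (θ • a)) * b *
          NormedSpace.exp (-(θ • a)))) θ := by
    intro θ
    have h2 : HasDerivAt (fun θ : ℝ => θ ^ 2 / 2) θ θ := by
      simpa using ((hasDerivAt_id θ).fun_pow 2).div_const 2
    have h1 := hasDerivAt_exp_mul_exp a w 1 θ
    simp only [mul_one, one_mul] at h1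
    refine (h1.fun_sub ((((hasDerivAt_id θ).smul_const b).fun_add
      (h2.smul_const ⁅a, b⁆)).fun_const_smul h)).congr_deriv ?_
    have e : w - a = h • b := by simp [hw]
    rw [e, expConj]
    simp only [mul_smul_comm, smul_mul_assoc, ← smul_sub, one_smul, sub_mul]
    congr 1
    abel
  have hb := norm_sub_le_of_hasDerivAt hd (C := h * (‖⁅a, ⁅a, b⁆⁆‖ + h * ‖b‖ * ‖b‖))
    (fun θ hθ => by
      have h2 : star (-(θ • a)) = - -(θ • a) := by rw [star_neg, star_smul_skew ha]
      rw [norm_smul, Real.norm_of_nonneg hh]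
      gcongr
      refine (norm_add_le _ _).trans (add_le_add (norm_expConj_sub_sub_le ha b hθ) ?_)
      rw [norm_mul_exp h2]
      refine (norm_mul_le _ _).trans ?_
      gcongr
      refine (norm_exp_sub_exp_le (star_smul_skew ha θ) (star_smul_skew hws θ)).trans ?_
      rw [← smul_sub, hw, add_sub_cancel_left, norm_smul, norm_smul, Real.norm_of_nonneg hh,
        Real.norm_of_nonneg hθ.1]
      exact mul_le_of_le_one_left (by positivity) hθ.2) (θ := 1) ⟨zero_le_one, le_rfl⟩
  refine le_of_eq_of_le ?_ hb
  rw [← norm_mul_exp ha (NormedSpace.exp ((1 : ℝ) • w) * NormedSpace.exp (-((1 : ℝ) • a)) - _ - _)]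
  simp only [one_smul, zero_smul, neg_zero, NormedSpace.exp_zero, mul_one, sub_mul, mul_assoc,
    exp_neg_mul_exp, one_mul, smul_mul_assoc]
  congr 1
  norm_num [NormedSpace.exp_zero]
  abel

/-- Derivative of the exponential along a path through a skew-adjoint element, with
an error given by a double commutator. -/
theorem exists_hasDerivAt_exp {a : ℝ → A} {b : A} {s : ℝ} (hd : HasDerivAt a b s)
    (ha : star (a s) = -(a s)) (hb : star b = -b) :
    ∃ T : A, HasDerivAt (fun u => NormedSpace.exp (a u)) (T * NormedSpace.exp (a s)) s ∧
      ‖T - b - (1 / 2 : ℝ) • ⁅a s, b⁆‖ ≤ ‖⁅a s, ⁅a s, b⁆⁆‖ := by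
  have hF := (NormedSpace.exp_analytic (𝕂 := ℝ) (a s)).differentiableAt.hasFDerivAt
  set F := fderiv ℝ (NormedSpace.exp : A → A) (a s) with hFdef
  have h1 : HasDerivAt (fun u => NormedSpace.exp (a u)) (F b) s := hF.comp_hasDerivAt s hd
  have hexp : F b = F b * NormedSpace.exp (-(a s)) * NormedSpace.exp (a s) := by
    rw [mul_assoc, exp_neg_mul_exp, mul_one]
  refine ⟨F b * NormedSpace.exp (-(a s)), hexp ▸ h1, ?_⟩
  have hline : HasDerivAt (fun h : ℝ => NormedSpace.exp (a s + h • b)) (F b) 0 := by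
    have h2 : HasDerivAt (fun h : ℝ => a s + h • b) b 0 := by
      simpa using ((hasDerivAt_id (0 : ℝ)).smul_const b).const_add (a s)
    have h3 : HasFDerivAt (NormedSpace.exp : A → A) F (a s + (0 : ℝ) • b) := by simpa using hF
    exact h3.comp_hasDerivAt (0 : ℝ) h2
  have hlim := (hasDerivAt_iff_tendsto_slope_zero.mp hline).mono_left
    (nhdsWithin_mono (0 : ℝ) (s := Set.Ioi 0) fun h hh => ne_of_gt hh)
  set D := (b + (1 / 2 : ℝ) • ⁅a s, b⁆) * NormedSpace.exp (a s) with hD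
  have hlim2 : Tendsto (fun h : ℝ => ‖⁅a s, ⁅a s, b⁆⁆‖ + h * ‖b‖ * ‖b‖) (𝓝[>] 0)
      (𝓝 ‖⁅a s, ⁅a s, b⁆⁆‖) := by
    have : Tendsto (fun h : ℝ => ‖⁅a s, ⁅a s, b⁆⁆‖ + h * ‖b‖ * ‖b‖) (𝓝 0)
        (𝓝 (‖⁅a s, ⁅a s, b⁆⁆‖ + 0 * ‖b‖ * ‖b‖)) := by
      apply Continuous.tendsto
      fun_prop
    simp only [zero_mul, add_zero] at this
    exact this.mono_left nhdsWithin_le_nhds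
  have hle := le_of_tendsto_of_tendsto (hlim.sub_const D).norm hlim2
    (eventually_mem_nhdsWithin.mono fun h (hh : (0 : ℝ) < h) => by
      have h3 := norm_exp_add_smul_sub_le ha hb hh.le
      have e : h⁻¹ • (NormedSpace.exp (a s + (0 + h) • b) -
          NormedSpace.exp (a s + (0 : ℝ) • b)) - D =
          h⁻¹ • (NormedSpace.exp (a s + h • b) - NormedSpace.exp (a s) - h • D) := by
        simp only [zero_add, zero_smul, add_zero]
        rw [smul_sub _ _ (h • D), smul_smul, inv_mul_cancel₀ hh.ne', one_smul]
      change ‖h⁻¹ • (NormedSpace.exp (a s + (0 + h) • b) -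
          NormedSpace.exp (a s + (0 : ℝ) • b)) - D‖ ≤ _
      rw [e, norm_smul, norm_inv, Real.norm_of_nonneg hh.le, inv_mul_le_iff₀ hh]
      exact h3)
  have e2 : F b - D = (F b * NormedSpace.exp (-(a s)) - b - (1 / 2 : ℝ) • ⁅a s, b⁆) *
      NormedSpace.exp (a s) := by
    rw [hD, sub_mul, sub_mul, add_mul, ← hexp]
    abel
  rwa [e2, norm_mul_exp ha] at hle

end ExpEstimates

/-! ### Single-site operators and translations -/

section Sites

variable {p : ℕ}

instance : PartialOrder (QuasiLocal p) := CStarAlgebra.spectralOrder _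

instance : StarOrderedRing (QuasiLocal p) := CStarAlgebra.spectralOrderedRing _

lemma toOp_injective : Function.Injective (toOp (p := p)) := Subtype.val_injective

lemma toOp_site (k : ℤ) (a : Matrix (Fin p) (Fin p) ℂ) : toOp (site k a) = siteOp k a := rfl

lemma siteOp_mul (k : ℤ) (a b : Matrix (Fin p) (Fin p) ℂ) :
    siteOp k (a * b) = siteOp k a * siteOp k b := by
  ext ψ s
  rw [mul_apply_eq_comp, siteOp_apply, siteOp_apply]
  simp only [siteOp_apply, Function.update_self, Function.update_idem, Matrix.mul_apply,
    Finset.mul_sum, Finset.sum_mul]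
  rw [Finset.sum_comm]
  simp only [mul_assoc]

lemma siteOp_one (k : ℤ) : siteOp k (1 : Matrix (Fin p) (Fin p) ℂ) = 1 := by
  ext ψ s
  rw [siteOp_apply, one_apply_eq_self]
  simp [Matrix.one_apply]

lemma siteOp_add (k : ℤ) (a b : Matrix (Fin p) (Fin p) ℂ) :
    siteOp k (a + b) = siteOp k a + siteOp k b := by
  simp only [siteOp, Matrix.add_apply, add_smul, Finset.sum_add_distrib]

lemma siteOp_smul (k : ℤ) (z : ℂ) (a : Matrix (Fin p) (Fin p) ℂ) :
    siteOp k (z • a) = z • siteOp k a := by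
  simp only [siteOp, Matrix.smul_apply, smul_assoc, Finset.smul_sum]

lemma siteOp_commute {k l : ℤ} (h : k ≠ l) (a b : Matrix (Fin p) (Fin p) ℂ) :
    siteOp k a * siteOp l b = siteOp l b * siteOp k a := by
  ext ψ s
  simp only [mul_apply_eq_comp, siteOp_apply, Finset.mul_sum]
  rw [Finset.sum_comm]
  refine Finset.sum_congr rfl fun i _ => Finset.sum_congr rfl fun j _ => ?_
  rw [Function.update_of_ne h.symm, Function.update_of_ne h, Function.update_comm h]
  ring

lemma star_levelProj (k : ℤ) (i : Fin p) :
    star (levelProj k i : ChainSpace p →L[ℂ] ChainSpace p) = levelProj k i := by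
  rw [ContinuousLinearMap.star_eq_adjoint]
  refine ((ContinuousLinearMap.eq_adjoint_iff _ _).mpr fun ψ φ => ?_).symm
  rw [lp.inner_eq_tsum, lp.inner_eq_tsum]
  refine tsum_congr fun s => ?_
  simp only [levelProj_apply]
  split_ifs <;> simp

lemma star_permOp (e : Config p ≃ Config p) :
    star ((permOp e).toContinuousLinearEquiv : ChainSpace p →L[ℂ] ChainSpace p) =
      ((permOp e).symm.toContinuousLinearEquiv : ChainSpace p →L[ℂ] ChainSpace p) := by
  rw [ContinuousLinearMap.star_eq_adjoint]
  exact LinearIsometryEquiv.adjoint_eq_symm (permOp e)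

lemma siteOp_star (k : ℤ) (a : Matrix (Fin p) (Fin p) ℂ) :
    star (siteOp k a) = siteOp k aᴴ := by
  simp only [siteOp, star_sum, star_smul]
  rw [Finset.sum_comm]
  refine Finset.sum_congr rfl fun j _ => Finset.sum_congr rfl fun i _ => ?_
  rw [Matrix.conjTranspose_apply]
  congr 1
  change star (levelProj k i * ((permOp (levelSwap k i j)).toContinuousLinearEquiv :
    ChainSpace p →L[ℂ] ChainSpace p)) = _
  rw [star_mul, star_levelProj, star_permOp]
  ext ψ s
  change (if (levelSwap k i j).symm s k = i then ψ ((levelSwap k i j).symm s) else 0) =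
    if s k = j then ψ (levelSwap k j i s) else 0
  simp [levelSwap, Equiv.swap_comm i j, Equiv.swap_apply_eq_iff]

lemma site_mul (k : ℤ) (a b : Matrix (Fin p) (Fin p) ℂ) :
    site k (a * b) = site k a * site k b :=
  toOp_injective (by simp only [map_mul, toOp_site, siteOp_mul])

lemma site_one (k : ℤ) : site k (1 : Matrix (Fin p) (Fin p) ℂ) = 1 :=
  toOp_injective (by simp only [map_one, toOp_site, siteOp_one])

lemma site_star (k : ℤ) (a : Matrix (Fin p) (Fin p) ℂ) : star (site k a) = site k aᴴ :=
  toOp_injective (by simp only [map_star, toOp_site, siteOp_star])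

/-- `a ↦ a^{(k)}` as a linear map. -/
def siteLin (k : ℤ) : Matrix (Fin p) (Fin p) ℂ →ₗ[ℂ] QuasiLocal p where
  toFun := site k
  map_add' a b := toOp_injective (by simp only [map_add, toOp_site, siteOp_add])
  map_smul' z a := toOp_injective (by simp only [map_smul, toOp_site, siteOp_smul]; rfl)

lemma site_add (k : ℤ) (a b : Matrix (Fin p) (Fin p) ℂ) :
    site k (a + b) = site k a + site k b := (siteLin k).map_add a b

lemma site_sub (k : ℤ) (a b : Matrix (Fin p) (Fin p) ℂ) :
    site k (a - b) = site k a - site k b := (siteLin k).map_sub a b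

lemma site_smul (k : ℤ) (z : ℂ) (a : Matrix (Fin p) (Fin p) ℂ) :
    site k (z • a) = z • site k a := (siteLin k).map_smul z a

lemma site_sum (k : ℤ) {ι : Type*} (s : Finset ι) (a : ι → Matrix (Fin p) (Fin p) ℂ) :
    site k (∑ i ∈ s, a i) = ∑ i ∈ s, site k (a i) := map_sum (siteLin k) a s

lemma site_commute {k l : ℤ} (h : k ≠ l) (a b : Matrix (Fin p) (Fin p) ℂ) :
    site k a * site l b = site l b * site k a :=
  toOp_injective (by simp only [map_mul, toOp_site, siteOp_commute h])

lemma site_lie (k l : ℤ) (a b : Matrix (Fin p) (Fin p) ℂ) :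
    ⁅site k a, site l b⁆ = if k = l then site k ⁅a, b⁆ else 0 := by
  split_ifs with h
  · subst h
    simp only [Ring.lie_def, site_sub, site_mul]
  · rw [Ring.lie_def, site_commute h, sub_self]

lemma translation_mul (n : ℤ) (A B : QuasiLocal p) :
    translation n (A * B) = translation n A * translation n B :=
  toOp_injective (map_mul (translationAux n) (toOp A) (toOp B))

lemma translation_star (n : ℤ) (A : QuasiLocal p) :
    translation n (star A) = star (translation n A) :=
  toOp_injective (map_star (translationAux n) (toOp A))

lemma translationAux_add (m n : ℤ) (T : ChainSpace p →L[ℂ] ChainSpace p) :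
    translationAux m (translationAux n T) = translationAux (m + n) T := by
  ext ψ s
  simp only [translationAux, LinearIsometryEquiv.conjStarAlgEquiv_apply_apply, permOp_apply]
  have h1 : shift n (shift m s) = shift (m + n) s := by
    funext k; simp [shift, add_assoc, add_comm m n]
  have h2 : (permOp (shift n)).symm ((permOp (shift m)).symm ψ) =
      (permOp (shift (m + n))).symm ψ := by
    ext s
    simp only [permOp_symm_apply]
    have h3 : (shift m).symm ((shift n).symm s) = (shift (m + n)).symm s := by
      funext k
      simp only [shift, Equiv.coe_fn_symm_mk]
      congr 1
      ring
    rw [h3]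
  rw [h1, h2]

lemma translation_add (m n : ℤ) (A : QuasiLocal p) :
    translation m (translation n A) = translation (m + n) A :=
  toOp_injective (translationAux_add m n (toOp A))

lemma translation_zero (A : QuasiLocal p) : translation 0 A = A := by
  have h1 := translation_add 0 0 A
  have h2 : Function.Injective (translation (p := p) 0) := fun A B h => by
    have h3 : translationAux 0 (toOp A) = translationAux 0 (toOp B) := congrArg toOp h
    exact toOp_injective ((translationAux (p := p) 0).injective h3)
  exact h2 (by rw [h1, add_zero])

lemma norm_translation_le (n : ℤ) (A : QuasiLocal p) : ‖translation n A‖ ≤ ‖A‖ :=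
  NonUnitalStarAlgHom.norm_apply_le (translationAux (p := p) n : _ ≃⋆ₐ[ℂ] _) (toOp A)

/-- Translation invariance of the norm of `a^{(k)}`, in the form of the bound used below. -/
lemma norm_site (k : ℤ) (a : Matrix (Fin p) (Fin p) ℂ) : ‖site k a‖ ≤ ‖site 0 a‖ := by
  have := norm_translation_le k (site 0 a)
  rwa [translation_site, zero_add] at this

end Sites

/-! ### Commutators, and the microscopic generator in Lindblad form -/

section Commutators

variable {A : Type*} [CStarAlgebra A]

lemma comm_add (X Y Z : A) : ⁅X, Y + Z⁆ = ⁅X, Y⁆ + ⁅X, Z⁆ := by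
  simp only [Ring.lie_def]; noncomm_ring

lemma add_comm_right (X Y Z : A) : ⁅X + Y, Z⁆ = ⁅X, Z⁆ + ⁅Y, Z⁆ := by
  simp only [Ring.lie_def]; noncomm_ring

lemma comm_smul (z : ℂ) (X Y : A) : ⁅X, z • Y⁆ = z • ⁅X, Y⁆ := by
  simp only [Ring.lie_def, mul_smul_comm, smul_mul_assoc, smul_sub]

lemma smul_comm_right (z : ℂ) (X Y : A) : ⁅z • X, Y⁆ = z • ⁅X, Y⁆ := by
  simp only [Ring.lie_def, mul_smul_comm, smul_mul_assoc, smul_sub]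

lemma comm_sum {ι : Type*} (s : Finset ι) (X : A) (f : ι → A) :
    ⁅X, ∑ i ∈ s, f i⁆ = ∑ i ∈ s, ⁅X, f i⁆ := by
  simp only [Ring.lie_def, Finset.mul_sum, Finset.sum_mul, Finset.sum_sub_distrib]

lemma sum_comm_right {ι : Type*} (s : Finset ι) (X : A) (f : ι → A) :
    ⁅∑ i ∈ s, f i, X⁆ = ∑ i ∈ s, ⁅f i, X⁆ := by
  simp only [Ring.lie_def, Finset.mul_sum, Finset.sum_mul, Finset.sum_sub_distrib]

end Commutators

/-- The box `[-N, N]`. -/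
abbrev box (N : ℕ) : Finset ℤ := Finset.Icc (-(N : ℤ)) N

section Generator

variable {p m : ℕ}

/-- The Kossakowski matrix `J ⊗ D` on the box `[-N, N]`. -/
def LindbladData.kossakowski (G : LindbladData p m) (N : ℕ) :
    Matrix (box N × Fin m) (box N × Fin m) ℂ :=
  Matrix.kroneckerMap (· * ·) (Matrix.of fun k l : box N => G.J ((k : ℤ) - (l : ℤ))) G.D

/-- The Kraus operators `v_μ^{(k)}`. -/
def LindbladData.kraus (G : LindbladData p m) (N : ℕ) (a : box N × Fin m) : QuasiLocal p :=
  site a.1 (G.v a.2)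

lemma LindbladData.kossakowski_posSemidef (G : LindbladData p m) (N : ℕ) :
    (G.kossakowski N).PosSemidef :=
  (G.J_posSemidef N).kronecker G.D_posSemidef

lemma LindbladData.hamiltonian_isSelfAdjoint (G : LindbladData p m) (N : ℕ) :
    IsSelfAdjoint (G.hamiltonian N) := by
  rw [IsSelfAdjoint, hamiltonian, star_sum]
  refine Finset.sum_congr rfl fun k _ => ?_
  rw [site_star, G.h_hermitian.eq]

lemma LindbladData.sum_kossakowski_smul (G : LindbladData p m) (N : ℕ) {M : Type*}
    [AddCommGroup M] [Module ℂ M] (g : ℤ → Fin m → ℤ → Fin m → M) :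
    ∑ a : box N × Fin m, ∑ b : box N × Fin m, G.kossakowski N a b • g a.1 a.2 b.1 b.2 =
      ∑ k ∈ box N, ∑ l ∈ box N, G.J (k - l) • ∑ μ, ∑ ν, G.D μ ν • g k μ l ν := by
  simp only [Fintype.sum_prod_type, kossakowski, Matrix.kroneckerMap_apply, Matrix.of_apply,
    Finset.smul_sum, smul_smul]
  rw [← Finset.sum_coe_sort (box N)]
  refine Finset.sum_congr rfl fun k _ => ?_
  rw [Finset.sum_comm, ← Finset.sum_coe_sort (box N)]

lemma LindbladData.generator_eq_lindblad (G : LindbladData p m) (N : ℕ) :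
    G.generator N = lindblad (G.hamiltonian N) (G.kossakowski N) (G.kraus N) := by
  ext1 X
  rw [generator_apply, lindblad_apply]
  congr 1
  have h := G.sum_kossakowski_smul N (fun k μ l ν =>
    site k (G.v μ) * X * site l (G.v ν)ᴴ - (1 / 2 : ℂ) •
      (site k (G.v μ) * site l (G.v ν)ᴴ * X + X * (site k (G.v μ) * site l (G.v ν)ᴴ)))
  refine h.symm.trans ?_
  simp only [kraus, site_star]

lemma LindbladData.evolution_eq (G : LindbladData p m) (N : ℕ) (t : ℝ) :
    G.evolution N t = semigroup (lindblad (G.hamiltonian N) (G.kossakowski N) (G.kraus N)) t := by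
  rw [← generator_eq_lindblad]; rfl

lemma LindbladData.evolution_nonneg (G : LindbladData p m) (N : ℕ) {t : ℝ} (ht : 0 ≤ t)
    {X : QuasiLocal p} (hX : 0 ≤ X) : 0 ≤ G.evolution N t X := by
  rw [evolution_eq]
  exact semigroup_lindblad_nonneg (G.hamiltonian_isSelfAdjoint N) (G.kossakowski_posSemidef N) _
    ht hX

lemma LindbladData.evolution_one (G : LindbladData p m) (N : ℕ) (t : ℝ) :
    G.evolution N t 1 = 1 := by
  rw [evolution_eq]
  exact semigroup_lindblad_one _ _ _ t

lemma LindbladData.norm_evolution_le (G : LindbladData p m) (N : ℕ) {t : ℝ} (ht : 0 ≤ t)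
    (X : QuasiLocal p) : ‖G.evolution N t X‖ ≤ 4 * ‖X‖ :=
  norm_le_four_of_positive_unital (fun _ => G.evolution_nonneg N ht) (G.evolution_one N t) X

end Generator

/-! ### Oscillations of an observable -/

section Oscillation

variable {p m : ℕ}

/-- The sum of the absolute values of the entries of `b`. -/
def entrySum (b : Matrix (Fin p) (Fin p) ℂ) : ℝ := ∑ α, ∑ β, ‖b α β‖

lemma entrySum_nonneg (b : Matrix (Fin p) (Fin p) ℂ) : 0 ≤ entrySum b :=
  Finset.sum_nonneg fun _ _ => Finset.sum_nonneg fun _ _ => norm_nonneg _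

/-- The dependence of `X` on the spin at site `k`, measured by the commutators with the matrix
units at `k`. -/
def osc (k : ℤ) (X : QuasiLocal p) : ℝ :=
  ∑ α : Fin p, ∑ β : Fin p, ‖⁅X, site k (Matrix.single α β (1 : ℂ))⁆‖

lemma osc_nonneg (k : ℤ) (X : QuasiLocal p) : 0 ≤ osc k X :=
  Finset.sum_nonneg fun _ _ => Finset.sum_nonneg fun _ _ => norm_nonneg _

lemma norm_lie_single_le (k : ℤ) (X : QuasiLocal p) (α β : Fin p) :
    ‖⁅X, site k (Matrix.single α β (1 : ℂ))⁆‖ ≤ osc k X :=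
  (Finset.single_le_sum (f := fun β => ‖⁅X, site k (Matrix.single α β (1 : ℂ))⁆‖)
    (fun _ _ => norm_nonneg _) (Finset.mem_univ β)).trans
  (Finset.single_le_sum (f := fun α => ∑ β, ‖⁅X, site k (Matrix.single α β (1 : ℂ))⁆‖)
    (fun _ _ => Finset.sum_nonneg fun _ _ => norm_nonneg _) (Finset.mem_univ α))

lemma site_eq_sum_single (k : ℤ) (b : Matrix (Fin p) (Fin p) ℂ) :
    site k b = ∑ α, ∑ β, b α β • site k (Matrix.single α β (1 : ℂ)) := by
  conv_lhs => rw [Matrix.matrix_eq_sum_single b]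
  simp only [site_sum, ← site_smul, Matrix.smul_single, smul_eq_mul, mul_one]

lemma norm_lie_site_le (k : ℤ) (X : QuasiLocal p) (b : Matrix (Fin p) (Fin p) ℂ) :
    ‖⁅X, site k b⁆‖ ≤ entrySum b * osc k X := by
  rw [site_eq_sum_single, comm_sum, entrySum, Finset.sum_mul]
  refine (norm_sum_le _ _).trans (Finset.sum_le_sum fun α _ => ?_)
  rw [comm_sum, Finset.sum_mul]
  refine (norm_sum_le _ _).trans (Finset.sum_le_sum fun β _ => ?_)
  rw [comm_smul, norm_smul]
  gcongr
  exact norm_lie_single_le k X α β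

lemma osc_add_le (k : ℤ) (X Y : QuasiLocal p) : osc k (X + Y) ≤ osc k X + osc k Y := by
  simp only [osc, ← Finset.sum_add_distrib, add_comm_right]
  exact Finset.sum_le_sum fun α _ => Finset.sum_le_sum fun β _ => norm_add_le _ _

lemma osc_smul (k : ℤ) (z : ℂ) (X : QuasiLocal p) : osc k (z • X) = ‖z‖ * osc k X := by
  simp only [osc, smul_comm_right, norm_smul, Finset.mul_sum]

lemma osc_zero (k : ℤ) : osc k (0 : QuasiLocal p) = 0 := by
  simpa using osc_smul k 0 (0 : QuasiLocal p)

lemma osc_one (k : ℤ) : osc k (1 : QuasiLocal p) = 0 := by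
  simp [osc, Ring.lie_def]

lemma osc_mul_le (k : ℤ) (X Y : QuasiLocal p) :
    osc k (X * Y) ≤ ‖X‖ * osc k Y + osc k X * ‖Y‖ := by
  simp only [osc, Finset.mul_sum, Finset.sum_mul, ← Finset.sum_add_distrib]
  refine Finset.sum_le_sum fun α _ => Finset.sum_le_sum fun β _ => ?_
  have e : ∀ b : QuasiLocal p, ⁅X * Y, b⁆ = X * ⁅Y, b⁆ + ⁅X, b⁆ * Y := fun b => by
    simp only [Ring.lie_def]; noncomm_ring
  rw [e]
  exact (norm_add_le _ _).trans (add_le_add (norm_mul_le _ _) (norm_mul_le _ _))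

lemma osc_star (k : ℤ) (X : QuasiLocal p) : osc k (star X) = osc k X := by
  rw [osc, Finset.sum_comm]
  refine Finset.sum_congr rfl fun α _ => Finset.sum_congr rfl fun β _ => ?_
  rw [← norm_star, ← norm_neg]
  congr 1
  simp only [Ring.lie_def, star_sub, star_mul, star_star, site_star,
    Matrix.conjTranspose_single, star_one]
  abel

lemma osc_site_of_ne {k l : ℤ} (h : k ≠ l) (b : Matrix (Fin p) (Fin p) ℂ) :
    osc k (site l b) = 0 := by
  simp [osc, site_lie, h.symm]

lemma osc_site_le (k l : ℤ) (b : Matrix (Fin p) (Fin p) ℂ) :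
    osc k (site l b) ≤ if l = k then osc 0 (site 0 b) else 0 := by
  split_ifs with h
  · subst h
    simp only [osc, site_lie, if_true]
    exact Finset.sum_le_sum fun α _ => Finset.sum_le_sum fun β _ => norm_site _ _
  · exact (osc_site_of_ne (Ne.symm h) b).le

/-- The total oscillation of `X` over the box `[-N, N]`. -/
def totalOsc (N : ℕ) (X : QuasiLocal p) : ℝ := ∑ k ∈ box N, osc k X

lemma totalOsc_nonneg (N : ℕ) (X : QuasiLocal p) : 0 ≤ totalOsc N X :=
  Finset.sum_nonneg fun _ _ => osc_nonneg _ _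

lemma totalOsc_add_le (N : ℕ) (X Y : QuasiLocal p) :
    totalOsc N (X + Y) ≤ totalOsc N X + totalOsc N Y := by
  simp only [totalOsc, ← Finset.sum_add_distrib]
  exact Finset.sum_le_sum fun k _ => osc_add_le k X Y

lemma totalOsc_smul (N : ℕ) (z : ℂ) (X : QuasiLocal p) :
    totalOsc N (z • X) = ‖z‖ * totalOsc N X := by
  simp only [totalOsc, osc_smul, Finset.mul_sum]

lemma totalOsc_one (N : ℕ) : totalOsc N (1 : QuasiLocal p) = 0 := by
  simp [totalOsc, osc_one]

lemma totalOsc_sum_le (N : ℕ) {ι : Type*} (s : Finset ι) (f : ι → QuasiLocal p) :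
    totalOsc N (∑ i ∈ s, f i) ≤ ∑ i ∈ s, totalOsc N (f i) :=
  Finset.le_sum_of_subadditive _ (by simp [totalOsc, osc_zero]) (totalOsc_add_le N) s f

lemma totalOsc_mul_le (N : ℕ) (X Y : QuasiLocal p) :
    totalOsc N (X * Y) ≤ ‖X‖ * totalOsc N Y + totalOsc N X * ‖Y‖ := by
  simp only [totalOsc, Finset.mul_sum, Finset.sum_mul, ← Finset.sum_add_distrib]
  exact Finset.sum_le_sum fun k _ => osc_mul_le k X Y

lemma totalOsc_star (N : ℕ) (X : QuasiLocal p) : totalOsc N (star X) = totalOsc N X := by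
  simp only [totalOsc, osc_star]

lemma totalOsc_site_le (N : ℕ) (l : ℤ) (b : Matrix (Fin p) (Fin p) ℂ) :
    totalOsc N (site l b) ≤ osc 0 (site 0 b) := by
  refine (Finset.sum_le_sum fun k _ => osc_site_le k l b).trans ?_
  rw [Finset.sum_ite_eq]
  split_ifs
  · exact le_rfl
  · exact osc_nonneg _ _

end Oscillation

/-! ### Commutators of the generator with single-site derivations -/

section LiebRobinson

/-- Failure of a derivation `⁅·, b⁆` to commute with a Lindblad generator. -/
lemma lie_lindblad {A : Type*} [CStarAlgebra A] {ι : Type*} [Fintype ι] (H : A)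
    (c : Matrix ι ι ℂ) (V : ι → A) (X b : A) :
    ⁅lindblad H c V X, b⁆ - lindblad H c V ⁅X, b⁆ = -(Complex.I • ⁅X, ⁅H, b⁆⁆) +
      ∑ i, ∑ j, c i j • ((1 / 2 : ℂ) •
        (⁅V i, b⁆ * ⁅X, star (V j)⁆ - ⁅X, ⁅V i, b⁆⁆ * star (V j) +
          (V i * ⁅X, ⁅star (V j), b⁆⁆ - ⁅X, V i⁆ * ⁅star (V j), b⁆))) := by
  have e : ∀ i j, ⁅c i j • (V i * X * star (V j) - (1 / 2 : ℂ) •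
        (V i * star (V j) * X + X * (V i * star (V j)))), b⁆ -
      c i j • (V i * ⁅X, b⁆ * star (V j) - (1 / 2 : ℂ) •
        (V i * star (V j) * ⁅X, b⁆ + ⁅X, b⁆ * (V i * star (V j)))) =
      c i j • ((1 / 2 : ℂ) •
        (⁅V i, b⁆ * ⁅X, star (V j)⁆ - ⁅X, ⁅V i, b⁆⁆ * star (V j) +
          (V i * ⁅X, ⁅star (V j), b⁆⁆ - ⁅X, V i⁆ * ⁅star (V j), b⁆))) := by
    intro i j
    rw [smul_comm_right, ← smul_sub]
    congr 1
    simp only [Ring.lie_def, sub_mul, mul_sub, add_mul, mul_add, smul_mul_assoc, mul_smul_comm,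
      smul_add, smul_sub, mul_assoc]
    module
  have e2 : ⁅Complex.I • (H * X - X * H), b⁆ - Complex.I • (H * ⁅X, b⁆ - ⁅X, b⁆ * H) =
      -(Complex.I • ⁅X, ⁅H, b⁆⁆) := by
    rw [smul_comm_right, ← smul_sub, ← smul_neg]
    congr 1
    simp only [Ring.lie_def]
    noncomm_ring
  rw [lindblad_apply, lindblad_apply, add_comm_right, sum_comm_right, ← e2]
  simp only [sum_comm_right, ← e, Finset.sum_sub_distrib]
  abel

variable {p m : ℕ}

/-- A norm on single-site matrices that dominates both `entrySum` and the operator norm. -/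
def matSize (b : Matrix (Fin p) (Fin p) ℂ) : ℝ := entrySum b + ‖site 0 b‖

lemma matSize_nonneg (b : Matrix (Fin p) (Fin p) ℂ) : 0 ≤ matSize b :=
  add_nonneg (entrySum_nonneg b) (norm_nonneg _)

lemma norm_site_le_matSize (k : ℤ) (b : Matrix (Fin p) (Fin p) ℂ) : ‖site k b‖ ≤ matSize b :=
  (norm_site k b).trans (le_add_of_nonneg_left (entrySum_nonneg b))

lemma norm_lie_site_le_matSize (k : ℤ) (X : QuasiLocal p) (b : Matrix (Fin p) (Fin p) ℂ) :
    ‖⁅X, site k b⁆‖ ≤ matSize b * osc k X :=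
  (norm_lie_site_le k X b).trans (mul_le_mul_of_nonneg_right
    (le_add_of_nonneg_right (norm_nonneg _)) (osc_nonneg _ _))

/-- The `ℓ¹` norm of the coupling `J`. -/
def LindbladData.couplingNorm (G : LindbladData p m) : ℝ := ∑' k, ‖G.J k‖

lemma LindbladData.couplingNorm_nonneg (G : LindbladData p m) : 0 ≤ G.couplingNorm :=
  tsum_nonneg fun _ => norm_nonneg _

lemma sum_norm_comp_le_tsum {J : ℤ → ℂ} (hJ : Summable fun k => ‖J k‖) (s : Finset ℤ)
    {f : ℤ → ℤ} (hf : Function.Injective f) : ∑ k ∈ s, ‖J (f k)‖ ≤ ∑' k, ‖J k‖ := by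
  rw [← Finset.sum_image (f := fun k => ‖J k‖) (g := f) fun a _ b _ h => hf h]
  exact hJ.sum_le_tsum _ fun _ _ => norm_nonneg _

lemma LindbladData.sum_norm_J_left_le (G : LindbladData p m) (s : Finset ℤ) (l : ℤ) :
    ∑ k ∈ s, ‖G.J (k - l)‖ ≤ G.couplingNorm :=
  sum_norm_comp_le_tsum G.J_summable s (f := fun k => k - l) sub_left_injective

lemma LindbladData.sum_norm_J_right_le (G : LindbladData p m) (s : Finset ℤ) (k : ℤ) :
    ∑ l ∈ s, ‖G.J (k - l)‖ ≤ G.couplingNorm :=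
  sum_norm_comp_le_tsum G.J_summable s (f := fun l => k - l) sub_right_injective

/-- The constant of `norm_lie_generator_le`. -/
def LindbladData.lieConst (G : LindbladData p m) (b : Matrix (Fin p) (Fin p) ℂ) : ℝ :=
  matSize ⁅G.h, b⁆ + ∑ μ, ∑ ν, ‖G.D μ ν‖ *
    (matSize ⁅G.v μ, b⁆ * matSize (G.v ν)ᴴ + matSize (G.v μ) * matSize ⁅(G.v ν)ᴴ, b⁆)

lemma LindbladData.lieConst_nonneg (G : LindbladData p m) (b : Matrix (Fin p) (Fin p) ℂ) :
    0 ≤ G.lieConst b :=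
  add_nonneg (matSize_nonneg _) (Finset.sum_nonneg fun _ _ => Finset.sum_nonneg fun _ _ =>
    mul_nonneg (norm_nonneg _) (add_nonneg (mul_nonneg (matSize_nonneg _) (matSize_nonneg _))
      (mul_nonneg (matSize_nonneg _) (matSize_nonneg _))))

/-- Commutators with single-site operators almost commute with the generator: the failure is
controlled, uniformly in `N`, by the oscillations of `X`. -/
lemma LindbladData.norm_lie_generator_le (G : LindbladData p m) {N : ℕ} {k : ℤ} (hk : k ∈ box N)
    (b : Matrix (Fin p) (Fin p) ℂ) (X : QuasiLocal p) :
    ‖⁅G.generator N X, site k b⁆ - G.generator N ⁅X, site k b⁆‖ ≤ G.lieConst b *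
      (osc k X + ∑ l ∈ box N, (‖G.J (k - l)‖ + ‖G.J (l - k)‖) * (osc k X + osc l X)) := by
  set T1 : ℤ → Fin m → ℤ → Fin m → QuasiLocal p := fun k' μ l ν =>
    (1 / 2 : ℂ) • (⁅site k' (G.v μ), site k b⁆ * ⁅X, site l (G.v ν)ᴴ⁆ -
      ⁅X, ⁅site k' (G.v μ), site k b⁆⁆ * site l (G.v ν)ᴴ) with hT1
  set T2 : ℤ → Fin m → ℤ → Fin m → QuasiLocal p := fun k' μ l ν =>
    (1 / 2 : ℂ) • (site k' (G.v μ) * ⁅X, ⁅site l (G.v ν)ᴴ, site k b⁆⁆ -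
      ⁅X, site k' (G.v μ)⁆ * ⁅site l (G.v ν)ᴴ, site k b⁆) with hT2
  have hzero : ⁅X, (0 : QuasiLocal p)⁆ = 0 := by simp [Ring.lie_def]
  have hT1z : ∀ k' μ l ν, k' ≠ k → T1 k' μ l ν = 0 := fun k' μ l ν h => by
    simp only [hT1, site_lie, if_neg h, hzero, zero_mul, sub_self, smul_zero]
  have hT2z : ∀ k' μ l ν, l ≠ k → T2 k' μ l ν = 0 := fun k' μ l ν h => by
    simp only [hT2, site_lie, if_neg h, hzero, mul_zero, sub_self, smul_zero]
  set c1 : Fin m → Fin m → ℝ := fun μ ν => matSize ⁅G.v μ, b⁆ * matSize (G.v ν)ᴴ with hc1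
  set c2 : Fin m → Fin m → ℝ := fun μ ν => matSize (G.v μ) * matSize ⁅(G.v ν)ᴴ, b⁆ with hc2
  have hhalf : ‖(1 / 2 : ℂ)‖ ≤ 1 := by norm_num
  have hbd1 : ∀ μ l ν, ‖T1 k μ l ν‖ ≤ c1 μ ν * (osc k X + osc l X) := fun μ l ν => by
    simp only [hT1, site_lie, if_true]
    rw [norm_smul]
    refine (mul_le_of_le_one_left (norm_nonneg _) hhalf).trans ((norm_sub_le _ _).trans ?_)
    have h1 : ‖site k ⁅G.v μ, b⁆ * ⁅X, site l (G.v ν)ᴴ⁆‖ ≤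
        matSize ⁅G.v μ, b⁆ * (matSize (G.v ν)ᴴ * osc l X) :=
      (norm_mul_le _ _).trans (mul_le_mul (norm_site_le_matSize _ _)
        (norm_lie_site_le_matSize _ _ _) (norm_nonneg _) (matSize_nonneg _))
    have h2 : ‖⁅X, site k ⁅G.v μ, b⁆⁆ * site l (G.v ν)ᴴ‖ ≤
        (matSize ⁅G.v μ, b⁆ * osc k X) * matSize (G.v ν)ᴴ :=
      (norm_mul_le _ _).trans (mul_le_mul (norm_lie_site_le_matSize _ _ _)
        (norm_site_le_matSize _ _) (norm_nonneg _)
        (mul_nonneg (matSize_nonneg _) (osc_nonneg _ _)))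
    refine (add_le_add h1 h2).trans_eq ?_
    simp only [hc1]
    ring
  have hbd2 : ∀ k' μ ν, ‖T2 k' μ k ν‖ ≤ c2 μ ν * (osc k X + osc k' X) := fun k' μ ν => by
    simp only [hT2, site_lie, if_true]
    rw [norm_smul]
    refine (mul_le_of_le_one_left (norm_nonneg _) hhalf).trans ((norm_sub_le _ _).trans ?_)
    have h1 : ‖site k' (G.v μ) * ⁅X, site k ⁅(G.v ν)ᴴ, b⁆⁆‖ ≤
        matSize (G.v μ) * (matSize ⁅(G.v ν)ᴴ, b⁆ * osc k X) :=
      (norm_mul_le _ _).trans (mul_le_mul (norm_site_le_matSize _ _)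
        (norm_lie_site_le_matSize _ _ _) (norm_nonneg _) (matSize_nonneg _))
    have h2 : ‖⁅X, site k' (G.v μ)⁆ * site k ⁅(G.v ν)ᴴ, b⁆‖ ≤
        (matSize (G.v μ) * osc k' X) * matSize ⁅(G.v ν)ᴴ, b⁆ :=
      (norm_mul_le _ _).trans (mul_le_mul (norm_lie_site_le_matSize _ _ _)
        (norm_site_le_matSize _ _) (norm_nonneg _)
        (mul_nonneg (matSize_nonneg _) (osc_nonneg _ _)))
    refine (add_le_add h1 h2).trans_eq ?_
    simp only [hc2]
    ring
  have hsplit : ⁅G.generator N X, site k b⁆ - G.generator N ⁅X, site k b⁆ =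
      -(Complex.I • ⁅X, site k ⁅G.h, b⁆⁆) +
      (∑ l ∈ box N, G.J (k - l) • ∑ μ, ∑ ν, G.D μ ν • T1 k μ l ν +
        ∑ l ∈ box N, G.J (l - k) • ∑ μ, ∑ ν, G.D μ ν • T2 l μ k ν) := by
    rw [G.generator_eq_lindblad, lie_lindblad]
    congr 1
    · congr 3
      rw [LindbladData.hamiltonian, sum_comm_right]
      simp only [site_lie, eq_comm (b := k)]
      rw [Finset.sum_ite_eq, if_pos hk]
    · have h := G.sum_kossakowski_smul N (fun k' μ l ν => T1 k' μ l ν + T2 k' μ l ν)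
      simp only [LindbladData.kraus, site_star]
      refine Eq.trans ?_ (h.trans ?_)
      · refine Finset.sum_congr rfl fun i _ => Finset.sum_congr rfl fun j _ => ?_
        rw [smul_add]
      · simp only [smul_add, Finset.sum_add_distrib]
        congr 1
        · refine Finset.sum_eq_single_of_mem k hk fun k' _ hne => ?_
          simp only [hT1z _ _ _ _ hne, smul_zero, Finset.sum_const_zero]
        · refine Finset.sum_congr rfl fun l _ => ?_
          refine Finset.sum_eq_single_of_mem k hk fun k' _ hne => ?_
          simp only [hT2z _ _ _ _ hne, smul_zero, Finset.sum_const_zero]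
  have hDsum : ∀ (T : Fin m → Fin m → QuasiLocal p) (c : Fin m → Fin m → ℝ) (r : ℝ),
      (∀ μ ν, ‖T μ ν‖ ≤ c μ ν * r) →
      ‖∑ μ, ∑ ν, G.D μ ν • T μ ν‖ ≤ (∑ μ, ∑ ν, ‖G.D μ ν‖ * c μ ν) * r := by
    intro T c r h
    rw [Finset.sum_mul]
    refine (norm_sum_le _ _).trans (Finset.sum_le_sum fun μ _ => ?_)
    rw [Finset.sum_mul]
    refine (norm_sum_le _ _).trans (Finset.sum_le_sum fun ν _ => ?_)
    rw [norm_smul, mul_assoc]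
    exact mul_le_mul_of_nonneg_left (h μ ν) (norm_nonneg _)
  set C1 := ∑ μ, ∑ ν, ‖G.D μ ν‖ * c1 μ ν with hC1
  set C2 := ∑ μ, ∑ ν, ‖G.D μ ν‖ * c2 μ ν with hC2
  have hCeq : G.lieConst b = matSize ⁅G.h, b⁆ + (C1 + C2) := by
    simp only [LindbladData.lieConst, hC1, hC2, hc1, hc2, mul_add, Finset.sum_add_distrib]
  have hC1n : 0 ≤ C1 := Finset.sum_nonneg fun _ _ => Finset.sum_nonneg fun _ _ =>
    mul_nonneg (norm_nonneg _) (mul_nonneg (matSize_nonneg _) (matSize_nonneg _))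
  have hC2n : 0 ≤ C2 := Finset.sum_nonneg fun _ _ => Finset.sum_nonneg fun _ _ =>
    mul_nonneg (norm_nonneg _) (mul_nonneg (matSize_nonneg _) (matSize_nonneg _))
  have hb1 : ‖∑ l ∈ box N, G.J (k - l) • ∑ μ, ∑ ν, G.D μ ν • T1 k μ l ν‖ ≤
      C1 * ∑ l ∈ box N, ‖G.J (k - l)‖ * (osc k X + osc l X) := by
    rw [Finset.mul_sum]
    refine (norm_sum_le _ _).trans (Finset.sum_le_sum fun l _ => ?_)
    rw [norm_smul, mul_left_comm]
    exact mul_le_mul_of_nonneg_left (hDsum _ c1 _ fun μ ν => hbd1 μ l ν) (norm_nonneg _)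
  have hb2 : ‖∑ l ∈ box N, G.J (l - k) • ∑ μ, ∑ ν, G.D μ ν • T2 l μ k ν‖ ≤
      C2 * ∑ l ∈ box N, ‖G.J (l - k)‖ * (osc k X + osc l X) := by
    rw [Finset.mul_sum]
    refine (norm_sum_le _ _).trans (Finset.sum_le_sum fun l _ => ?_)
    rw [norm_smul, mul_left_comm]
    exact mul_le_mul_of_nonneg_left (hDsum _ c2 _ fun μ ν => hbd2 l μ ν) (norm_nonneg _)
  have hb0 : ‖-(Complex.I • ⁅X, site k ⁅G.h, b⁆⁆)‖ ≤ matSize ⁅G.h, b⁆ * osc k X := by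
    rw [norm_neg, norm_smul, Complex.norm_I, one_mul]
    exact norm_lie_site_le_matSize _ _ _
  rw [hsplit]
  refine (norm_add_le _ _).trans ((add_le_add hb0 ((norm_add_le _ _).trans
    (add_le_add hb1 hb2))).trans ?_)
  simp only [add_mul, Finset.sum_add_distrib]
  set S1 := ∑ l ∈ box N, ‖G.J (k - l)‖ * (osc k X + osc l X) with hS1
  set S2 := ∑ l ∈ box N, ‖G.J (l - k)‖ * (osc k X + osc l X) with hS2
  have hS1n : 0 ≤ S1 := Finset.sum_nonneg fun _ _ => mul_nonneg (norm_nonneg _)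
    (add_nonneg (osc_nonneg _ _) (osc_nonneg _ _))
  have hS2n : 0 ≤ S2 := Finset.sum_nonneg fun _ _ => mul_nonneg (norm_nonneg _)
    (add_nonneg (osc_nonneg _ _) (osc_nonneg _ _))
  have ho := osc_nonneg k X
  have hm := matSize_nonneg ⁅G.h, b⁆
  rw [hCeq]
  nlinarith [mul_nonneg hm hS1n, mul_nonneg hm hS2n, mul_nonneg hC1n hS2n,
    mul_nonneg hC2n hS1n, mul_nonneg hC1n ho, mul_nonneg hC2n ho]

end LiebRobinson

/-! ### Growth of oscillations under the dynamics -/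

section LiebRobinsonGrowth

/-- Grönwall's inequality in integral form. -/
lemma le_mul_exp_of_le_add_integral {S : ℝ → ℝ} (hS : Continuous S) {a b : ℝ} (hb : 0 ≤ b)
    (h : ∀ t, 0 ≤ t → S t ≤ a + b * ∫ s in (0 : ℝ)..t, S s) {t : ℝ} (ht : 0 ≤ t) :
    S t ≤ a * Real.exp (b * t) := by
  set I : ℝ → ℝ := fun t => ∫ s in (0 : ℝ)..t, S s with hI
  have hId : ∀ t, HasDerivAt I (S t) t := fun t =>
    intervalIntegral.integral_hasDerivAt_right (hS.intervalIntegrable _ _)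
      (hS.stronglyMeasurableAtFilter _ _) hS.continuousAt
  set k : ℝ → ℝ := fun t => Real.exp (-(b * t)) * (a + b * I t) with hk
  have hkd : ∀ t, HasDerivAt k (b * Real.exp (-(b * t)) * (S t - (a + b * I t))) t := by
    intro t
    have h1 : HasDerivAt (fun t : ℝ => Real.exp (-(b * t))) (Real.exp (-(b * t)) * -(b * 1)) t :=
      (Real.hasDerivAt_exp _).comp t ((hasDerivAt_id t).const_mul b).fun_neg
    refine (h1.mul (((hId t).const_mul b).const_add a)).congr_deriv ?_
    ring
  have hanti : AntitoneOn k (Set.Icc 0 t) := by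
    refine antitoneOn_of_deriv_nonpos (convex_Icc 0 t)
      (fun s _ => (hkd s).continuousAt.continuousWithinAt)
      (fun s _ => (hkd s).differentiableAt.differentiableWithinAt) fun s hs => ?_
    rw [interior_Icc] at hs
    rw [(hkd s).deriv]
    exact mul_nonpos_of_nonneg_of_nonpos (mul_nonneg hb (Real.exp_pos _).le)
      (sub_nonpos.mpr (h s hs.1.le))
  have h1 := hanti ⟨le_rfl, ht⟩ ⟨ht, le_rfl⟩ ht
  have h2 : k 0 = a := by simp [hk, hI]
  rw [h2] at h1
  calc S t ≤ a + b * I t := h t ht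
    _ = Real.exp (-(b * t)) * (a + b * I t) * Real.exp (b * t) := by
      rw [mul_right_comm, ← Real.exp_add, neg_add_cancel, Real.exp_zero, one_mul]
    _ ≤ a * Real.exp (b * t) := by gcongr

variable {p m : ℕ}

/-- The growth rate of the total oscillation under the dynamics. -/
def LindbladData.growthRate (G : LindbladData p m) : ℝ :=
  (∑ α, ∑ β, G.lieConst (Matrix.single α β (1 : ℂ))) * (1 + 4 * G.couplingNorm)

lemma LindbladData.growthRate_nonneg (G : LindbladData p m) : 0 ≤ G.growthRate :=
  mul_nonneg (Finset.sum_nonneg fun _ _ => Finset.sum_nonneg fun _ _ => G.lieConst_nonneg _)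
    (by linarith [G.couplingNorm_nonneg])

/-- The map `X ↦ [X, b^{(k)}]`. -/
def lieSite (k : ℤ) (b : Matrix (Fin p) (Fin p) ℂ) : QuasiLocal p →L[ℂ] QuasiLocal p :=
  ContinuousLinearMap.mulLeftRight ℂ _ 1 (site k b) -
    ContinuousLinearMap.mulLeftRight ℂ _ (site k b) 1

lemma lieSite_apply (k : ℤ) (b : Matrix (Fin p) (Fin p) ℂ) (X : QuasiLocal p) :
    lieSite k b X = ⁅X, site k b⁆ := by
  simp [lieSite, Ring.lie_def]

/-- The failure of the derivations to commute with the generator, summed over all sites and matrix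
units; the summability of `J` makes the bound uniform in `N`. -/
lemma LindbladData.sum_norm_lie_generator_le (G : LindbladData p m) (N : ℕ) (X : QuasiLocal p) :
    ∑ k ∈ box N, ∑ α, ∑ β, ‖⁅G.generator N X, site k (Matrix.single α β (1 : ℂ))⁆ -
      G.generator N ⁅X, site k (Matrix.single α β (1 : ℂ))⁆‖ ≤ G.growthRate * totalOsc N X := by
  have h1 : ∀ k ∈ box N, ∑ α, ∑ β, ‖⁅G.generator N X, site k (Matrix.single α β (1 : ℂ))⁆ -
      G.generator N ⁅X, site k (Matrix.single α β (1 : ℂ))⁆‖ ≤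
      (∑ α, ∑ β, G.lieConst (Matrix.single α β (1 : ℂ))) *
      (osc k X + ∑ l ∈ box N, (‖G.J (k - l)‖ + ‖G.J (l - k)‖) * (osc k X + osc l X)) := by
    intro k hk
    rw [Finset.sum_mul]
    refine Finset.sum_le_sum fun α _ => ?_
    rw [Finset.sum_mul]
    exact Finset.sum_le_sum fun β _ => G.norm_lie_generator_le hk _ X
  refine (Finset.sum_le_sum h1).trans ?_
  rw [← Finset.mul_sum, LindbladData.growthRate, mul_assoc]
  refine mul_le_mul_of_nonneg_left ?_
    (Finset.sum_nonneg fun _ _ => Finset.sum_nonneg fun _ _ => G.lieConst_nonneg _)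
  have hJ : ∀ k, ∑ l ∈ box N, (‖G.J (k - l)‖ + ‖G.J (l - k)‖) ≤ 2 * G.couplingNorm := by
    intro k
    rw [Finset.sum_add_distrib, two_mul]
    exact add_le_add (G.sum_norm_J_right_le _ k) (G.sum_norm_J_left_le _ k)
  have h2 : ∑ k ∈ box N, ∑ l ∈ box N, (‖G.J (k - l)‖ + ‖G.J (l - k)‖) * osc k X ≤
      2 * G.couplingNorm * totalOsc N X := by
    rw [totalOsc, Finset.mul_sum]
    refine Finset.sum_le_sum fun k _ => ?_
    rw [← Finset.sum_mul]
    exact mul_le_mul_of_nonneg_right (hJ k) (osc_nonneg _ _)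
  have h3 : ∑ k ∈ box N, ∑ l ∈ box N, (‖G.J (k - l)‖ + ‖G.J (l - k)‖) * osc l X ≤
      2 * G.couplingNorm * totalOsc N X := by
    rw [Finset.sum_comm]
    refine le_trans (le_of_eq ?_) h2
    simp only [add_comm]
  simp only [Finset.sum_add_distrib, mul_add] at h2 h3 ⊢
  have : ∑ k ∈ box N, osc k X = totalOsc N X := rfl
  rw [this]
  linarith

lemma LindbladData.hasDerivAt_evolution_apply (G : LindbladData p m) (N : ℕ) (X : QuasiLocal p)
    (s : ℝ) :
    HasDerivAt (fun s => G.evolution N s X) (G.generator N (G.evolution N s X)) s := by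
  have h := hasDerivAt_semigroup_apply (G.generator N) X s
  rw [semigroup_commute] at h
  exact h

lemma LindbladData.continuous_evolution_apply (G : LindbladData p m) (N : ℕ) (X : QuasiLocal p) :
    Continuous fun s => G.evolution N s X :=
  continuous_iff_continuousAt.mpr fun s => (G.hasDerivAt_evolution_apply N X s).continuousAt

/-- A Lieb–Robinson type bound: the total oscillation grows at most exponentially, at a rate that
does not depend on `N`.  The factors `4` bound the norm of the evolution, which is positive and
unital. -/
theorem LindbladData.totalOsc_evolution_le (G : LindbladData p m) (N : ℕ) (X : QuasiLocal p)
    {t : ℝ} (ht : 0 ≤ t) :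
    totalOsc N (G.evolution N t X) ≤
      4 * totalOsc N X * Real.exp (4 * G.growthRate * t) := by
  set E : Fin p → Fin p → Matrix (Fin p) (Fin p) ℂ := fun α β => Matrix.single α β (1 : ℂ) with hE
  set F : ℤ → Fin p → Fin p → ℝ → QuasiLocal p := fun k α β s =>
    lieSite k (E α β) (G.generator N (G.evolution N s X)) -
      G.generator N (lieSite k (E α β) (G.evolution N s X)) with hF
  have hXc := G.continuous_evolution_apply N X
  have hFc : ∀ k α β, Continuous (F k α β) := fun k α β => by
    simp only [hF]
    fun_prop
  have hosc : ∀ s, totalOsc N (G.evolution N s X) =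
      ∑ k ∈ box N, ∑ α, ∑ β, ‖lieSite k (E α β) (G.evolution N s X)‖ := fun s => by
    simp only [totalOsc, osc, lieSite_apply, hE]
  have hFsum : ∀ s, ∑ k ∈ box N, ∑ α, ∑ β, ‖F k α β s‖ ≤
      G.growthRate * totalOsc N (G.evolution N s X) := fun s => by
    simp only [hF, lieSite_apply, hE]
    exact G.sum_norm_lie_generator_le N _
  have hcont : Continuous fun s => totalOsc N (G.evolution N s X) := by
    simp only [hosc]
    fun_prop
  refine le_mul_exp_of_le_add_integral hcont
    (mul_nonneg (by norm_num) G.growthRate_nonneg) (fun u hu => ?_) ht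
  -- Duhamel's formula for each commutator
  have hone : ∀ k α β, ‖lieSite k (E α β) (G.evolution N u X)‖ ≤
      4 * ‖lieSite k (E α β) X‖ + 4 * ∫ s in (0 : ℝ)..u, ‖F k α β s‖ := by
    intro k α β
    set y : ℝ → QuasiLocal p := fun s =>
      semigroup (G.generator N) (u - s) (lieSite k (E α β) (G.evolution N s X)) with hy
    set y' : ℝ → QuasiLocal p := fun s => semigroup (G.generator N) (u - s) (F k α β s) with hy'
    have hyd : ∀ s, HasDerivAt y (y' s) s := fun s => by
      have h1 : HasDerivAt (fun s => lieSite k (E α β) (G.evolution N s X))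
          (lieSite k (E α β) (G.generator N (G.evolution N s X))) s :=
        ((lieSite k (E α β)).restrictScalars ℝ).hasFDerivAt.comp_hasDerivAt s
          (G.hasDerivAt_evolution_apply N X s)
      exact hasDerivAt_semigroup_sub_apply (G.generator N) u h1
    have hsc : Continuous fun s => semigroup (G.generator N) (u - s) :=
      (continuous_iff_continuousAt.mpr fun s =>
        (hasDerivAt_semigroup (G.generator N) s).continuousAt).comp (by fun_prop)
    have hy'c : Continuous y' := hsc.clm_apply (hFc k α β)
    have hint : ∫ s in (0 : ℝ)..u, y' s = y u - y 0 :=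
      intervalIntegral.integral_eq_sub_of_hasDerivAt (fun s _ => hyd s)
        (hy'c.intervalIntegrable _ _)
    have hyu : y u = lieSite k (E α β) (G.evolution N u X) := by
      simp [hy, semigroup_zero]
    have hy0 : ‖y 0‖ ≤ 4 * ‖lieSite k (E α β) X‖ := by
      have h0 : G.evolution N 0 X = X := by
        change semigroup (G.generator N) 0 X = X
        rw [semigroup_zero, one_apply_eq_self]
      have := G.norm_evolution_le N hu (lieSite k (E α β) X)
      simp only [hy, h0, sub_zero]
      exact this
    have hnorm : ‖∫ s in (0 : ℝ)..u, y' s‖ ≤ ∫ s in (0 : ℝ)..u, 4 * ‖F k α β s‖ := by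
      refine (intervalIntegral.norm_integral_le_integral_norm hu).trans ?_
      refine intervalIntegral.integral_mono_on hu (hy'c.norm.intervalIntegrable _ _)
        ((by fun_prop : Continuous fun s => 4 * ‖F k α β s‖).intervalIntegrable _ _)
        fun s hs => ?_
      exact G.norm_evolution_le N (sub_nonneg.mpr hs.2) (F k α β s)
    rw [intervalIntegral.integral_const_mul] at hnorm
    have : y u = y 0 + ∫ s in (0 : ℝ)..u, y' s := by rw [hint]; abel
    rw [← hyu, this]
    exact (norm_add_le _ _).trans (add_le_add hy0 hnorm)
  have hsum : totalOsc N (G.evolution N u X) ≤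
      4 * totalOsc N X + 4 * ∫ s in (0 : ℝ)..u, ∑ k ∈ box N, ∑ α, ∑ β, ‖F k α β s‖ := by
    have hi : ∀ (f : ℝ → ℝ), Continuous f →
        IntervalIntegrable f MeasureTheory.volume 0 u := fun f hf => hf.intervalIntegrable _ _
    rw [intervalIntegral.integral_finsetSum fun k _ => hi _ (by fun_prop)]
    have e : ∀ k, ∫ s in (0 : ℝ)..u, ∑ α, ∑ β, ‖F k α β s‖ =
        ∑ α, ∑ β, ∫ s in (0 : ℝ)..u, ‖F k α β s‖ := fun k => by
      rw [intervalIntegral.integral_finsetSum fun α _ => hi _ (by fun_prop)]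
      refine Finset.sum_congr rfl fun α _ => ?_
      rw [intervalIntegral.integral_finsetSum fun β _ => hi _ (by fun_prop)]
    simp only [e, Finset.mul_sum, totalOsc, osc, ← Finset.sum_add_distrib]
    refine Finset.sum_le_sum fun k _ => Finset.sum_le_sum fun α _ =>
      Finset.sum_le_sum fun β _ => ?_
    have := hone k α β
    simpa only [lieSite_apply] using this
  refine hsum.trans ?_
  rw [mul_assoc 4 G.growthRate]
  gcongr
  rw [← intervalIntegral.integral_const_mul]
  refine intervalIntegral.integral_mono_on hu
    ((by fun_prop : Continuous fun s => ∑ k ∈ box N, ∑ α, ∑ β,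
      ‖F k α β s‖).intervalIntegrable _ _)
    ((hcont.const_mul _).intervalIntegrable _ _) fun s _ => hFsum s

end LiebRobinsonGrowth

/-! ### Averages of double sums over a box -/

section DoubleSums

/-- A double sum over the box, arranged by the difference of the two indices. -/
lemma sum_box_box {M : Type*} [AddCommMonoid M] (N : ℕ) (h : ℤ → ℤ → M) :
    ∑ k ∈ box N, ∑ l ∈ box N, h k l =
      ∑ n ∈ box (2 * N), ∑ k ∈ (box N).filter (fun k => k - n ∈ box N), h k (k - n) := by
  simp only [Finset.sum_filter]
  rw [Finset.sum_comm (s := box (2 * N))]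
  refine Finset.sum_congr rfl fun k hk => ?_
  rw [← Finset.sum_filter]
  refine Finset.sum_nbij' (fun l => k - l) (fun n => k - n) ?_ ?_ ?_ ?_ ?_
  · intro l hl
    simp only [Finset.mem_filter, Finset.mem_Icc, sub_sub_cancel] at *
    push_cast
    omega
  · intro n hn
    exact (Finset.mem_filter.mp hn).2
  · intro l _; ring
  · intro n _; ring
  · intro l _; simp

lemma filter_box_eq_empty {N : ℕ} {n : ℤ} (hn : n ∉ box (2 * N)) :
    (box N).filter (fun k => k - n ∈ box N) = ∅ := by
  refine Finset.filter_eq_empty_iff.mpr fun k hk h => hn ?_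
  simp only [Finset.mem_Icc] at *
  push_cast
  omega

lemma card_box (N : ℕ) : ((box N).card : ℝ) = 2 * N + 1 := by
  rw [Int.card_Icc]
  have : ((N : ℤ) + 1 - -(N : ℤ)).toNat = 2 * N + 1 := by omega
  rw [this]
  push_cast
  ring

lemma two_mul_add_one_pos (N : ℕ) : (0 : ℝ) < 2 * N + 1 := by positivity

lemma card_filter_box_le (N : ℕ) (n : ℤ) :
    (((box N).filter (fun k => k - n ∈ box N)).card : ℝ) ≤ 2 * N + 1 := by
  rw [← card_box]
  exact_mod_cast Finset.card_filter_le _ _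

lemma card_filter_box_ge (N : ℕ) (n : ℤ) :
    (2 * N + 1 : ℝ) - n.natAbs ≤ ((box N).filter (fun k => k - n ∈ box N)).card := by
  have h : (box N).filter (fun k => k - n ∈ box N) =
      Finset.Icc (max (-(N : ℤ)) (-(N : ℤ) + n)) (min (N : ℤ) (N + n)) := by
    ext k
    simp only [Finset.mem_filter, Finset.mem_Icc]
    omega
  rw [h, Int.card_Icc]
  have h2 : 2 * N + 1 ≤
      (min (N : ℤ) (N + n) + 1 - max (-(N : ℤ)) (-(N : ℤ) + n)).toNat + n.natAbs := by omega
  have h3 : ((2 * N + 1 : ℕ) : ℝ) ≤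
      ((min (N : ℤ) (N + n) + 1 - max (-(N : ℤ)) (-(N : ℤ) + n)).toNat + n.natAbs : ℕ) := by
    exact_mod_cast h2
  push_cast at h3
  linarith

lemma tendsto_inv_box : Tendsto (fun N : ℕ => (2 * (N : ℝ) + 1)⁻¹) atTop (𝓝 0) := by
  refine tendsto_inv_atTop_zero.comp ?_
  refine tendsto_atTop_add_const_right _ _ ?_
  exact tendsto_natCast_atTop_atTop.const_mul_atTop two_pos

lemma tendsto_card_filter_box (n : ℤ) :
    Tendsto (fun N : ℕ => (2 * (N : ℝ) + 1)⁻¹ *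
      ((box N).filter (fun k => k - n ∈ box N)).card) atTop (𝓝 1) := by
  have h1 : Tendsto (fun N : ℕ => 1 - (2 * (N : ℝ) + 1)⁻¹ * n.natAbs) atTop (𝓝 1) := by
    simpa using (tendsto_inv_box.mul_const (n.natAbs : ℝ)).const_sub 1
  refine tendsto_of_tendsto_of_tendsto_of_le_of_le h1 tendsto_const_nhds (fun N => ?_)
    fun N => ?_
  · have h := card_filter_box_ge N n
    have hp := two_mul_add_one_pos N
    have := mul_le_mul_of_nonneg_left h (inv_pos.mpr hp).le
    rw [mul_sub, inv_mul_cancel₀ hp.ne'] at this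
    exact this
  · have hp := two_mul_add_one_pos N
    exact (inv_mul_le_one₀ hp).mpr (card_filter_box_le N n)

/-- Averages over large boxes of a double sequence `g(k - l)` converge to `∑ g`. -/
lemma tendsto_box_average_of_summable {g : ℤ → ℂ} (hg : Summable fun n => ‖g n‖) :
    Tendsto (fun N : ℕ => (((2 * (N : ℝ) + 1)⁻¹ : ℝ) : ℂ) *
      ∑ k ∈ box N, ∑ l ∈ box N, g (k - l)) atTop (𝓝 (∑' n, g n)) := by
  have e : ∀ N : ℕ, (((2 * (N : ℝ) + 1)⁻¹ : ℝ) : ℂ) * ∑ k ∈ box N, ∑ l ∈ box N, g (k - l) =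
      ∑' n, (((2 * (N : ℝ) + 1)⁻¹ *
        ((box N).filter (fun k => k - n ∈ box N)).card : ℝ) : ℂ) * g n := by
    intro N
    rw [sum_box_box, tsum_eq_sum (s := box (2 * N)), Finset.mul_sum]
    · refine Finset.sum_congr rfl fun n _ => ?_
      simp only [sub_sub_cancel, Finset.sum_const, nsmul_eq_mul]
      push_cast
      ring
    · intro n hn
      rw [filter_box_eq_empty hn]
      simp
  simp only [e]
  refine tendsto_tsum_of_dominated_convergence hg (fun n => ?_)
    (Eventually.of_forall fun N n => ?_)
  · have h := (Complex.continuous_ofReal.tendsto 1).comp (tendsto_card_filter_box n)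
    simpa using h.mul_const (g n)
  · rw [norm_mul, Complex.norm_real, Real.norm_of_nonneg (by positivity)]
    exact mul_le_of_le_one_left (norm_nonneg _)
      ((inv_mul_le_one₀ (two_mul_add_one_pos N)).mpr (card_filter_box_le N n))

lemma sum_box_box_sub_le {g : ℤ → ℝ} (hg : ∀ n, 0 ≤ g n) (N : ℕ) :
    ∑ k ∈ box N, ∑ l ∈ box N, g (k - l) ≤ (2 * N + 1) * ∑ n ∈ box (2 * N), g n := by
  rw [sum_box_box, Finset.mul_sum]
  refine Finset.sum_le_sum fun n _ => ?_
  simp only [sub_sub_cancel, Finset.sum_const, nsmul_eq_mul]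
  exact mul_le_mul_of_nonneg_right (card_filter_box_le N n) (hg n)

/-- Cesàro averages of a sequence that vanishes at infinity. -/
lemma tendsto_box_average_zero {g : ℤ → ℝ} (hg : ∀ n, 0 ≤ g n) (h0 : Tendsto g cofinite (𝓝 0)) :
    Tendsto (fun N : ℕ => ((2 * (N : ℝ) + 1)⁻¹) ^ 2 * ∑ k ∈ box N, ∑ l ∈ box N, g (k - l))
      atTop (𝓝 0) := by
  rw [Metric.tendsto_atTop]
  intro ε hε
  have hfin : {n | ¬ g n < ε / 4}.Finite := by
    have := h0.eventually (gt_mem_nhds (by positivity : (0 : ℝ) < ε / 4))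
    exact this
  set K := ∑ n ∈ hfin.toFinset, g n with hK
  have hbound : ∀ N : ℕ, ∑ n ∈ box (2 * N), g n ≤ K + (2 * (2 * N + 1)) * (ε / 4) := by
    intro N
    rw [← Finset.sum_filter_add_sum_filter_not (box (2 * N)) (fun n => ¬ g n < ε / 4)]
    refine add_le_add ?_ ?_
    · refine Finset.sum_le_sum_of_subset_of_nonneg (fun n hn => ?_) fun n _ _ => hg n
      simpa using (Finset.mem_filter.mp hn).2
    · refine (Finset.sum_le_card_nsmul _ _ (ε / 4) fun n hn => ?_).trans ?_
      · have := (Finset.mem_filter.mp hn).2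
        exact (not_not.mp this).le
      · rw [nsmul_eq_mul]
        have h1 : (((box (2 * N)).filter fun n => ¬¬g n < ε / 4).card : ℝ) ≤
            (box (2 * N)).card := by
          exact_mod_cast Finset.card_filter_le _ _
        rw [card_box] at h1
        push_cast at h1
        gcongr
        linarith
  have hKlim : Tendsto (fun N : ℕ => (2 * (N : ℝ) + 1)⁻¹ * K) atTop (𝓝 0) := by
    simpa using tendsto_inv_box.mul_const K
  obtain ⟨N0, hN0⟩ := (Metric.tendsto_atTop.mp hKlim) (ε / 2) (by positivity)
  refine ⟨N0, fun N hN => ?_⟩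
  have h1 := hN0 N hN
  have hp := two_mul_add_one_pos N
  rw [Real.dist_0_eq_abs] at h1 ⊢
  have hnn : 0 ≤ ∑ k ∈ box N, ∑ l ∈ box N, g (k - l) :=
    Finset.sum_nonneg fun _ _ => Finset.sum_nonneg fun _ _ => hg _
  rw [abs_of_nonneg (by positivity)]
  have h2 := (sum_box_box_sub_le hg N).trans
    (mul_le_mul_of_nonneg_left (hbound N) hp.le)
  calc ((2 * (N : ℝ) + 1)⁻¹) ^ 2 * ∑ k ∈ box N, ∑ l ∈ box N, g (k - l)
      ≤ ((2 * (N : ℝ) + 1)⁻¹) ^ 2 *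
        ((2 * N + 1) * (K + (2 * (2 * N + 1)) * (ε / 4))) := by gcongr
    _ = (2 * (N : ℝ) + 1)⁻¹ * K + ε / 2 := by field_simp; ring
    _ < ε := by linarith [le_abs_self ((2 * (N : ℝ) + 1)⁻¹ * K)]

end DoubleSums

/-! ### States and translations -/

section States

variable {p : ℕ} {ω : QuasiLocal p →ₗ[ℂ] ℂ}

/-- A state as a positive linear map. -/
def IsState.toPositive (hω : IsState ω) : QuasiLocal p →ₚ[ℂ] ℂ :=
  PositiveLinearMap.mk₀ ω fun X hX => by
    obtain ⟨c, rfl⟩ := CStarAlgebra.nonneg_iff_eq_star_mul_self.mp hX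
    exact hω.nonneg c

lemma IsState.toPositive_apply (hω : IsState ω) (X : QuasiLocal p) : hω.toPositive X = ω X := rfl

lemma IsState.norm_apply_le (hω : IsState ω) (X : QuasiLocal p) : ‖ω X‖ ≤ ‖X‖ :=
  norm_apply_le_norm hω.toPositive hω.map_one X

lemma IsState.continuous (hω : IsState ω) : Continuous ω :=
  (ω.mkContinuous 1 fun X => by simpa using hω.norm_apply_le X).continuous

lemma IsState.map_star (hω : IsState ω) (X : QuasiLocal p) : ω (star X) = star (ω X) :=
  StarHomClass.map_star hω.toPositive X

lemma translation_sub (n : ℤ) (A B : QuasiLocal p) :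
    translation n (A - B) = translation n A - translation n B :=
  toOp_injective (map_sub (translationAux n) (toOp A) (toOp B))

lemma translation_smul_one (n : ℤ) (z : ℂ) :
    translation n (z • (1 : QuasiLocal p)) = z • 1 :=
  toOp_injective (by
    change translationAux n (z • 1) = z • 1
    rw [map_smul, map_one])

lemma IsTranslationInvariant.apply (h : IsTranslationInvariant ω) (n : ℤ) (A : QuasiLocal p) :
    ω (translation n A) = ω A := by
  induction n using Int.induction_on with
  | zero => rw [translation_zero]
  | succ n ih => rw [add_comm, ← translation_add, h, ih]
  | pred n ih =>
    rw [← h (translation (-(n : ℤ) - 1) A), translation_add, ← ih]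
    congr 2
    ring

lemma IsTranslationInvariant.apply_site (h : IsTranslationInvariant ω) (k : ℤ)
    (a : Matrix (Fin p) (Fin p) ℂ) : ω (site k a) = ω (site 0 a) := by
  rw [← h.apply k (site 0 a), translation_site, zero_add]

lemma site_mul_site_eq_translation (k l : ℤ) (a b : Matrix (Fin p) (Fin p) ℂ) :
    site k a * site l b = translation k (site 0 a * site (l - k) b) := by
  rw [translation_mul, translation_site, translation_site, zero_add, sub_add_cancel]

end States

/-! ### Intensive observables -/

section Intensive

variable {p : ℕ} {ω : QuasiLocal p →ₗ[ℂ] ℂ}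

/-- Averages of the translates of `O` over subsets of the boxes have vanishing variance. -/
lemma tendsto_rightNorm_average (hω : IsState ω) (hti : IsTranslationInvariant ω)
    (hcl : IsClustering ω) (O : QuasiLocal p) (s : ℕ → Finset ℤ) (hs : ∀ N, s N ⊆ box N) :
    Tendsto (fun N : ℕ => rightNorm hω.toPositive ((((2 * (N : ℝ) + 1)⁻¹ : ℝ) : ℂ) •
      ∑ k ∈ s N, (translation k O - ω O • 1))) atTop (𝓝 0) := by
  set Q : QuasiLocal p := O - ω O • 1 with hQ
  have hQ0 : ω Q = 0 := by simp [hQ, hω.map_one]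
  have hQt : ∀ k, translation k O - ω O • 1 = translation k Q := fun k => by
    rw [hQ, translation_sub, translation_smul_one]
  set g : ℤ → ℝ := fun n => ‖ω (translation n Q * star Q)‖ with hg
  have hg0 : Tendsto g cofinite (𝓝 0) := by
    have h := (hcl Q (star Q)).norm
    rw [hQ0, zero_mul, norm_zero] at h
    exact h
  have hlim := tendsto_box_average_zero (fun n => norm_nonneg _) hg0
  have hsqrt : Tendsto (fun N : ℕ => √(((2 * (N : ℝ) + 1)⁻¹) ^ 2 *
      ∑ k ∈ box N, ∑ l ∈ box N, g (k - l))) atTop (𝓝 0) := by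
    have := (Real.continuous_sqrt.tendsto 0).comp hlim
    rwa [Real.sqrt_zero] at this
  refine squeeze_zero (fun N => rightNorm_nonneg _ _) (fun N => ?_) hsqrt
  refine Real.le_sqrt_of_sq_le ?_
  rw [rightNorm_smul, mul_pow, Complex.norm_real, Real.norm_of_nonneg (by positivity)]
  gcongr
  have hω2 : ∀ k l, ω (translation k Q * star (translation l Q)) =
      ω (translation (k - l) Q * star Q) := fun k l => by
    rw [← hti.apply l (translation (k - l) Q * star Q), translation_mul, translation_add,
      translation_star, add_sub_cancel]
  rw [rightNorm_sq_re, star_sum, Finset.sum_mul_sum, map_sum]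
  simp only [map_sum, hQt, hω.toPositive_apply, hω2]
  refine (Complex.re_le_norm _).trans ((norm_sum_le _ _).trans ?_)
  refine (Finset.sum_le_sum fun k _ => norm_sum_le _ _).trans ?_
  refine (Finset.sum_le_sum fun k _ => Finset.sum_le_sum_of_subset_of_nonneg (hs N)
    fun _ _ _ => norm_nonneg _).trans ?_
  exact Finset.sum_le_sum_of_subset_of_nonneg (hs N)
    fun _ _ _ => Finset.sum_nonneg fun _ _ => norm_nonneg _

/-- Mean-field observables `(2N+1)⁻¹ ∑_{k,l} J(k-l) a^{(k)} b^{(l)}` of the box `[-N, N]`. -/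
def pairAverage (J : ℤ → ℂ) (a b : Matrix (Fin p) (Fin p) ℂ) (N : ℕ) : QuasiLocal p :=
  (((2 * (N : ℝ) + 1)⁻¹ : ℝ) : ℂ) • ∑ k ∈ box N, ∑ l ∈ box N, J (k - l) • (site k a * site l b)

/-- Sequences of local observables that become classical in the limit: uniformly bounded, with
uniformly bounded total oscillation, and with vanishing variance. -/
structure IsIntensive (hω : IsState ω) (A : ℕ → QuasiLocal p) : Prop where
  mem : ∀ N, toOp (A N) ∈ localAlgebra p N
  norm_le : ∃ C, ∀ N, ‖A N‖ ≤ C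
  totalOsc_le : ∃ C, ∀ N, totalOsc N (A N) ≤ C
  tendsto : Tendsto (fun N => rightNorm hω.toPositive (A N - ω (A N) • 1)) atTop (𝓝 0)

lemma toOp_site_mem {N : ℕ} {k : ℤ} (hk : k ∈ box N) (a : Matrix (Fin p) (Fin p) ℂ) :
    toOp (site k a) ∈ localAlgebra p N :=
  StarAlgebra.subset_adjoin ℂ _ ⟨k, hk, a, rfl⟩

lemma IsIntensive.add {hω : IsState ω} {A B : ℕ → QuasiLocal p} (hA : IsIntensive hω A)
    (hB : IsIntensive hω B) : IsIntensive hω fun N => A N + B N where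
  mem N := by rw [map_add]; exact add_mem (hA.mem N) (hB.mem N)
  norm_le := by
    obtain ⟨C, hC⟩ := hA.norm_le
    obtain ⟨D, hD⟩ := hB.norm_le
    exact ⟨C + D, fun N => (norm_add_le _ _).trans (add_le_add (hC N) (hD N))⟩
  totalOsc_le := by
    obtain ⟨C, hC⟩ := hA.totalOsc_le
    obtain ⟨D, hD⟩ := hB.totalOsc_le
    exact ⟨C + D, fun N => (totalOsc_add_le _ _ _).trans (add_le_add (hC N) (hD N))⟩
  tendsto := by
    have h := hA.tendsto.add hB.tendsto
    rw [add_zero] at h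
    refine squeeze_zero (fun N => rightNorm_nonneg _ _) (fun N => ?_) h
    refine le_of_eq_of_le ?_ (rightNorm_add_le _ _ _)
    rw [map_add]
    congr 1
    module

lemma IsIntensive.smul {hω : IsState ω} {A : ℕ → QuasiLocal p} (hA : IsIntensive hω A)
    (z : ℂ) : IsIntensive hω fun N => z • A N where
  mem N := by rw [map_smul]; exact SMulMemClass.smul_mem z (hA.mem N)
  norm_le := by
    obtain ⟨C, hC⟩ := hA.norm_le
    exact ⟨‖z‖ * C, fun N => by rw [norm_smul]; gcongr; exact hC N⟩
  totalOsc_le := by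
    obtain ⟨C, hC⟩ := hA.totalOsc_le
    exact ⟨‖z‖ * C, fun N => by rw [totalOsc_smul]; gcongr; exact hC N⟩
  tendsto := by
    have h := hA.tendsto.const_mul ‖z‖
    rw [mul_zero] at h
    refine h.congr fun N => ?_
    rw [← rightNorm_smul, map_smul, smul_sub, smul_assoc]

lemma IsIntensive.zero (hω : IsState ω) : IsIntensive hω fun _ => (0 : QuasiLocal p) where
  mem N := by rw [map_zero]; exact zero_mem _
  norm_le := ⟨0, fun N => by simp⟩
  totalOsc_le := ⟨0, fun N => by simp [totalOsc, osc_zero]⟩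
  tendsto := by simp [rightNorm]

lemma IsIntensive.sum {hω : IsState ω} {ι : Type*} (s : Finset ι) {A : ι → ℕ → QuasiLocal p}
    (hA : ∀ i, IsIntensive hω (A i)) : IsIntensive hω fun N => ∑ i ∈ s, A i N := by
  classical
  induction s using Finset.induction_on with
  | empty => simpa using IsIntensive.zero hω
  | insert i s hi ih =>
    simp only [Finset.sum_insert hi]
    exact (hA i).add ih

/-- Clustering makes mean-field observables intensive. -/
theorem isIntensive_pairAverage (hω : IsState ω) (hti : IsTranslationInvariant ω)
    (hcl : IsClustering ω) {J : ℤ → ℂ} (hJ : Summable fun n => ‖J n‖)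
    (a b : Matrix (Fin p) (Fin p) ℂ) : IsIntensive hω (pairAverage J a b) := by
  have hsumJ : ∀ N : ℕ, ∑ k ∈ box N, ∑ l ∈ box N, ‖J (k - l)‖ ≤ (2 * N + 1) * ∑' n, ‖J n‖ := by
    intro N
    refine (Finset.sum_le_card_nsmul _ _ (∑' n, ‖J n‖) fun k _ =>
      sum_norm_comp_le_tsum hJ (box N) (f := fun l => k - l) sub_right_injective).trans_eq ?_
    rw [nsmul_eq_mul, card_box]
  -- A uniform bound of the summands bounds the average.
  have havg : ∀ (N : ℕ) (c : ℝ), (2 * (N : ℝ) + 1)⁻¹ *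
      ∑ k ∈ box N, ∑ l ∈ box N, ‖J (k - l)‖ * |c| ≤ (∑' n, ‖J n‖) * |c| := by
    intro N c
    simp only [← Finset.sum_mul]
    rw [← mul_assoc]
    refine mul_le_mul_of_nonneg_right ?_ (abs_nonneg c)
    rw [inv_mul_le_iff₀ (two_mul_add_one_pos N)]
    exact hsumJ N
  have hinv : ∀ N : ℕ, ‖(((2 * (N : ℝ) + 1)⁻¹ : ℝ) : ℂ)‖ = (2 * (N : ℝ) + 1)⁻¹ := fun N => by
    rw [Complex.norm_real, Real.norm_of_nonneg (by positivity)]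
  refine ⟨fun N => ?_, ?_, ?_, ?_⟩
  · rw [pairAverage, map_smul, map_sum]
    refine SMulMemClass.smul_mem _ (sum_mem fun k hk => ?_)
    rw [map_sum]
    refine sum_mem fun l hl => ?_
    rw [map_smul, map_mul]
    exact SMulMemClass.smul_mem _ (mul_mem (toOp_site_mem hk a) (toOp_site_mem hl b))
  · refine ⟨(∑' n, ‖J n‖) * |‖site 0 a‖ * ‖site 0 b‖|, fun N => le_trans ?_ (havg N _)⟩
    rw [pairAverage, norm_smul, hinv]
    gcongr
    refine (norm_sum_le _ _).trans (Finset.sum_le_sum fun k _ =>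
      (norm_sum_le _ _).trans (Finset.sum_le_sum fun l _ => ?_))
    rw [norm_smul]
    gcongr
    refine (norm_mul_le _ _).trans (le_trans ?_ (le_abs_self _))
    exact mul_le_mul (norm_site _ _) (norm_site _ _) (norm_nonneg _) (norm_nonneg _)
  · refine ⟨(∑' n, ‖J n‖) * |‖site 0 a‖ * osc 0 (site 0 b) + osc 0 (site 0 a) * ‖site 0 b‖|,
      fun N => le_trans ?_ (havg N _)⟩
    rw [pairAverage, totalOsc_smul, hinv]
    gcongr
    refine (totalOsc_sum_le _ _ _).trans (Finset.sum_le_sum fun k _ =>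
      (totalOsc_sum_le _ _ _).trans (Finset.sum_le_sum fun l _ => ?_))
    rw [totalOsc_smul]
    gcongr
    refine (totalOsc_mul_le _ _ _).trans (le_trans ?_ (le_abs_self _))
    exact add_le_add
      (mul_le_mul (norm_site _ _) (totalOsc_site_le _ _ _) (totalOsc_nonneg _ _) (norm_nonneg _))
      (mul_le_mul (totalOsc_site_le _ _ _) (norm_site _ _) (norm_nonneg _) (osc_nonneg _ _))
  -- For a fixed distance `n` the pairs `(k, k - n)` give an average of translates of
  -- `a^{(0)} b^{(-n)}`, whose variance vanishes; the sum over `n` is dominated by `J`.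
  · set O : ℤ → QuasiLocal p := fun n => site 0 a * site (-n) b with hO
    set s : ℤ → ℕ → Finset ℤ := fun n N => (box N).filter (fun k => k - n ∈ box N) with hs
    set Y : ℤ → ℕ → QuasiLocal p := fun n N => (((2 * (N : ℝ) + 1)⁻¹ : ℝ) : ℂ) •
      ∑ k ∈ s n N, (translation k (O n) - ω (O n) • 1) with hY
    have hYlim : ∀ n, Tendsto (fun N => rightNorm hω.toPositive (Y n N)) atTop (𝓝 0) := fun n =>
      tendsto_rightNorm_average hω hti hcl (O n) (s n) fun N => Finset.filter_subset _ _
    have hYbd : ∀ n N, rightNorm hω.toPositive (Y n N) ≤ 2 * (‖site 0 a‖ * ‖site 0 b‖) := by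
      intro n N
      refine (rightNorm_le_norm _ hω.map_one _).trans ?_
      have hOn : ‖O n‖ ≤ ‖site 0 a‖ * ‖site 0 b‖ :=
        (norm_mul_le _ _).trans (mul_le_mul_of_nonneg_left (norm_site _ _) (norm_nonneg _))
      have h1 : ∀ k, ‖translation k (O n) - ω (O n) • 1‖ ≤ 2 * (‖site 0 a‖ * ‖site 0 b‖) := by
        intro k
        rw [show translation k (O n) - ω (O n) • 1 = translation k (O n) -
          translation k (ω (O n) • 1) by rw [translation_smul_one]]
        refine (norm_sub_le _ _).trans ?_
        rw [two_mul]
        refine add_le_add ((norm_translation_le _ _).trans hOn)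
          ((norm_translation_le _ _).trans ?_)
        rw [norm_smul]
        have h2 : ‖(1 : QuasiLocal p)‖ ≤ 1 := by
          rcases subsingleton_or_nontrivial (QuasiLocal p) with h | h
          · rw [Subsingleton.elim (1 : QuasiLocal p) 0, norm_zero]; exact zero_le_one
          · rw [norm_one]
        exact (mul_le_of_le_one_right (norm_nonneg _) h2).trans
          ((hω.norm_apply_le _).trans hOn)
      simp only [hY]
      rw [norm_smul, hinv, inv_mul_le_iff₀ (two_mul_add_one_pos N)]
      refine (norm_sum_le _ _).trans ((Finset.sum_le_card_nsmul _ _ _ fun k _ => h1 k).trans ?_)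
      rw [nsmul_eq_mul]
      exact mul_le_mul_of_nonneg_right (card_filter_box_le N n) (by positivity)
    have hdecomp : ∀ N, pairAverage J a b N - ω (pairAverage J a b N) • 1 =
        ∑ n ∈ box (2 * N), J n • Y n N := by
      intro N
      have e1 : pairAverage J a b N = ∑ n ∈ box (2 * N), J n •
          ((((2 * (N : ℝ) + 1)⁻¹ : ℝ) : ℂ) • ∑ k ∈ s n N, translation k (O n)) := by
        rw [pairAverage, sum_box_box, Finset.smul_sum]
        refine Finset.sum_congr rfl fun n _ => ?_
        rw [smul_comm]
        congr 1
        rw [Finset.smul_sum]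
        refine Finset.sum_congr rfl fun k _ => ?_
        rw [sub_sub_cancel, site_mul_site_eq_translation, hO]
        congr 4
        ring
      rw [e1, map_sum, Finset.sum_smul, ← Finset.sum_sub_distrib]
      refine Finset.sum_congr rfl fun n _ => ?_
      simp only [hY, Finset.sum_sub_distrib, map_smul, map_sum, hti.apply, smul_sub, smul_assoc,
        Finset.sum_smul]
    have htan : Tendsto (fun N => ∑' n, ‖J n‖ * rightNorm hω.toPositive (Y n N)) atTop
        (𝓝 (∑' _ : ℤ, (0 : ℝ))) := by
      refine tendsto_tsum_of_dominated_convergence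
        (hJ.mul_right (2 * (‖site 0 a‖ * ‖site 0 b‖))) (fun n => ?_)
        (Eventually.of_forall fun N n => ?_)
      · simpa using (hYlim n).const_mul ‖J n‖
      · rw [Real.norm_of_nonneg (mul_nonneg (norm_nonneg _) (rightNorm_nonneg _ _))]
        exact mul_le_mul_of_nonneg_left (hYbd n N) (norm_nonneg _)
    rw [tsum_zero] at htan
    refine squeeze_zero (fun N => rightNorm_nonneg _ _) (fun N => ?_) htan
    rw [hdecomp]
    refine (rightNorm_sum_le _ _ _).trans ?_
    simp only [rightNorm_smul]
    refine Summable.sum_le_tsum (box (2 * N)) (fun n _ =>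
      mul_nonneg (norm_nonneg _) (rightNorm_nonneg _ _)) ?_
    exact Summable.of_nonneg_of_le (fun n => mul_nonneg (norm_nonneg _) (rightNorm_nonneg _ _))
      (fun n => mul_le_mul_of_nonneg_left (hYbd n N) (norm_nonneg _))
      (hJ.mul_right (2 * (‖site 0 a‖ * ‖site 0 b‖)))

/-- Averages of a single-site observable. -/
def siteAverage (a : Matrix (Fin p) (Fin p) ℂ) (N : ℕ) : QuasiLocal p :=
  (((2 * (N : ℝ) + 1)⁻¹ : ℝ) : ℂ) • ∑ k ∈ box N, site k a

lemma isIntensive_siteAverage (hω : IsState ω) (hti : IsTranslationInvariant ω)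
    (hcl : IsClustering ω) (a : Matrix (Fin p) (Fin p) ℂ) : IsIntensive hω (siteAverage a) := by
  have hJ : Summable fun n : ℤ => ‖(Pi.single 0 1 : ℤ → ℂ) n‖ :=
    summable_of_ne_finset_zero (s := {0}) fun n hn => by
      rw [Pi.single_eq_of_ne (by simpa using hn), norm_zero]
  have h := isIntensive_pairAverage hω hti hcl hJ a 1
  have e : pairAverage (Pi.single 0 1) a 1 = siteAverage a := by
    funext N
    rw [pairAverage, siteAverage]
    congr 1
    refine Finset.sum_congr rfl fun k hk => ?_
    rw [Finset.sum_eq_single_of_mem k hk fun l _ hl => ?_]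
    · simp [site_one]
    · rw [Pi.single_eq_of_ne (sub_ne_zero.mpr hl.symm), zero_smul]
  rwa [e] at h

end Intensive

/-! ### Second-order expansion of a Lindblad generator on exponentials -/

section SecondOrder

variable {A : Type*} [CStarAlgebra A] {ι : Type*} [Fintype ι]

lemma lindblad_apply_comm (H : A) (c : Matrix ι ι ℂ) (V : ι → A) (X : A) :
    lindblad H c V X = Complex.I • ⁅H, X⁆ +
      ∑ i, ∑ j, c i j • ((1 / 2 : ℂ) • (V i * ⁅X, star (V j)⁆ + ⁅V i, X⁆ * star (V j))) := by
  rw [lindblad_apply]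
  congr 1
  refine Finset.sum_congr rfl fun i _ => Finset.sum_congr rfl fun j _ => ?_
  congr 1
  simp only [Ring.lie_def, sub_mul, mul_sub, smul_add, smul_sub, mul_assoc]
  module

/-- The polarised second order term of `L[e^{iF}] e^{-iF}` in `F`. -/
def secondOrder (H : A) (c : Matrix ι ι ℂ) (V : ι → A) (F F' : A) : A :=
  (Complex.I / 2) • ⁅F, ⁅F', H⁆⁆ + ∑ i, ∑ j, c i j • ((1 / 2 : ℂ) •
    (-((1 / 2 : ℂ) • (V i * ⁅F, ⁅F', star (V j)⁆⁆)) +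
      (1 / 2 : ℂ) • (⁅F, ⁅F', V i⁆⁆ * star (V j)) + ⁅F, V i⁆ * ⁅F', star (V j)⁆))

/-- On the diagonal the second order term is expressed by `L` itself, which gives access to its
expectation in an invariant state. -/
lemma secondOrder_eq (H : A) (c : Matrix ι ι ℂ) (V : ι → A) (F : A) :
    secondOrder H c V F F =
      -((1 / 2 : ℂ) • lindblad H c V (F * F)) + lindblad H c V F * F := by
  have e : ∀ i j, c i j • ((1 / 2 : ℂ) •
      (-((1 / 2 : ℂ) • (V i * ⁅F, ⁅F, star (V j)⁆⁆)) +
        (1 / 2 : ℂ) • (⁅F, ⁅F, V i⁆⁆ * star (V j)) + ⁅F, V i⁆ * ⁅F, star (V j)⁆)) =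
      -((1 / 2 : ℂ) • (c i j • ((1 / 2 : ℂ) •
        (V i * ⁅F * F, star (V j)⁆ + ⁅V i, F * F⁆ * star (V j))))) +
      c i j • ((1 / 2 : ℂ) • (V i * ⁅F, star (V j)⁆ + ⁅V i, F⁆ * star (V j))) * F := by
    intro i j
    rw [smul_comm (1 / 2 : ℂ) (c i j), smul_mul_assoc, ← smul_neg, ← smul_add]
    simp only [Ring.lie_def, sub_mul, mul_sub, add_mul, smul_mul_assoc, mul_assoc, smul_sub,
      smul_add]
    module
  have e2 : (Complex.I / 2) • ⁅F, ⁅F, H⁆⁆ =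
      -((1 / 2 : ℂ) • (Complex.I • ⁅H, F * F⁆)) + Complex.I • ⁅H, F⁆ * F := by
    simp only [Ring.lie_def, sub_mul, mul_sub, smul_mul_assoc, mul_assoc, smul_sub]
    module
  rw [secondOrder, lindblad_apply_comm, lindblad_apply_comm, e2,
    Finset.sum_congr rfl fun i _ => Finset.sum_congr rfl fun j _ => e i j]
  simp only [Finset.sum_add_distrib, Finset.sum_neg_distrib, ← Finset.smul_sum (r := (1 / 2 : ℂ)),
    ← Finset.sum_mul]
  rw [add_mul, smul_add (1 / 2 : ℂ) (Complex.I • _)]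
  abel

/-- The second order term as a bilinear map. -/
def secondOrderBilin (H : A) (c : Matrix ι ι ℂ) (V : ι → A) : A →ₗ[ℂ] A →ₗ[ℂ] A :=
  LinearMap.mk₂ ℂ (secondOrder H c V)
    (fun F F' G => by
      simp only [secondOrder, add_comm_right, mul_add, add_mul, smul_add, neg_add,
        Finset.sum_add_distrib]
      abel)
    (fun z F G => by
      simp only [secondOrder, smul_comm_right, mul_smul_comm, smul_mul_assoc, smul_add,
        Finset.smul_sum, smul_neg, smul_comm z])
    (fun F G G' => by
      simp only [secondOrder, comm_add, add_comm_right, mul_add, add_mul, smul_add, neg_add,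
        Finset.sum_add_distrib]
      abel)
    (fun z F G => by
      simp only [secondOrder, smul_comm_right, comm_smul, mul_smul_comm, smul_mul_assoc, smul_add,
        Finset.smul_sum, smul_neg, smul_comm z])

lemma lie_exp (a X : A) :
    ⁅NormedSpace.exp a, X⁆ = (expConj a 1 X - X) * NormedSpace.exp a := by
  rw [Ring.lie_def, expConj, one_smul, sub_mul, mul_assoc _ _ (NormedSpace.exp a),
    exp_neg_mul_exp, mul_one]

/-- The generator on an exponential. -/
lemma lindblad_exp (H : A) (c : Matrix ι ι ℂ) (V : ι → A) (a : A) :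
    lindblad H c V (NormedSpace.exp a) =
      (-(Complex.I • (expConj a 1 H - H)) + ∑ i, ∑ j, c i j • ((1 / 2 : ℂ) •
        (V i * (expConj a 1 (star (V j)) - star (V j)) -
          (expConj a 1 (V i) - V i) * star (V j) -
          (expConj a 1 (V i) - V i) * (expConj a 1 (star (V j)) - star (V j))))) *
        NormedSpace.exp a := by
  set W := NormedSpace.exp a with hW
  have hc : ∀ X : A, W * X = expConj a 1 X * W := fun X => by
    have := lie_exp a X
    rw [Ring.lie_def, sub_mul] at this
    simpa using this
  rw [lindblad_apply_comm, add_mul, Finset.sum_mul]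
  congr 1
  · rw [Ring.lie_def, hc, neg_mul, smul_mul_assoc, ← smul_neg, sub_mul, neg_sub]
  · refine Finset.sum_congr rfl fun i _ => ?_
    rw [Finset.sum_mul]
    refine Finset.sum_congr rfl fun j _ => ?_
    rw [smul_mul_assoc, smul_mul_assoc]
    congr 2
    have h1 : ⁅V i, W⁆ * star (V j) = (V i - expConj a 1 (V i)) *
        (expConj a 1 (star (V j)) * W) := by
      rw [Ring.lie_def, hc, ← hc (star (V j)), ← sub_mul, mul_assoc]
    rw [lie_exp, h1]
    noncomm_ring

/-- Expansion of `L[e^{iF}] e^{-iF}` to second order in `F`. -/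
theorem exists_lindblad_exp (H : A) (c : Matrix ι ι ℂ) (V : ι → A) {F : A} (hF : star F = F) :
    ∃ ρ : A, lindblad H c V (NormedSpace.exp (Complex.I • F)) =
        (Complex.I • lindblad H c V F + secondOrder H c V F F + ρ) *
          NormedSpace.exp (Complex.I • F) ∧
      ‖ρ‖ ≤ ‖⁅F, ⁅F, ⁅F, H⁆⁆⁆‖ + ∑ i, ∑ j, ‖c i j‖ *
        (‖V i‖ * ‖⁅F, ⁅F, ⁅F, star (V j)⁆⁆⁆‖ + ‖⁅F, ⁅F, ⁅F, V i⁆⁆⁆‖ * ‖star (V j)‖ +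
          (‖⁅F, ⁅F, V i⁆⁆‖ * ‖⁅F, star (V j)⁆‖ + ‖⁅F, V i⁆‖ * ‖⁅F, ⁅F, star (V j)⁆⁆‖)) := by
  set a : A := Complex.I • F with ha
  have has : star a = -a := by simp [ha, hF]
  set δ : A → A := fun X => expConj a 1 X - X with hδ
  set ρ₃ : A → A := fun X => δ X - ⁅a, X⁆ - (1 / 2 : ℝ) • ⁅a, ⁅a, X⁆⁆ with hρ₃
  set ρ₂ : A → A := fun X => δ X - ⁅a, X⁆ with hρ₂
  have had1 : ∀ X : A, ⁅a, X⁆ = Complex.I • ⁅F, X⁆ := fun X => by rw [ha, smul_comm_right]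
  have had2 : ∀ X : A, ⁅a, ⁅a, X⁆⁆ = -⁅F, ⁅F, X⁆⁆ := fun X => by
    rw [had1, had1, comm_smul, smul_smul, Complex.I_mul_I, neg_one_smul]
  have hn1 : ∀ X : A, ‖⁅a, X⁆‖ = ‖⁅F, X⁆‖ := fun X => by
    rw [had1, norm_smul, Complex.norm_I, one_mul]
  have hn2 : ∀ X : A, ‖⁅a, ⁅a, X⁆⁆‖ = ‖⁅F, ⁅F, X⁆⁆‖ := fun X => by rw [had2, norm_neg]
  have hn3 : ∀ X : A, ‖⁅a, ⁅a, ⁅a, X⁆⁆⁆‖ = ‖⁅F, ⁅F, ⁅F, X⁆⁆⁆‖ := fun X => by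
    rw [had2, norm_neg, had1, comm_smul, comm_smul, norm_smul, Complex.norm_I, one_mul]
  have hb3 : ∀ X, ‖ρ₃ X‖ ≤ ‖⁅F, ⁅F, ⁅F, X⁆⁆⁆‖ := fun X =>
    (norm_expConj_taylor_le has X).trans_eq (hn3 X)
  have hb2 : ∀ X, ‖ρ₂ X‖ ≤ ‖⁅F, ⁅F, X⁆⁆‖ := fun X => by
    have := norm_expConj_sub_sub_le has X (θ := 1) ⟨zero_le_one, le_rfl⟩
    rw [one_smul, hn2] at this
    exact this
  have hb1 : ∀ X, ‖δ X‖ ≤ ‖⁅F, X⁆‖ := fun X =>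
    (norm_expConj_sub_le has X (θ := 1) ⟨zero_le_one, le_rfl⟩).trans_eq (hn1 X)
  refine ⟨-(Complex.I • ρ₃ H) + ∑ i, ∑ j, c i j • ((1 / 2 : ℂ) •
    (V i * ρ₃ (star (V j)) - ρ₃ (V i) * star (V j) -
      (ρ₂ (V i) * δ (star (V j)) + ⁅a, V i⁆ * ρ₂ (star (V j))))), ?_, ?_⟩
  · rw [lindblad_exp]
    congr 1
    have e3 : ∀ X : A, ρ₃ X = δ X - Complex.I • ⁅F, X⁆ + (1 / 2 : ℂ) • ⁅F, ⁅F, X⁆⁆ := fun X => by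
      change δ X - ⁅a, X⁆ - (1 / 2 : ℝ) • ⁅a, ⁅a, X⁆⁆ = _
      rw [had2, had1, smul_neg, sub_neg_eq_add, ← Complex.coe_smul]
      norm_num
    have e : ∀ i j, c i j • ((1 / 2 : ℂ) • (V i * δ (star (V j)) - δ (V i) * star (V j) -
        δ (V i) * δ (star (V j)))) =
        Complex.I • (c i j • ((1 / 2 : ℂ) • (V i * ⁅F, star (V j)⁆ + ⁅V i, F⁆ * star (V j)))) +
        c i j • ((1 / 2 : ℂ) • (-((1 / 2 : ℂ) • (V i * ⁅F, ⁅F, star (V j)⁆⁆)) +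
          (1 / 2 : ℂ) • (⁅F, ⁅F, V i⁆⁆ * star (V j)) + ⁅F, V i⁆ * ⁅F, star (V j)⁆)) +
        c i j • ((1 / 2 : ℂ) • (V i * ρ₃ (star (V j)) - ρ₃ (V i) * star (V j) -
          (ρ₂ (V i) * δ (star (V j)) + ⁅a, V i⁆ * ρ₂ (star (V j))))) := by
      intro i j
      rw [smul_comm Complex.I, smul_comm Complex.I, ← smul_add, ← smul_add, ← smul_add,
        ← smul_add]
      congr 2
      have e2 : ∀ X, ρ₂ X = δ X - Complex.I • ⁅F, X⁆ := fun X => by simp only [hρ₂, had1]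
      have e4 : ⁅V i, F⁆ = -⁅F, V i⁆ := by simp only [Ring.lie_def, neg_sub]
      simp only [e3, e2, e4, had1, mul_sub, sub_mul, mul_add, add_mul, mul_smul_comm,
        smul_mul_assoc, smul_add, smul_neg, neg_mul]
      rw [smul_smul Complex.I Complex.I, Complex.I_mul_I]
      module
    have e0 : -(Complex.I • δ H) = Complex.I • (Complex.I • ⁅H, F⁆) +
        (Complex.I / 2) • ⁅F, ⁅F, H⁆⁆ + -(Complex.I • ρ₃ H) := by
      have e4 : ⁅H, F⁆ = -⁅F, H⁆ := by simp only [Ring.lie_def, neg_sub]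
      rw [e3, e4]
      simp only [smul_add, smul_sub, smul_neg]
      rw [smul_smul Complex.I Complex.I]
      module
    change -(Complex.I • δ H) + ∑ i, ∑ j, c i j • ((1 / 2 : ℂ) •
      (V i * δ (star (V j)) - δ (V i) * star (V j) - δ (V i) * δ (star (V j)))) = _
    rw [lindblad_apply_comm, secondOrder, e0]
    simp only [e, Finset.sum_add_distrib, ← Finset.smul_sum, smul_add]
    abel
  · refine (norm_add_le _ _).trans (add_le_add ?_ ?_)
    · rw [norm_neg, norm_smul, Complex.norm_I, one_mul]
      exact hb3 H
    · refine (norm_sum_le _ _).trans (Finset.sum_le_sum fun i _ =>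
        (norm_sum_le _ _).trans (Finset.sum_le_sum fun j _ => ?_))
      rw [norm_smul, norm_smul]
      refine mul_le_mul_of_nonneg_left ?_ (norm_nonneg _)
      refine (mul_le_of_le_one_left (norm_nonneg _) (by norm_num)).trans ?_
      refine (norm_sub_le _ _).trans (add_le_add ((norm_sub_le _ _).trans (add_le_add ?_ ?_))
        ((norm_add_le _ _).trans (add_le_add ?_ ?_)))
      · exact (norm_mul_le _ _).trans (mul_le_mul_of_nonneg_left (hb3 _) (norm_nonneg _))
      · exact (norm_mul_le _ _).trans (mul_le_mul_of_nonneg_right (hb3 _) (norm_nonneg _))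
      · exact (norm_mul_le _ _).trans (mul_le_mul (hb2 _) (hb1 _) (norm_nonneg _) (norm_nonneg _))
      · exact (norm_mul_le _ _).trans (mul_le_mul (hn1 _).le (hb2 _) (norm_nonneg _)
          (norm_nonneg _))

end SecondOrder

/-! ### Local fluctuations -/

section Fluctuations

variable {p d : ℕ} {ω : QuasiLocal p →ₗ[ℂ] ℂ}

/-- The fluctuation scale `(2N+1)^{-1/2}`. -/
def scale (N : ℕ) : ℝ := 1 / Real.sqrt (2 * N + 1)

lemma scale_nonneg (N : ℕ) : 0 ≤ scale N := by unfold scale; positivity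

lemma scale_mul_self (N : ℕ) : scale N * scale N = (2 * (N : ℝ) + 1)⁻¹ := by
  rw [scale, div_mul_div_comm, Real.mul_self_sqrt (two_mul_add_one_pos N).le, one_mul, one_div]

lemma card_mul_scale_cube (N : ℕ) : (2 * (N : ℝ) + 1) * scale N ^ 3 = scale N := by
  rw [pow_succ, sq, scale_mul_self, ← mul_assoc,
    mul_inv_cancel₀ (two_mul_add_one_pos N).ne', one_mul]

lemma tendsto_scale : Tendsto scale atTop (𝓝 0) := by
  have h := (Real.continuous_sqrt.tendsto 0).comp tendsto_inv_box
  rw [Real.sqrt_zero] at h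
  refine h.congr fun N => ?_
  simp [scale, Real.sqrt_inv]

lemma fluct_eq (N : ℕ) (y : Matrix (Fin p) (Fin p) ℂ) :
    fluct ω N y = (scale N : ℂ) • ∑ k ∈ box N, (site k y - ω (site 0 y) • 1) := rfl

/-- The fluctuation map as a linear map. -/
def fluctLin (ω : QuasiLocal p →ₗ[ℂ] ℂ) (N : ℕ) : Matrix (Fin p) (Fin p) ℂ →ₗ[ℂ] QuasiLocal p where
  toFun := fluct ω N
  map_add' y z := by
    simp only [fluct_eq, site_add, map_add, add_smul, ← smul_add, ← Finset.sum_add_distrib]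
    congr 1
    refine Finset.sum_congr rfl fun k _ => ?_
    abel
  map_smul' c y := by
    simp only [fluct_eq, site_smul, map_smul, smul_assoc, ← smul_sub, ← Finset.smul_sum,
      RingHom.id_apply]
    rw [smul_comm]

/-- The observable `∑ r_i x_i`. -/
def combo (x : Fin d → Matrix (Fin p) (Fin p) ℂ) (r : Fin d → ℝ) : Matrix (Fin p) (Fin p) ℂ :=
  ∑ i, (r i : ℂ) • x i

lemma fluctVec_eq_fluct (x : Fin d → Matrix (Fin p) (Fin p) ℂ) (N : ℕ) (r : Fin d → ℝ) :
    fluctVec ω x N r = fluct ω N (combo x r) := by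
  change _ = fluctLin ω N (combo x r)
  rw [combo, map_sum]
  simp only [map_smul]
  rfl

lemma combo_isHermitian {x : Fin d → Matrix (Fin p) (Fin p) ℂ} (hx : ∀ i, (x i).IsHermitian)
    (r : Fin d → ℝ) : (combo x r).IsHermitian := by
  simp only [Matrix.IsHermitian, combo, Matrix.conjTranspose_sum, Matrix.conjTranspose_smul,
    (hx _).eq, Complex.star_def, Complex.conj_ofReal]

lemma fluct_star (hω : IsState ω) {y : Matrix (Fin p) (Fin p) ℂ} (hy : y.IsHermitian) (N : ℕ) :
    star (fluct ω N y) = fluct ω N y := by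
  have h : star (ω (site 0 y)) = ω (site 0 y) := by rw [← hω.map_star, site_star, hy.eq]
  simp only [fluct_eq, star_smul, star_sum, star_sub, site_star, hy.eq, h, star_one,
    Complex.star_def, Complex.conj_ofReal]

lemma lie_smul_one (X : QuasiLocal p) (z : ℂ) : ⁅z • (1 : QuasiLocal p), X⁆ = 0 := by
  simp [Ring.lie_def]

lemma lie_fluct_site {N : ℕ} {k : ℤ} (hk : k ∈ box N) (y b : Matrix (Fin p) (Fin p) ℂ) :
    ⁅fluct ω N y, site k b⁆ = (scale N : ℂ) • site k ⁅y, b⁆ := by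
  rw [fluct_eq, smul_comm_right, sum_comm_right]
  congr 1
  rw [Finset.sum_eq_single_of_mem k hk fun l _ hl => ?_]
  · rw [sub_eq_add_neg, ← neg_smul, add_comm_right, lie_smul_one, add_zero, site_lie, if_pos rfl]
  · rw [sub_eq_add_neg, ← neg_smul, add_comm_right, lie_smul_one, add_zero, site_lie, if_neg hl]

lemma lie_fluct_sum_site (N : ℕ) (y b : Matrix (Fin p) (Fin p) ℂ) :
    ⁅fluct ω N y, ∑ k ∈ box N, site k b⁆ = (scale N : ℂ) • ∑ k ∈ box N, site k ⁅y, b⁆ := by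
  rw [comm_sum, Finset.smul_sum]
  exact Finset.sum_congr rfl fun k hk => lie_fluct_site hk y b

lemma scale_smul_scale (N : ℕ) (X : QuasiLocal p) :
    (scale N : ℂ) • (scale N : ℂ) • X = (((2 * (N : ℝ) + 1)⁻¹ : ℝ) : ℂ) • X := by
  rw [smul_smul, ← Complex.ofReal_mul, scale_mul_self]

lemma lie_fluct_fluct (N : ℕ) (y z : Matrix (Fin p) (Fin p) ℂ) :
    ⁅fluct ω N y, fluct ω N z⁆ = siteAverage ⁅y, z⁆ N := by
  have h : fluct ω N z = (scale N : ℂ) • ∑ k ∈ box N, site k z +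
      (-((scale N : ℂ) * ((box N).card * ω (site 0 z)))) • 1 := by
    rw [fluct_eq, Finset.sum_sub_distrib, smul_sub, sub_eq_add_neg, neg_smul, Finset.sum_const,
      ← Nat.cast_smul_eq_nsmul ℂ, smul_smul, smul_smul, mul_assoc]
  have h1 : ∀ (X : QuasiLocal p) (c : ℂ), ⁅X, c • (1 : QuasiLocal p)⁆ = 0 := fun X c => by
    simp [Ring.lie_def]
  rw [h, comm_add, h1, add_zero, comm_smul, lie_fluct_sum_site, scale_smul_scale, siteAverage]

lemma toOp_fluct_mem (N : ℕ) (y : Matrix (Fin p) (Fin p) ℂ) :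
    toOp (fluct ω N y) ∈ localAlgebra p N := by
  rw [fluct_eq, map_smul, map_sum]
  refine SMulMemClass.smul_mem _ (sum_mem fun k hk => ?_)
  rw [map_sub, map_smul, map_one]
  exact sub_mem (toOp_site_mem hk y) (SMulMemClass.smul_mem _ (one_mem _))

lemma norm_site_zero_lie_le (q b : Matrix (Fin p) (Fin p) ℂ) :
    ‖site 0 ⁅q, b⁆‖ ≤ 2 * ‖site 0 q‖ * ‖site 0 b‖ := by
  rw [Ring.lie_def, site_sub, site_mul, site_mul]
  refine (norm_sub_le _ _).trans ((add_le_add (norm_mul_le _ _) (norm_mul_le _ _)).trans_eq ?_)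
  ring

lemma norm_lie_fluct_site_le {N : ℕ} {k : ℤ} (hk : k ∈ box N)
    {q : Matrix (Fin p) (Fin p) ℂ} {κ : ℝ} (hκ : 2 * ‖site 0 q‖ ≤ κ)
    (b : Matrix (Fin p) (Fin p) ℂ) :
    ‖⁅fluct ω N q, site k b⁆‖ ≤ scale N * κ * ‖site 0 b‖ := by
  rw [lie_fluct_site hk, norm_smul, Complex.norm_real, Real.norm_of_nonneg (scale_nonneg N),
    mul_assoc]
  refine mul_le_mul_of_nonneg_left ?_ (scale_nonneg N)
  exact (norm_site _ _).trans ((norm_site_zero_lie_le _ _).trans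
    (mul_le_mul_of_nonneg_right hκ (norm_nonneg _)))

lemma norm_lie_fluct_site_le₂ {N : ℕ} {k : ℤ} (hk : k ∈ box N)
    {q : Matrix (Fin p) (Fin p) ℂ} {κ : ℝ} (hκ : 2 * ‖site 0 q‖ ≤ κ)
    (b : Matrix (Fin p) (Fin p) ℂ) :
    ‖⁅fluct ω N q, ⁅fluct ω N q, site k b⁆⁆‖ ≤ (scale N * κ) ^ 2 * ‖site 0 b‖ := by
  have hκ0 : 0 ≤ κ := le_trans (by positivity) hκ
  have hs := scale_nonneg N
  rw [lie_fluct_site hk, comm_smul, norm_smul, Complex.norm_real, Real.norm_of_nonneg hs]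
  have h1 := norm_lie_fluct_site_le (ω := ω) hk hκ ⁅q, b⁆
  have h2 := (norm_site_zero_lie_le q b).trans (mul_le_mul_of_nonneg_right hκ (norm_nonneg _))
  calc scale N * ‖⁅fluct ω N q, site k ⁅q, b⁆⁆‖ ≤ scale N * (scale N * κ * (κ * ‖site 0 b‖)) := by
        gcongr
        exact h1.trans (by gcongr)
    _ = (scale N * κ) ^ 2 * ‖site 0 b‖ := by ring

lemma norm_lie_fluct_site_le₃ {N : ℕ} {k : ℤ} (hk : k ∈ box N)
    {q : Matrix (Fin p) (Fin p) ℂ} {κ : ℝ} (hκ : 2 * ‖site 0 q‖ ≤ κ)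
    (b : Matrix (Fin p) (Fin p) ℂ) :
    ‖⁅fluct ω N q, ⁅fluct ω N q, ⁅fluct ω N q, site k b⁆⁆⁆‖ ≤
      (scale N * κ) ^ 3 * ‖site 0 b‖ := by
  have hκ0 : 0 ≤ κ := le_trans (by positivity) hκ
  have hs := scale_nonneg N
  rw [lie_fluct_site hk, comm_smul, comm_smul, norm_smul, Complex.norm_real,
    Real.norm_of_nonneg hs]
  have h1 := norm_lie_fluct_site_le₂ (ω := ω) hk hκ ⁅q, b⁆
  have h2 := (norm_site_zero_lie_le q b).trans (mul_le_mul_of_nonneg_right hκ (norm_nonneg _))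
  calc scale N * ‖⁅fluct ω N q, ⁅fluct ω N q, site k ⁅q, b⁆⁆⁆‖
      ≤ scale N * ((scale N * κ) ^ 2 * (κ * ‖site 0 b‖)) := by
        gcongr
        exact h1.trans (by gcongr)
    _ = (scale N * κ) ^ 3 * ‖site 0 b‖ := by ring

/-- Conjugation by `e^{iF}` moves an observable by at most a multiple of its total oscillation times
the fluctuation scale. -/
lemma norm_conj_exp_fluct_sub_le (hω : IsState ω) {y : Matrix (Fin p) (Fin p) ℂ}
    (hy : y.IsHermitian) (N : ℕ) (Y : QuasiLocal p) :
    ‖NormedSpace.exp (Complex.I • fluct ω N y) * Y *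
      star (NormedSpace.exp (Complex.I • fluct ω N y)) - Y‖ ≤
      scale N * entrySum y * totalOsc N Y := by
  set a := Complex.I • fluct ω N y with ha
  have has : star a = -a := by simp [ha, fluct_star hω hy]
  have h := norm_expConj_sub_le has Y (θ := 1) ⟨zero_le_one, le_rfl⟩
  rw [expConj, one_smul, ← star_exp_of_skew has] at h
  refine h.trans ?_
  rw [ha, smul_comm_right, norm_smul, Complex.norm_I, one_mul, fluct_eq, smul_comm_right,
    norm_smul, Complex.norm_real, Real.norm_of_nonneg (scale_nonneg N), mul_assoc, totalOsc,
    Finset.mul_sum, sum_comm_right]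
  refine mul_le_mul_of_nonneg_left ?_ (scale_nonneg N)
  refine (norm_sum_le _ _).trans (Finset.sum_le_sum fun k _ => ?_)
  rw [sub_eq_add_neg, ← neg_smul, add_comm_right, lie_smul_one, add_zero]
  have : ⁅site k y, Y⁆ = -⁅Y, site k y⁆ := by simp only [Ring.lie_def, neg_sub]
  rw [this, norm_neg]
  exact norm_lie_site_le k Y y

end Fluctuations

/-! ### The microscopic generator on exponentials of fluctuations -/

section GeneratorFluct

variable {p m d : ℕ} {ω : QuasiLocal p →ₗ[ℂ] ℂ}

/-- The constant of `exists_generator_exp`. -/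
def LindbladData.cubicConst (G : LindbladData p m) : ℝ :=
  ‖site 0 G.h‖ + G.couplingNorm *
    ∑ μ, ∑ ν, ‖G.D μ ν‖ * (4 * (‖site 0 (G.v μ)‖ * ‖site 0 (G.v ν)ᴴ‖))

lemma LindbladData.sum_norm_kossakowski_le (G : LindbladData p m) (N : ℕ)
    {w : Fin m → Fin m → ℝ} (hw : ∀ μ ν, 0 ≤ w μ ν) :
    ∑ a : box N × Fin m, ∑ b : box N × Fin m, ‖G.kossakowski N a b‖ * w a.2 b.2 ≤
      (2 * N + 1) * (G.couplingNorm * ∑ μ, ∑ ν, ‖G.D μ ν‖ * w μ ν) := by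
  have e : ∑ a : box N × Fin m, ∑ b : box N × Fin m, ‖G.kossakowski N a b‖ * w a.2 b.2 =
      ∑ k ∈ box N, (∑ l ∈ box N, ‖G.J (k - l)‖) * ∑ μ, ∑ ν, ‖G.D μ ν‖ * w μ ν := by
    simp only [Fintype.sum_prod_type, kossakowski, Matrix.kroneckerMap_apply, Matrix.of_apply,
      norm_mul]
    rw [← Finset.sum_coe_sort (box N)]
    refine Finset.sum_congr rfl fun k _ => ?_
    rw [Finset.sum_comm, ← Finset.sum_coe_sort (box N), Finset.sum_mul]
    simp only [Finset.mul_sum, mul_assoc]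
  have hD : 0 ≤ ∑ μ, ∑ ν, ‖G.D μ ν‖ * w μ ν :=
    Finset.sum_nonneg fun μ _ => Finset.sum_nonneg fun ν _ => mul_nonneg (norm_nonneg _) (hw μ ν)
  rw [e]
  refine (Finset.sum_le_card_nsmul _ _ _ fun k _ =>
    mul_le_mul_of_nonneg_right (sum_norm_comp_le_tsum G.J_summable (box N)
      (f := fun l => k - l) sub_right_injective) hD).trans_eq ?_
  rw [nsmul_eq_mul, card_box]
  rfl

lemma cubic_sum_le {η u u' a₀ a₁ a₂ a₃ b₀ b₁ b₂ b₃ : ℝ} (hη : 0 ≤ η) (ha₀ : 0 ≤ a₀)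
    (hb₀ : 0 ≤ b₀) (hb₁ : 0 ≤ b₁) (ha₁ : 0 ≤ a₁) (a0 : a₀ ≤ u) (b0 : b₀ ≤ u')
    (a1 : a₁ ≤ η * u) (b1 : b₁ ≤ η * u') (a2 : a₂ ≤ η ^ 2 * u) (b2 : b₂ ≤ η ^ 2 * u')
    (a3 : a₃ ≤ η ^ 3 * u) (b3 : b₃ ≤ η ^ 3 * u') :
    a₀ * b₃ + a₃ * b₀ + (a₂ * b₁ + a₁ * b₂) ≤ η ^ 3 * (4 * (u * u')) := by
  have hu : 0 ≤ u := ha₀.trans a0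
  have hu' : 0 ≤ u' := hb₀.trans b0
  have h1 : a₀ * b₃ ≤ u * (η ^ 3 * u') :=
    (mul_le_mul_of_nonneg_left b3 ha₀).trans (mul_le_mul_of_nonneg_right a0 (by positivity))
  have h2 : a₃ * b₀ ≤ η ^ 3 * u * u' :=
    (mul_le_mul_of_nonneg_right a3 hb₀).trans (mul_le_mul_of_nonneg_left b0 (by positivity))
  have h3 : a₂ * b₁ ≤ η ^ 2 * u * (η * u') :=
    (mul_le_mul_of_nonneg_right a2 hb₁).trans (mul_le_mul_of_nonneg_left b1 (by positivity))
  have h4 : a₁ * b₂ ≤ η * u * (η ^ 2 * u') :=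
    (mul_le_mul_of_nonneg_left b2 ha₁).trans (mul_le_mul_of_nonneg_right a1 (by positivity))
  refine (add_le_add (add_le_add h1 h2) (add_le_add h3 h4)).trans_eq ?_
  ring

/-- Expansion of `𝕃_N[e^{iF}] e^{-iF}`; the cubic remainder is of the order of the fluctuation
scale, uniformly for bounded observables. -/
theorem LindbladData.exists_generator_exp (G : LindbladData p m) (hω : IsState ω)
    {q : Matrix (Fin p) (Fin p) ℂ} (hq : q.IsHermitian) {κ : ℝ} (hκ : 2 * ‖site 0 q‖ ≤ κ)
    (N : ℕ) :
    ∃ ρ : QuasiLocal p, G.generator N (NormedSpace.exp (Complex.I • fluct ω N q)) =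
        (Complex.I • G.generator N (fluct ω N q) +
          secondOrder (G.hamiltonian N) (G.kossakowski N) (G.kraus N)
            (fluct ω N q) (fluct ω N q) + ρ) *
          NormedSpace.exp (Complex.I • fluct ω N q) ∧
      ‖ρ‖ ≤ scale N * κ ^ 3 * G.cubicConst := by
  obtain ⟨ρ, h1, h2⟩ := exists_lindblad_exp (G.hamiltonian N) (G.kossakowski N) (G.kraus N)
    (fluct_star hω hq N)
  refine ⟨ρ, by rw [G.generator_eq_lindblad]; exact h1, h2.trans ?_⟩
  have hκ0 : 0 ≤ κ := le_trans (by positivity) hκ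
  have hs := scale_nonneg N
  have hH : ‖⁅fluct ω N q, ⁅fluct ω N q, ⁅fluct ω N q, G.hamiltonian N⁆⁆⁆‖ ≤
      (2 * N + 1) * ((scale N * κ) ^ 3 * ‖site 0 G.h‖) := by
    rw [LindbladData.hamiltonian, comm_sum, comm_sum, comm_sum]
    refine (norm_sum_le _ _).trans ((Finset.sum_le_card_nsmul _ _ _ fun k hk =>
      norm_lie_fluct_site_le₃ hk hκ G.h).trans_eq ?_)
    rw [nsmul_eq_mul, card_box]
  set w : Fin m → Fin m → ℝ := fun μ ν => (scale N * κ) ^ 3 *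
    (4 * (‖site 0 (G.v μ)‖ * ‖site 0 (G.v ν)ᴴ‖)) with hw
  have hw0 : ∀ μ ν, 0 ≤ w μ ν := fun μ ν => by simp only [hw]; positivity
  have hV : ∑ i, ∑ j, ‖G.kossakowski N i j‖ *
        (‖G.kraus N i‖ * ‖⁅fluct ω N q, ⁅fluct ω N q, ⁅fluct ω N q, star (G.kraus N j)⁆⁆⁆‖ +
          ‖⁅fluct ω N q, ⁅fluct ω N q, ⁅fluct ω N q, G.kraus N i⁆⁆⁆‖ * ‖star (G.kraus N j)‖ +
          (‖⁅fluct ω N q, ⁅fluct ω N q, G.kraus N i⁆⁆‖ * ‖⁅fluct ω N q, star (G.kraus N j)⁆‖ +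
            ‖⁅fluct ω N q, G.kraus N i⁆‖ *
              ‖⁅fluct ω N q, ⁅fluct ω N q, star (G.kraus N j)⁆⁆‖)) ≤
      ∑ i, ∑ j, ‖G.kossakowski N i j‖ * w i.2 j.2 := by
    refine Finset.sum_le_sum fun i _ => Finset.sum_le_sum fun j _ => ?_
    refine mul_le_mul_of_nonneg_left ?_ (norm_nonneg _)
    simp only [LindbladData.kraus, site_star]
    have hi := i.1.2
    have hj := j.1.2
    exact cubic_sum_le (mul_nonneg hs hκ0) (norm_nonneg _) (norm_nonneg _) (norm_nonneg _)
      (norm_nonneg _) (norm_site _ _) (norm_site _ _) (norm_lie_fluct_site_le hi hκ _)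
      (norm_lie_fluct_site_le hj hκ _) (norm_lie_fluct_site_le₂ hi hκ _)
      (norm_lie_fluct_site_le₂ hj hκ _) (norm_lie_fluct_site_le₃ hi hκ _)
      (norm_lie_fluct_site_le₃ hj hκ _)
  refine (add_le_add hH (hV.trans (G.sum_norm_kossakowski_le N hw0))).trans_eq ?_
  have hwsum : ∑ μ, ∑ ν, ‖G.D μ ν‖ * w μ ν = (scale N * κ) ^ 3 *
      ∑ μ, ∑ ν, ‖G.D μ ν‖ * (4 * (‖site 0 (G.v μ)‖ * ‖site 0 (G.v ν)ᴴ‖)) := by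
    simp only [hw, Finset.mul_sum, mul_left_comm]
  rw [hwsum, LindbladData.cubicConst]
  have h3 := card_mul_scale_cube N
  calc _ = ((2 * (N : ℝ) + 1) * scale N ^ 3) * κ ^ 3 * (‖site 0 G.h‖ + G.couplingNorm *
        ∑ μ, ∑ ν, ‖G.D μ ν‖ * (4 * (‖site 0 (G.v μ)‖ * ‖site 0 (G.v ν)ᴴ‖))) := by ring
    _ = _ := by rw [h3]

/-- The second order term in the fluctuations is a mean-field observable. -/
lemma LindbladData.secondOrder_fluct (G : LindbladData p m) (N : ℕ)
    (y z : Matrix (Fin p) (Fin p) ℂ) :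
    secondOrder (G.hamiltonian N) (G.kossakowski N) (G.kraus N) (fluct ω N y) (fluct ω N z) =
      (Complex.I / 2) • siteAverage ⁅y, ⁅z, G.h⁆⁆ N + ∑ μ, ∑ ν, G.D μ ν • ((1 / 2 : ℂ) •
        ((-(1 / 2 : ℂ)) • pairAverage G.J (G.v μ) ⁅y, ⁅z, (G.v ν)ᴴ⁆⁆ N +
          (1 / 2 : ℂ) • pairAverage G.J ⁅y, ⁅z, G.v μ⁆⁆ (G.v ν)ᴴ N +
          pairAverage G.J ⁅y, G.v μ⁆ ⁅z, (G.v ν)ᴴ⁆ N)) := by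
  rw [secondOrder]
  congr 1
  · rw [LindbladData.hamiltonian, lie_fluct_sum_site, comm_smul, lie_fluct_sum_site,
      scale_smul_scale, siteAverage]
  · set ε2 : ℂ := (((2 * (N : ℝ) + 1)⁻¹ : ℝ) : ℂ) with hε2
    set g : ℤ → Fin m → ℤ → Fin m → QuasiLocal p := fun k μ l ν => (1 / 2 : ℂ) •
      ((-(1 / 2 : ℂ)) • ε2 • (site k (G.v μ) * site l ⁅y, ⁅z, (G.v ν)ᴴ⁆⁆) +
        (1 / 2 : ℂ) • ε2 • (site k ⁅y, ⁅z, G.v μ⁆⁆ * site l (G.v ν)ᴴ) +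
        ε2 • (site k ⁅y, G.v μ⁆ * site l ⁅z, (G.v ν)ᴴ⁆)) with hg
    have h := G.sum_kossakowski_smul N g
    refine Eq.trans ?_ (h.trans ?_)
    · refine Finset.sum_congr rfl fun i _ => Finset.sum_congr rfl fun j _ => ?_
      have hi := i.1.2
      have hj := j.1.2
      simp only [LindbladData.kraus, site_star, hg]
      rw [lie_fluct_site hi, lie_fluct_site hi, lie_fluct_site hj, comm_smul, comm_smul,
        lie_fluct_site hi, lie_fluct_site hj]
      simp only [mul_smul_comm, smul_mul_assoc, scale_smul_scale, neg_smul]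
      rfl
    · have hswap : ∑ k ∈ box N, ∑ l ∈ box N, G.J (k - l) • ∑ μ, ∑ ν, G.D μ ν • g k μ l ν =
          ∑ μ, ∑ ν, G.D μ ν • ∑ k ∈ box N, ∑ l ∈ box N, G.J (k - l) • g k μ l ν := by
        simp only [Finset.smul_sum]
        simp only [smul_comm (G.J _)]
        rw [Finset.sum_congr rfl fun k _ => Finset.sum_comm, Finset.sum_comm]
        refine Finset.sum_congr rfl fun μ _ => ?_
        rw [Finset.sum_congr rfl fun k _ => Finset.sum_comm, Finset.sum_comm]
      rw [hswap]
      refine Finset.sum_congr rfl fun μ _ => Finset.sum_congr rfl fun ν _ => ?_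
      congr 1
      simp only [hg, pairAverage, smul_add, Finset.sum_add_distrib, Finset.smul_sum,
        smul_comm (G.J _)]
      rfl

/-- The second order term in the fluctuations is intensive. -/
lemma LindbladData.isIntensive_secondOrder (G : LindbladData p m) (hω : IsState ω)
    (hti : IsTranslationInvariant ω) (hcl : IsClustering ω) (y z : Matrix (Fin p) (Fin p) ℂ) :
    IsIntensive hω fun N => secondOrder (G.hamiltonian N) (G.kossakowski N) (G.kraus N)
      (fluct ω N y) (fluct ω N z) := by
  simp only [G.secondOrder_fluct]
  have hJ := G.J_summable
  refine ((isIntensive_siteAverage hω hti hcl _).smul _).add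
    (IsIntensive.sum _ fun μ => IsIntensive.sum _ fun ν => IsIntensive.smul
      (IsIntensive.smul (IsIntensive.add (IsIntensive.add ?_ ?_) ?_) _) _)
  · exact (isIntensive_pairAverage hω hti hcl hJ _ _).smul _
  · exact (isIntensive_pairAverage hω hti hcl hJ _ _).smul _
  · exact isIntensive_pairAverage hω hti hcl hJ _ _

lemma LindbladData.evolution_zero (G : LindbladData p m) (N : ℕ) (X : QuasiLocal p) :
    G.evolution N 0 X = X := by
  change semigroup (G.generator N) 0 X = X
  rw [semigroup_zero, one_apply_eq_self]

/-- Infinitesimal form of the invariance of the state. -/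
lemma LindbladData.apply_generator_eq_zero (G : LindbladData p m) (hω : IsState ω)
    (hinv : G.Preserves ω) (N : ℕ) {X : QuasiLocal p} (hX : toOp X ∈ localAlgebra p N) :
    ω (G.generator N X) = 0 := by
  have h1 : HasDerivAt (fun s : ℝ => ω (G.evolution N s X)) (ω (G.generator N X)) 0 := by
    have h := G.hasDerivAt_evolution_apply N X 0
    rw [G.evolution_zero] at h
    exact ((⟨ω, hω.continuous⟩ :
      QuasiLocal p →L[ℂ] ℂ).restrictScalars ℝ).hasFDerivAt.comp_hasDerivAt
      (0 : ℝ) h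
  have h2 : HasDerivWithinAt (fun s : ℝ => ω (G.evolution N s X)) 0 (Set.Ici 0) 0 :=
    (hasDerivWithinAt_const (0 : ℝ) (Set.Ici (0 : ℝ)) (ω X)).congr
      (fun s hs => hinv N s hs X hX) (hinv N 0 le_rfl X hX)
  exact (uniqueDiffOn_Ici (0 : ℝ) 0 Set.self_mem_Ici).eq_deriv _ h1.hasDerivWithinAt h2

/-- The fluctuations evolve linearly. -/
lemma LindbladData.generator_fluctVec (G : LindbladData p m) (hω : IsState ω)
    (hinv : G.Preserves ω)
    {x : Fin d → Matrix (Fin p) (Fin p) ℂ} {𝓛 : Matrix (Fin d) (Fin d) ℝ}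
    (hloc : G.IsLocalOn x 𝓛) (N : ℕ) (r : Fin d → ℝ) :
    G.generator N (fluctVec ω x N r) = fluctVec ω x N (𝓛ᵀ *ᵥ r) := by
  have hone : G.generator N 1 = 0 := by rw [G.generator_eq_lindblad, lindblad_one]
  have hmean : ∀ i, ∑ j, (𝓛 i j : ℂ) * ω (site 0 (x j)) = 0 := fun i => by
    have h0 : (0 : ℤ) ∈ box 0 := by simp
    have h := G.apply_generator_eq_zero hω hinv 0 (toOp_site_mem h0 (x i))
    rw [hloc 0 0 h0 i, map_sum] at h
    simpa only [map_smul, smul_eq_mul] using h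
  have hi : ∀ i, G.generator N (fluct ω N (x i)) = ∑ j, (𝓛 i j : ℂ) • fluct ω N (x j) := by
    intro i
    rw [fluct_eq, map_smul, map_sum]
    simp only [fluct_eq, smul_comm _ (scale N : ℂ), ← Finset.smul_sum]
    congr 1
    simp only [Finset.smul_sum]
    rw [Finset.sum_comm]
    refine Finset.sum_congr rfl fun k hk => ?_
    rw [map_sub, map_smul, hone, smul_zero, sub_zero, hloc N k hk i]
    simp only [smul_sub, Finset.sum_sub_distrib, smul_smul]
    rw [← Finset.sum_smul, hmean, zero_smul, sub_zero]
  rw [fluctVec, fluctVec, map_sum]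
  simp only [map_smul, hi, Finset.smul_sum, smul_smul]
  rw [Finset.sum_comm]
  refine Finset.sum_congr rfl fun j _ => ?_
  rw [← Finset.sum_smul]
  congr 1
  simp only [Matrix.mulVec, dotProduct, Matrix.transpose_apply, Complex.ofReal_sum,
    Complex.ofReal_mul, mul_comm]

end GeneratorFluct

/-! ### Limits of the two-point functions -/

section Covariance

variable {p m d : ℕ} {ω : QuasiLocal p →ₗ[ℂ] ℂ} {x : Fin d → Matrix (Fin p) (Fin p) ℂ}

/-- The matrix `ω(F_N(x_i) F_N(x_j))` of two-point functions of the local fluctuations. -/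
def localCov (ω : QuasiLocal p →ₗ[ℂ] ℂ) (x : Fin d → Matrix (Fin p) (Fin p) ℂ) (N : ℕ) :
    Matrix (Fin d) (Fin d) ℂ :=
  Matrix.of fun i j => ω (fluct ω N (x i) * fluct ω N (x j))

/-- The limit `M_{ij} = lim_N ω(F_N(x_i) F_N(x_j))`, a sum of truncated two-point functions. -/
def limitCov (ω : QuasiLocal p →ₗ[ℂ] ℂ) (x : Fin d → Matrix (Fin p) (Fin p) ℂ) :
    Matrix (Fin d) (Fin d) ℂ :=
  Matrix.of fun i j => ∑' n : ℤ,
    (ω (site 0 (x i) * translation (-n) (site 0 (x j))) - ω (site 0 (x i)) * ω (site 0 (x j)))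

lemma apply_fluct_mul_fluct (hω : IsState ω) (hti : IsTranslationInvariant ω)
    (y z : Matrix (Fin p) (Fin p) ℂ) (N : ℕ) :
    ω (fluct ω N y * fluct ω N z) = (((2 * (N : ℝ) + 1)⁻¹ : ℝ) : ℂ) * ∑ k ∈ box N, ∑ l ∈ box N,
      (ω (site 0 y * translation (-(k - l)) (site 0 z)) - ω (site 0 y) * ω (site 0 z)) := by
  rw [fluct_eq, fluct_eq, smul_mul_smul_comm, ← Complex.ofReal_mul, scale_mul_self,
    Finset.sum_mul_sum, map_smul, smul_eq_mul, map_sum]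
  congr 1
  refine Finset.sum_congr rfl fun k _ => ?_
  rw [map_sum]
  refine Finset.sum_congr rfl fun l _ => ?_
  have h1 : ω (site k y * site l z) = ω (site 0 y * translation (-(k - l)) (site 0 z)) := by
    rw [site_mul_site_eq_translation, hti.apply, translation_site]
    congr 3
    ring
  simp only [sub_mul, mul_sub, smul_mul_assoc, mul_smul_comm, one_mul, mul_one, map_sub, map_smul,
    smul_eq_mul, h1, hti.apply_site, hω.map_one]
  ring

lemma tendsto_localCov (h : HasNormalFluctuations ω x) (i j : Fin d) :
    Tendsto (fun N => localCov ω x N i j) atTop (𝓝 (limitCov ω x i j)) := by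
  have hs : Summable fun n : ℤ => ‖ω (site 0 (x i) * translation (-n) (site 0 (x j))) -
      ω (site 0 (x i)) * ω (site 0 (x j))‖ :=
    (Equiv.neg ℤ).summable_iff.mpr (h.summable i j)
  have h1 := tendsto_box_average_of_summable hs
  refine h1.congr fun N => ?_
  exact (apply_fluct_mul_fluct h.isState h.translationInvariant (x i) (x j) N).symm

lemma localCov_star (hω : IsState ω) (hx : ∀ i, (x i).IsHermitian) (N : ℕ) (i j : Fin d) :
    star (localCov ω x N i j) = localCov ω x N j i := by
  simp only [localCov, Matrix.of_apply]
  rw [← hω.map_star, star_mul, fluct_star hω (hx i), fluct_star hω (hx j)]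

lemma limitCov_isHermitian (h : HasNormalFluctuations ω x) (hx : ∀ i, (x i).IsHermitian) :
    (limitCov ω x).IsHermitian := by
  ext i j
  rw [Matrix.conjTranspose_apply]
  refine tendsto_nhds_unique ((continuous_star.tendsto _).comp (tendsto_localCov h j i)) ?_
  refine (tendsto_localCov h i j).congr fun N => ?_
  exact (localCov_star h.isState hx N j i).symm

/-- `Σ_ω`, the real part of the limiting two-point functions. -/
def covMatrix (ω : QuasiLocal p →ₗ[ℂ] ℂ) (x : Fin d → Matrix (Fin p) (Fin p) ℂ) :
    Matrix (Fin d) (Fin d) ℝ :=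
  Matrix.of fun i j => (limitCov ω x i j).re

/-- `σ_ω`, twice the imaginary part of the limiting two-point functions. -/
def sympMatrix (ω : QuasiLocal p →ₗ[ℂ] ℂ) (x : Fin d → Matrix (Fin p) (Fin p) ℂ) :
    Matrix (Fin d) (Fin d) ℝ :=
  Matrix.of fun i j => 2 * (limitCov ω x i j).im

lemma limitCov_eq (i j : Fin d) : limitCov ω x i j =
    (covMatrix ω x i j : ℂ) + Complex.I / 2 * (sympMatrix ω x i j : ℂ) := by
  apply Complex.ext <;> simp [covMatrix, sympMatrix]

lemma limitCov_swap (h : HasNormalFluctuations ω x) (hx : ∀ i, (x i).IsHermitian) (i j : Fin d) :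
    limitCov ω x j i = star (limitCov ω x i j) :=
  ((limitCov_isHermitian h hx).apply j i).symm

lemma covMatrix_transpose (h : HasNormalFluctuations ω x) (hx : ∀ i, (x i).IsHermitian) :
    (covMatrix ω x)ᵀ = covMatrix ω x := by
  ext i j
  simp [covMatrix, limitCov_swap h hx i j]

lemma sympMatrix_transpose (h : HasNormalFluctuations ω x) (hx : ∀ i, (x i).IsHermitian) :
    (sympMatrix ω x)ᵀ = -sympMatrix ω x := by
  ext i j
  simp [sympMatrix, limitCov_swap h hx i j]

lemma isCovariance_covMatrix (h : HasNormalFluctuations ω x) (hx : ∀ i, (x i).IsHermitian) :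
    IsCovariance ω x (covMatrix ω x) := by
  intro i j
  have h1 := ((tendsto_localCov h i j).add (tendsto_localCov h j i)).const_mul (1 / 2 : ℂ)
  have e : (1 / 2 : ℂ) * (limitCov ω x i j + limitCov ω x j i) = (covMatrix ω x i j : ℂ) := by
    rw [limitCov_swap h hx i j, Complex.star_def, Complex.add_conj, covMatrix, Matrix.of_apply]
    push_cast
    ring
  rw [e] at h1
  refine h1.congr fun N => ?_
  simp only [localCov, Matrix.of_apply, map_add]

lemma isSymplecticForm_sympMatrix (h : HasNormalFluctuations ω x)
    (hx : ∀ i, (x i).IsHermitian) : IsSymplecticForm ω x (sympMatrix ω x) := by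
  intro i j
  have h1 := ((tendsto_localCov h i j).sub (tendsto_localCov h j i)).const_mul (-Complex.I)
  have e : -Complex.I * (limitCov ω x i j - limitCov ω x j i) = (sympMatrix ω x i j : ℂ) := by
    rw [limitCov_swap h hx i j, Complex.star_def, Complex.sub_conj, sympMatrix, Matrix.of_apply]
    push_cast
    linear_combination (-2 * ((limitCov ω x i j).im : ℂ)) * Complex.I_mul_I
  rw [e] at h1
  refine h1.congr fun N => ?_
  simp only [localCov, Matrix.of_apply, map_sub]

/-- Complex linear combinations `∑ conj(u_i) F_N(x_i)` of the fluctuations. -/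
def fluctStar (ω : QuasiLocal p →ₗ[ℂ] ℂ) (x : Fin d → Matrix (Fin p) (Fin p) ℂ) (N : ℕ)
    (u : Fin d → ℂ) : QuasiLocal p :=
  ∑ i, star (u i) • fluct ω N (x i)

lemma apply_fluctStar_mul (hω : IsState ω) (hx : ∀ i, (x i).IsHermitian) (N : ℕ)
    (u w : Fin d → ℂ) :
    ω (fluctStar ω x N u * star (fluctStar ω x N w)) = star u ⬝ᵥ (localCov ω x N *ᵥ w) := by
  rw [fluctStar, fluctStar, star_sum, Finset.sum_mul_sum]
  simp only [star_smul, star_star, fluct_star hω (hx _), map_sum, smul_mul_smul_comm, map_smul,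
    smul_eq_mul, dotProduct, Matrix.mulVec, localCov, Matrix.of_apply, Finset.mul_sum,
    Pi.star_apply]
  refine Finset.sum_congr rfl fun i _ => Finset.sum_congr rfl fun j _ => ?_
  ring

lemma tendsto_localCov_form (h : HasNormalFluctuations ω x) (u w : Fin d → ℂ) :
    Tendsto (fun N => star u ⬝ᵥ (localCov ω x N *ᵥ w)) atTop
      (𝓝 (star u ⬝ᵥ (limitCov ω x *ᵥ w))) := by
  simp only [dotProduct, Matrix.mulVec]
  exact tendsto_finsetSum _ fun i _ => (tendsto_finsetSum _ fun j _ =>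
    (tendsto_localCov h i j).mul_const _).const_mul _

lemma LindbladData.generator_fluct_apply (G : LindbladData p m) (hω : IsState ω)
    (hinv : G.Preserves ω) {𝓛 : Matrix (Fin d) (Fin d) ℝ} (hloc : G.IsLocalOn x 𝓛) (N : ℕ)
    (i : Fin d) : G.generator N (fluct ω N (x i)) = ∑ j, (𝓛 i j : ℂ) • fluct ω N (x j) := by
  have h := G.generator_fluctVec hω hinv hloc N (Pi.single i 1)
  have e1 : fluctVec ω x N (Pi.single i 1) = fluct ω N (x i) := by
    rw [fluctVec, Finset.sum_eq_single_of_mem i (Finset.mem_univ i) fun j _ hj => ?_]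
    · simp
    · rw [Pi.single_eq_of_ne hj, Complex.ofReal_zero, zero_smul]
  rw [e1] at h
  rw [h, fluctVec]
  simp

/-- Dissipativity passes to the covariances: `𝓛 M + M 𝓛ᵗʳ ≤ 0`. -/
lemma limitCov_dissipative (h : HasNormalFluctuations ω x) (hx : ∀ i, (x i).IsHermitian)
    (G : LindbladData p m) {𝓛 : Matrix (Fin d) (Fin d) ℝ} (hloc : G.IsLocalOn x 𝓛)
    (hinv : G.Preserves ω) (u : Fin d → ℂ) :
    (star ((𝓛.map Complex.ofReal)ᵀ *ᵥ u) ⬝ᵥ (limitCov ω x *ᵥ u) +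
      star u ⬝ᵥ (limitCov ω x *ᵥ ((𝓛.map Complex.ofReal)ᵀ *ᵥ u))).re ≤ 0 := by
  have hω := h.isState
  set u' := (𝓛.map Complex.ofReal)ᵀ *ᵥ u with hu'
  have hL : ∀ N, G.generator N (fluctStar ω x N u) = fluctStar ω x N u' := by
    intro N
    rw [fluctStar, fluctStar, map_sum]
    simp only [map_smul, G.generator_fluct_apply hω hinv hloc, Finset.smul_sum, smul_smul]
    rw [Finset.sum_comm]
    refine Finset.sum_congr rfl fun j _ => ?_
    rw [← Finset.sum_smul]
    congr 1
    simp [hu', Matrix.mulVec, dotProduct, mul_comm]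
  have hmem : ∀ N, toOp (fluctStar ω x N u * star (fluctStar ω x N u)) ∈ localAlgebra p N := by
    intro N
    have h1 : toOp (fluctStar ω x N u) ∈ localAlgebra p N := by
      rw [fluctStar, map_sum]
      refine sum_mem fun i _ => ?_
      rw [map_smul]
      exact SMulMemClass.smul_mem _ (toOp_fluct_mem N (x i))
    rw [map_mul, map_star]
    exact mul_mem h1 (star_mem h1)
  have hneg : ∀ N, (star u' ⬝ᵥ (localCov ω x N *ᵥ u) +
      star u ⬝ᵥ (localCov ω x N *ᵥ u')).re ≤ 0 := by
    intro N
    have h1 := lindblad_dissipative (G.hamiltonian_isSelfAdjoint N) (G.kossakowski_posSemidef N)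
      (G.kraus N) (fluctStar ω x N u)
    rw [← G.generator_eq_lindblad, hL] at h1
    have h2 := re_apply_mono hω.toPositive h1
    rw [map_add, hω.toPositive_apply, hω.toPositive_apply, hω.toPositive_apply,
      apply_fluctStar_mul hω hx, apply_fluctStar_mul hω hx,
      G.apply_generator_eq_zero hω hinv N (hmem N)] at h2
    simpa using h2
  have hlim := (Complex.continuous_re.tendsto _).comp
    ((tendsto_localCov_form h u' u).add (tendsto_localCov_form h u u'))
  exact le_of_tendsto hlim (Eventually.of_forall hneg)

end Covariance

/-! ### The mesoscopic flow -/

section MesoX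

variable {d : ℕ}

lemma mesoX_zero (𝓛 : Matrix (Fin d) (Fin d) ℝ) : mesoX 𝓛 0 = 1 := by
  rw [mesoX, zero_smul, NormedSpace.exp_zero]

lemma mesoX_add (𝓛 : Matrix (Fin d) (Fin d) ℝ) (t u : ℝ) :
    mesoX 𝓛 (t + u) = mesoX 𝓛 t * mesoX 𝓛 u := by
  rw [mesoX, add_smul, Matrix.exp_add_of_commute]
  · rfl
  · exact ((Commute.refl 𝓛).smul_left t).smul_right u

open scoped Matrix.Norms.Operator in
lemma hasDerivAt_mesoX_apply (𝓛 : Matrix (Fin d) (Fin d) ℝ) (t : ℝ) (i j : Fin d) :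
    HasDerivAt (fun t => mesoX 𝓛 t i j) ((mesoX 𝓛 t * 𝓛) i j) t := by
  have h : HasDerivAt (fun t : ℝ => NormedSpace.exp (t • 𝓛)) (NormedSpace.exp (t • 𝓛) * 𝓛) t :=
    hasDerivAt_exp_smul_const (𝕂 := ℝ) 𝓛 t
  exact (LinearMap.toContinuousLinearMap
    (Matrix.entryLinearMap ℝ ℝ i j)).hasFDerivAt.comp_hasDerivAt t h

/-- The flow `r_t = 𝒳_tᵗʳ r` solves `r' = 𝓛ᵗʳ r`. -/
lemma hasDerivAt_mesoX_transpose_mulVec (𝓛 : Matrix (Fin d) (Fin d) ℝ) (r : Fin d → ℝ) (t : ℝ) :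
    HasDerivAt (fun t => (mesoX 𝓛 t)ᵀ *ᵥ r) (𝓛ᵀ *ᵥ ((mesoX 𝓛 t)ᵀ *ᵥ r)) t := by
  rw [hasDerivAt_pi]
  intro i
  rw [Matrix.mulVec_mulVec, ← Matrix.transpose_mul]
  simp only [Matrix.mulVec, dotProduct, Matrix.transpose_apply]
  exact HasDerivAt.fun_sum fun j _ => (hasDerivAt_mesoX_apply 𝓛 t j i).mul_const _

lemma hasDerivAt_mesoX_transpose_mulVec_complex (𝓛 : Matrix (Fin d) (Fin d) ℝ) (u : Fin d → ℂ)
    (t : ℝ) :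
    HasDerivAt (fun t => ((mesoX 𝓛 t).map Complex.ofReal)ᵀ *ᵥ u)
      ((𝓛.map Complex.ofReal)ᵀ *ᵥ (((mesoX 𝓛 t).map Complex.ofReal)ᵀ *ᵥ u)) t := by
  rw [hasDerivAt_pi]
  intro i
  have e : (𝓛.map Complex.ofReal)ᵀ *ᵥ (((mesoX 𝓛 t).map Complex.ofReal)ᵀ *ᵥ u) =
      ((mesoX 𝓛 t * 𝓛).map Complex.ofReal)ᵀ *ᵥ u := by
    rw [Matrix.mulVec_mulVec, ← Matrix.transpose_mul]
    congr 2
    exact (Matrix.map_mul (f := Complex.ofRealHom)).symm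
  rw [e]
  simp only [Matrix.mulVec, dotProduct, Matrix.transpose_apply, Matrix.map_apply]
  exact HasDerivAt.fun_sum fun j _ =>
    ((hasDerivAt_mesoX_apply 𝓛 t j i).ofReal_comp).mul_const _

/-- If `𝓛 M + M 𝓛ᵗʳ ≤ 0` then `𝒳_t M 𝒳_tᵗʳ ≤ M` for `t ≥ 0`. -/
lemma posSemidef_sub_mesoX {M : Matrix (Fin d) (Fin d) ℂ} (hM : M.IsHermitian)
    {𝓛 : Matrix (Fin d) (Fin d) ℝ}
    (hdiss : ∀ u : Fin d → ℂ, (star ((𝓛.map Complex.ofReal)ᵀ *ᵥ u) ⬝ᵥ (M *ᵥ u) +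
      star u ⬝ᵥ (M *ᵥ ((𝓛.map Complex.ofReal)ᵀ *ᵥ u))).re ≤ 0) {t : ℝ} (ht : 0 ≤ t) :
    (M - (mesoX 𝓛 t).map Complex.ofReal * M *
      ((mesoX 𝓛 t).map Complex.ofReal)ᵀ).PosSemidef := by
  have hXstar : ∀ t, ((mesoX 𝓛 t).map Complex.ofReal)ᴴ = ((mesoX 𝓛 t).map Complex.ofReal)ᵀ := by
    intro t
    ext i j
    simp
  have hherm : (M - (mesoX 𝓛 t).map Complex.ofReal * M *
      ((mesoX 𝓛 t).map Complex.ofReal)ᵀ).IsHermitian := by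
    refine hM.sub ?_
    rw [← hXstar]
    exact Matrix.isHermitian_mul_mul_conjTranspose _ hM
  refine Matrix.PosSemidef.of_dotProduct_mulVec_nonneg hherm fun u => ?_
  set w : ℝ → Fin d → ℂ := fun t => ((mesoX 𝓛 t).map Complex.ofReal)ᵀ *ᵥ u with hw
  set q : ℝ → ℂ := fun t => star (w t) ⬝ᵥ (M *ᵥ w t) with hq
  have hwd := hasDerivAt_mesoX_transpose_mulVec_complex 𝓛 u
  have hqd : ∀ t, HasDerivAt q (star ((𝓛.map Complex.ofReal)ᵀ *ᵥ w t) ⬝ᵥ (M *ᵥ w t) +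
      star (w t) ⬝ᵥ (M *ᵥ ((𝓛.map Complex.ofReal)ᵀ *ᵥ w t))) t := by
    intro t
    have hc : ∀ i, HasDerivAt (fun t => w t i) (((𝓛.map Complex.ofReal)ᵀ *ᵥ w t) i) t :=
      hasDerivAt_pi.mp (hwd t)
    have hs : ∀ i, HasDerivAt (fun t => star (w t i))
        (star (((𝓛.map Complex.ofReal)ᵀ *ᵥ w t) i)) t := fun i => (hc i).star
    have hMw : ∀ i, HasDerivAt (fun t => (M *ᵥ w t) i)
        ((M *ᵥ ((𝓛.map Complex.ofReal)ᵀ *ᵥ w t)) i) t := fun i => by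
      simp only [Matrix.mulVec, dotProduct]
      exact HasDerivAt.fun_sum fun j _ => (hc j).const_mul _
    simp only [hq, dotProduct, ← Finset.sum_add_distrib, Pi.star_apply]
    exact HasDerivAt.fun_sum fun i _ => (hs i).mul (hMw i)
  have hanti : AntitoneOn (fun t => (q t).re) (Set.Icc 0 t) := by
    have hre : ∀ s, HasDerivAt (fun t => (q t).re) _ s := fun s =>
      Complex.reCLM.hasFDerivAt.comp_hasDerivAt s (hqd s)
    refine antitoneOn_of_deriv_nonpos (convex_Icc 0 t)
      (fun s _ => (hre s).continuousAt.continuousWithinAt)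
      (fun s _ => (hre s).differentiableAt.differentiableWithinAt) fun s _ => ?_
    rw [(hre s).deriv]
    exact hdiss (w s)
  have h1 := hanti ⟨le_rfl, ht⟩ ⟨ht, le_rfl⟩ ht
  have h0 : q 0 = star u ⬝ᵥ (M *ᵥ u) := by
    simp only [hq, hw, mesoX_zero]
    rw [Matrix.map_one _ Complex.ofReal_zero Complex.ofReal_one, Matrix.transpose_one,
      Matrix.one_mulVec]
  have ht' : star u ⬝ᵥ (((mesoX 𝓛 t).map Complex.ofReal * M *
      ((mesoX 𝓛 t).map Complex.ofReal)ᵀ) *ᵥ u) = q t := by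
    simp only [hq, hw]
    rw [← hXstar, Matrix.star_mulVec, Matrix.conjTranspose_conjTranspose, ← Matrix.mulVec_mulVec,
      ← Matrix.mulVec_mulVec, Matrix.dotProduct_mulVec]
  rw [Complex.le_def]
  constructor
  · rw [Matrix.sub_mulVec, dotProduct_sub, ht', ← h0]
    simpa using h1
  · have := hherm.im_star_dotProduct_mulVec_self u
    simpa using this.symm

end MesoX

/-! ### Intensive observables under the dynamics and the local Weyl operators -/

section Convergence

variable {p m d : ℕ} {ω : QuasiLocal p →ₗ[ℂ] ℂ} {x : Fin d → Matrix (Fin p) (Fin p) ℂ}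

lemma smul_fluct_skew (hω : IsState ω) {y : Matrix (Fin p) (Fin p) ℂ} (hy : y.IsHermitian)
    (N : ℕ) : star (Complex.I • fluct ω N y) = -(Complex.I • fluct ω N y) := by
  rw [star_smul, fluct_star hω hy, Complex.star_def, Complex.conj_I, neg_smul]

lemma localWeyl_mul_star (hω : IsState ω) (hx : ∀ i, (x i).IsHermitian) (N : ℕ)
    (r : Fin d → ℝ) : localWeyl ω x N r * star (localWeyl ω x N r) = 1 := by
  rw [localWeyl, fluctVec_eq_fluct,
    star_exp_of_skew (smul_fluct_skew hω (combo_isHermitian hx r) N), exp_mul_exp_neg]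

/-- The functional `X ↦ ω(W_N(a) Φ_u^N[X] W_N(a)†)`. -/
def evolvedFunctional (hω : IsState ω) (G : LindbladData p m)
    (x : Fin d → Matrix (Fin p) (Fin p) ℂ) (a : Fin d → ℝ) (N : ℕ) {u : ℝ} (hu : 0 ≤ u) :
    QuasiLocal p →ₚ[ℂ] ℂ :=
  conjFunctional hω.toPositive (G.evolution N u) (fun _ hX => G.evolution_nonneg N hu hX)
    (localWeyl ω x N a)

lemma evolvedFunctional_apply (hω : IsState ω) (G : LindbladData p m) (a : Fin d → ℝ) (N : ℕ)
    {u : ℝ} (hu : 0 ≤ u) (X : QuasiLocal p) :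
    evolvedFunctional hω G x a N hu X =
      ω (localWeyl ω x N a * G.evolution N u X * star (localWeyl ω x N a)) := by
  rw [evolvedFunctional, conjFunctional_apply, hω.toPositive_apply]

lemma evolvedFunctional_one (hω : IsState ω) (hx : ∀ i, (x i).IsHermitian)
    (G : LindbladData p m) (a : Fin d → ℝ) (N : ℕ) {u : ℝ} (hu : 0 ≤ u) :
    evolvedFunctional hω G x a N hu 1 = 1 := by
  rw [evolvedFunctional_apply, G.evolution_one, mul_one, localWeyl_mul_star hω hx, hω.map_one]

/-- Centred intensive observables stay negligible after conjugation with `W_N(a)` and after the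
evolution, uniformly for bounded times.  The invariance of `ω` deals with the evolution, and the
bound on the oscillations of an evolved observable shows that `W_N(a)` almost commutes with it. -/
lemma IsIntensive.exists_rightNorm_evolvedFunctional_le {hω : IsState ω}
    (hx : ∀ i, (x i).IsHermitian) (G : LindbladData p m) (hinv : G.Preserves ω) (a : Fin d → ℝ)
    (t : ℝ) {A : ℕ → QuasiLocal p} (hA : IsIntensive hω A) :
    ∃ β : ℕ → ℝ, Tendsto β atTop (𝓝 0) ∧ ∀ N, ∀ u, (hu : 0 ≤ u) → u ≤ t →
      rightNorm (evolvedFunctional hω G x a N hu) (A N - ω (A N) • 1) ≤ β N := by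
  obtain ⟨C₁, hC₁⟩ := hA.norm_le
  obtain ⟨C₂, hC₂⟩ := hA.totalOsc_le
  have hC₁0 : 0 ≤ C₁ := (norm_nonneg _).trans (hC₁ 0)
  have hC₂0 : 0 ≤ C₂ := (totalOsc_nonneg _ _).trans (hC₂ 0)
  set K : ℝ := C₁ + C₁ * ‖(1 : QuasiLocal p)‖ with hK
  have hK0 : 0 ≤ K := by positivity
  set c : ℝ := entrySum (combo x a) * (4 * (K * C₂ + C₂ * K) * Real.exp (4 * G.growthRate * t))
    with hc
  have hlim : Tendsto (fun N => rightNorm hω.toPositive (A N - ω (A N) • 1) ^ 2 + scale N * c)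
      atTop (𝓝 0) := by
    simpa using (hA.tendsto.pow 2).add (tendsto_scale.mul_const c)
  refine ⟨fun N => Real.sqrt (rightNorm hω.toPositive (A N - ω (A N) • 1) ^ 2 + scale N * c),
    by simpa using hlim.sqrt, fun N u hu hut => Real.le_sqrt_of_sq_le ?_⟩
  set Y := A N - ω (A N) • (1 : QuasiLocal p) with hY
  have hYn : ‖Y‖ ≤ K := by
    refine (norm_sub_le _ _).trans (add_le_add (hC₁ N) ?_)
    rw [norm_smul]
    exact mul_le_mul_of_nonneg_right ((hω.norm_apply_le _).trans (hC₁ N)) (norm_nonneg _)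
  have hYo : totalOsc N Y ≤ C₂ := by
    rw [hY, sub_eq_add_neg, ← neg_smul]
    refine (totalOsc_add_le _ _ _).trans ?_
    rw [totalOsc_smul, totalOsc_one, mul_zero, add_zero]
    exact hC₂ N
  have hYY : totalOsc N (Y * star Y) ≤ K * C₂ + C₂ * K := by
    refine (totalOsc_mul_le _ _ _).trans ?_
    rw [totalOsc_star, norm_star]
    exact add_le_add (mul_le_mul hYn hYo (totalOsc_nonneg _ _) hK0)
      (mul_le_mul hYo hYn (norm_nonneg _) hC₂0)
  have hmem : toOp (Y * star Y) ∈ localAlgebra p N := by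
    have h1 : toOp Y ∈ localAlgebra p N := by
      rw [hY, map_sub, map_smul, map_one]
      exact sub_mem (hA.mem N) (SMulMemClass.smul_mem _ (one_mem _))
    rw [map_mul, map_star]
    exact mul_mem h1 (star_mem h1)
  set Z := G.evolution N u (Y * star Y) with hZ
  have hosc : totalOsc N Z ≤ 4 * (K * C₂ + C₂ * K) * Real.exp (4 * G.growthRate * t) := by
    refine (G.totalOsc_evolution_le N _ hu).trans ?_
    have := G.growthRate_nonneg
    gcongr
  have hconj : ‖localWeyl ω x N a * Z * star (localWeyl ω x N a) - Z‖ ≤ scale N * c := by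
    rw [localWeyl, fluctVec_eq_fluct]
    refine (norm_conj_exp_fluct_sub_le hω (combo_isHermitian hx a) N Z).trans ?_
    rw [hc, ← mul_assoc]
    exact mul_le_mul_of_nonneg_left hosc (mul_nonneg (scale_nonneg N) (entrySum_nonneg _))
  rw [rightNorm_sq_re, rightNorm_sq_re, evolvedFunctional_apply, ← hZ, hω.toPositive_apply,
    ← hinv N u hu _ hmem, ← hZ]
  have h2 := (Complex.re_le_norm _).trans ((hω.norm_apply_le _).trans hconj)
  rw [map_sub, Complex.sub_re] at h2
  linarith

lemma norm_site_zero_combo_le (x : Fin d → Matrix (Fin p) (Fin p) ℂ) {r : Fin d → ℝ} {κ : ℝ}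
    (hr : ∀ i, |r i| ≤ κ) : ‖site 0 (combo x r)‖ ≤ κ * ∑ i, ‖site 0 (x i)‖ := by
  simp only [combo, site_sum, site_smul]
  refine (norm_sum_le _ _).trans ?_
  rw [Finset.mul_sum]
  refine Finset.sum_le_sum fun i _ => ?_
  rw [norm_smul, Complex.norm_real, Real.norm_eq_abs]
  exact mul_le_mul_of_nonneg_right (hr i) (norm_nonneg _)

lemma norm_lie_lie_fluct_le (N : ℕ) {y z : Matrix (Fin p) (Fin p) ℂ} {κ : ℝ}
    (hy : 2 * ‖site 0 y‖ ≤ κ) (hz : 2 * ‖site 0 z‖ ≤ κ) :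
    ‖⁅fluct ω N y, ⁅fluct ω N y, fluct ω N z⁆⁆‖ ≤ scale N * κ ^ 3 := by
  have hκ : 0 ≤ κ := (by positivity : 0 ≤ 2 * ‖site 0 y‖).trans hy
  have hb : ‖site 0 ⁅y, z⁆‖ ≤ κ ^ 2 := by
    refine (norm_site_zero_lie_le y z).trans ?_
    have h1 : ‖site 0 z‖ ≤ κ := by
      have := norm_nonneg (site 0 z)
      linarith
    rw [pow_two]
    exact mul_le_mul hy h1 (norm_nonneg _) hκ
  rw [lie_fluct_fluct, siteAverage, comm_smul, comm_sum, norm_smul, Complex.norm_real,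
    Real.norm_of_nonneg (inv_nonneg.2 (two_mul_add_one_pos N).le)]
  have h2 : ‖∑ k ∈ box N, ⁅fluct ω N y, site k ⁅y, z⁆⁆‖ ≤
      (2 * N + 1) * (scale N * κ * κ ^ 2) := by
    refine (norm_sum_le_of_le _ fun k hk => (norm_lie_fluct_site_le hk hy _).trans
      (mul_le_mul_of_nonneg_left hb (mul_nonneg (scale_nonneg N) hκ))).trans ?_
    rw [Finset.sum_const, nsmul_eq_mul, card_box]
  refine (mul_le_mul_of_nonneg_left h2 (inv_nonneg.2 (two_mul_add_one_pos N).le)).trans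
    (le_of_eq ?_)
  rw [← mul_assoc, inv_mul_cancel₀ (two_mul_add_one_pos N).ne', one_mul]
  ring

end Convergence

/-! ### The evolution equation of the deviation -/

section DeviationDerivative

variable {p m d : ℕ} {ω : QuasiLocal p →ₗ[ℂ] ℂ} {x : Fin d → Matrix (Fin p) (Fin p) ℂ}

lemma damping_eq (𝓛 S : Matrix (Fin d) (Fin d) ℝ) (t : ℝ) (r : Fin d → ℝ) :
    damping 𝓛 S t r = Real.exp (1 / 2 * (((mesoX 𝓛 t)ᵀ *ᵥ r) ⬝ᵥ (S *ᵥ ((mesoX 𝓛 t)ᵀ *ᵥ r))) -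
      1 / 2 * (r ⬝ᵥ (S *ᵥ r))) := by
  rw [damping, mesoY, Matrix.smul_mulVec, Matrix.sub_mulVec, dotProduct_smul, dotProduct_sub,
    ← Matrix.mulVec_mulVec, ← Matrix.mulVec_mulVec, Matrix.dotProduct_mulVec _ (mesoX 𝓛 t),
    ← Matrix.mulVec_transpose, smul_eq_mul]
  congr 1
  ring

lemma dotProduct_mulVec_swap {S : Matrix (Fin d) (Fin d) ℝ} (hS : Sᵀ = S) (u w : Fin d → ℝ) :
    u ⬝ᵥ (S *ᵥ w) = w ⬝ᵥ (S *ᵥ u) := by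
  rw [Matrix.dotProduct_mulVec, ← Matrix.mulVec_transpose, hS, dotProduct_comm]

lemma hasDerivAt_damping (𝓛 : Matrix (Fin d) (Fin d) ℝ) {S : Matrix (Fin d) (Fin d) ℝ}
    (hS : Sᵀ = S) (r : Fin d → ℝ) (s : ℝ) :
    HasDerivAt (fun s => damping 𝓛 S s r) (damping 𝓛 S s r *
      ((𝓛ᵀ *ᵥ ((mesoX 𝓛 s)ᵀ *ᵥ r)) ⬝ᵥ (S *ᵥ ((mesoX 𝓛 s)ᵀ *ᵥ r)))) s := by
  have hv := hasDerivAt_pi.1 (hasDerivAt_mesoX_transpose_mulVec 𝓛 r s)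
  set v := fun s => (mesoX 𝓛 s)ᵀ *ᵥ r with hvdef
  have hq : HasDerivAt (fun s => v s ⬝ᵥ (S *ᵥ v s))
      ((𝓛ᵀ *ᵥ v s) ⬝ᵥ (S *ᵥ v s) + v s ⬝ᵥ (S *ᵥ (𝓛ᵀ *ᵥ v s))) s := by
    simp only [dotProduct, ← Finset.sum_add_distrib]
    refine HasDerivAt.fun_sum fun i _ => (hv i).mul ?_
    simp only [Matrix.mulVec, dotProduct]
    exact HasDerivAt.fun_sum fun j _ => (hv j).const_mul _
  rw [dotProduct_mulVec_swap hS (v s)] at hq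
  have he := ((hq.const_mul (1 / 2 : ℝ)).sub_const (1 / 2 * (r ⬝ᵥ (S *ᵥ r)))).exp
  simp only [damping_eq]
  refine he.congr_deriv ?_
  ring

lemma hasDerivAt_smul_fluctVec (𝓛 : Matrix (Fin d) (Fin d) ℝ) (r : Fin d → ℝ) (N : ℕ) (s : ℝ) :
    HasDerivAt (fun s => Complex.I • fluctVec ω x N ((mesoX 𝓛 s)ᵀ *ᵥ r))
      (Complex.I • fluctVec ω x N (𝓛ᵀ *ᵥ ((mesoX 𝓛 s)ᵀ *ᵥ r))) s := by
  have hv := hasDerivAt_pi.1 (hasDerivAt_mesoX_transpose_mulVec 𝓛 r s)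
  simp only [fluctVec]
  refine HasDerivAt.const_smul Complex.I (HasDerivAt.fun_sum fun i _ => ?_)
  exact (hv i).ofReal_comp.smul_const _

/-- The deviation solves the evolution equation of `𝕃_N` up to a source term.  The terms of order
`√N` cancel because `𝕃_N` acts on the fluctuations through `𝓛`; what is left is the intensive
part of second order and a remainder of order `N^{-1/2}`. -/
lemma LindbladData.exists_hasDerivAt_deviation (G : LindbladData p m) (hω : IsState ω)
    (hx : ∀ i, (x i).IsHermitian) (hinv : G.Preserves ω) {𝓛 : Matrix (Fin d) (Fin d) ℝ}
    (hloc : G.IsLocalOn x 𝓛) {S : Matrix (Fin d) (Fin d) ℝ} (hS : Sᵀ = S) (N : ℕ)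
    (r : Fin d → ℝ) (s : ℝ) {v v' : Fin d → ℝ} (hv : v = (mesoX 𝓛 s)ᵀ *ᵥ r)
    (hv' : v' = 𝓛ᵀ *ᵥ v) {κ : ℝ} (hκ : 2 * ‖site 0 (combo x v)‖ ≤ κ)
    (hκ' : 2 * ‖site 0 (combo x v')‖ ≤ κ) :
    ∃ ρ : QuasiLocal p, ‖ρ‖ ≤ scale N * κ ^ 3 * (1 + G.cubicConst) ∧
      HasDerivAt (fun s => deviation G ω x 𝓛 S N s r)
        (G.generator N (deviation G ω x 𝓛 S N s r) + (damping 𝓛 S s r : ℂ) •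
          ((((v' ⬝ᵥ (S *ᵥ v) : ℝ) : ℂ) • (1 : QuasiLocal p) -
            (1 / 2 : ℂ) • ⁅fluctVec ω x N v, fluctVec ω x N v'⁆ -
            secondOrder (G.hamiltonian N) (G.kossakowski N) (G.kraus N)
              (fluctVec ω x N v) (fluctVec ω x N v) + ρ) * localWeyl ω x N v)) s := by
  have hskew : ∀ r : Fin d → ℝ, star (Complex.I • fluctVec ω x N r) =
      -(Complex.I • fluctVec ω x N r) := fun r => by
    rw [fluctVec_eq_fluct]
    exact smul_fluct_skew hω (combo_isHermitian hx r) N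
  obtain ⟨T, hT, hTn⟩ := exists_hasDerivAt_exp
    (hasDerivAt_smul_fluctVec (ω := ω) (x := x) 𝓛 r N s) (hskew _) (hskew _)
  rw [← hv] at hT
  rw [← hv, ← hv'] at hTn
  obtain ⟨ρ, hρ, hρn⟩ := G.exists_generator_exp hω (combo_isHermitian hx v) hκ N
  rw [← fluctVec_eq_fluct, G.generator_fluctVec hω hinv hloc, ← hv'] at hρ
  set F := fluctVec ω x N v with hF
  set F' := fluctVec ω x N v' with hF'
  have hlie : ⁅Complex.I • F, Complex.I • F'⁆ = -⁅F, F'⁆ := by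
    rw [smul_comm_right, comm_smul, smul_smul, Complex.I_mul_I, neg_one_smul]
  have hTn' : ‖T - Complex.I • F' + (1 / 2 : ℂ) • ⁅F, F'⁆‖ ≤ scale N * κ ^ 3 := by
    have e : T - Complex.I • F' - (1 / 2 : ℝ) • ⁅Complex.I • F, Complex.I • F'⁆ =
        T - Complex.I • F' + (1 / 2 : ℂ) • ⁅F, F'⁆ := by
      rw [hlie, smul_neg, sub_neg_eq_add, ← Complex.coe_smul]
      norm_num
    rw [← e]
    refine hTn.trans ?_
    rw [hlie, smul_comm_right, norm_smul, Complex.norm_I, one_mul, ← neg_one_smul ℂ, comm_smul,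
      norm_smul, norm_neg, norm_one, one_mul, hF, hF', fluctVec_eq_fluct, fluctVec_eq_fluct]
    exact norm_lie_lie_fluct_le N hκ hκ'
  refine ⟨(T - Complex.I • F' + (1 / 2 : ℂ) • ⁅F, F'⁆) - ρ, ?_, ?_⟩
  · refine (norm_sub_le _ _).trans ((add_le_add hTn' hρn).trans (le_of_eq ?_))
    ring
  · have h1 := ((hasDerivAt_damping 𝓛 hS r s).ofReal_comp.smul hT).sub
      (G.hasDerivAt_evolution_apply N (localWeyl ω x N r) s)
    refine h1.congr_deriv ?_
    simp only [deviation, interpolating, ← hv, ← hv', map_sub, map_smul, localWeyl, ← hF]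
    rw [hρ]
    simp only [Complex.ofReal_mul, sub_mul, add_mul, smul_sub, smul_add, smul_mul_assoc, one_mul,
      smul_smul]
    module

end DeviationDerivative

/-! ### Smallness of the source term -/

section Source

variable {p m d : ℕ} {ω : QuasiLocal p →ₗ[ℂ] ℂ} {x : Fin d → Matrix (Fin p) (Fin p) ℂ}

lemma lie_fluctVec_fluctVec (N : ℕ) (v w : Fin d → ℝ) :
    ⁅fluctVec ω x N v, fluctVec ω x N w⁆ =
      ∑ i, ∑ j, ((v i : ℂ) * (w j : ℂ)) • siteAverage ⁅x i, x j⁆ N := by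
  simp only [fluctVec, sum_comm_right, comm_sum, smul_comm_right, comm_smul, lie_fluct_fluct,
    Finset.smul_sum, smul_smul]
  rw [Finset.sum_comm]
  refine Finset.sum_congr rfl fun i _ => Finset.sum_congr rfl fun j _ => ?_
  rw [mul_comm]

lemma secondOrder_fluctVec (G : LindbladData p m) (N : ℕ) (v w : Fin d → ℝ) :
    secondOrder (G.hamiltonian N) (G.kossakowski N) (G.kraus N) (fluctVec ω x N v)
        (fluctVec ω x N w) =
      ∑ i, ∑ j, ((v i : ℂ) * (w j : ℂ)) • secondOrder (G.hamiltonian N) (G.kossakowski N)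
        (G.kraus N) (fluct ω N (x i)) (fluct ω N (x j)) := by
  change secondOrderBilin _ _ _ _ _ = ∑ i, ∑ j, _ • secondOrderBilin _ _ _ _ _
  simp only [fluctVec, map_sum, map_smul, LinearMap.sum_apply, LinearMap.smul_apply,
    Finset.smul_sum, smul_smul]
  rw [Finset.sum_comm]
  refine Finset.sum_congr rfl fun i _ => Finset.sum_congr rfl fun j _ => ?_
  rw [mul_comm]

lemma toOp_fluctVec_mem (N : ℕ) (v : Fin d → ℝ) :
    toOp (fluctVec ω x N v) ∈ localAlgebra p N := by
  rw [fluctVec_eq_fluct]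
  exact toOp_fluct_mem N _

/-- Since `ω ∘ 𝕃_N = 0`, the expectation of the second-order term is a two-point function. -/
lemma LindbladData.apply_secondOrder_fluctVec (G : LindbladData p m) (hω : IsState ω)
    (hinv : G.Preserves ω) {𝓛 : Matrix (Fin d) (Fin d) ℝ} (hloc : G.IsLocalOn x 𝓛) (N : ℕ)
    (v : Fin d → ℝ) :
    ω (secondOrder (G.hamiltonian N) (G.kossakowski N) (G.kraus N) (fluctVec ω x N v)
      (fluctVec ω x N v)) = ω (fluctVec ω x N (𝓛ᵀ *ᵥ v) * fluctVec ω x N v) := by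
  have hmem := toOp_fluctVec_mem (ω := ω) (x := x) N v
  rw [secondOrder_eq, ← G.generator_eq_lindblad, map_add, map_neg, map_smul,
    G.apply_generator_eq_zero hω hinv N (by rw [map_mul]; exact mul_mem hmem hmem),
    G.generator_fluctVec hω hinv hloc, smul_zero, neg_zero, zero_add]

lemma rightNorm_one (φ : QuasiLocal p →ₚ[ℂ] ℂ) (hφ : φ 1 = 1) : rightNorm φ 1 = 1 :=
  (pow_eq_one_iff_of_nonneg (rightNorm_nonneg φ 1) two_ne_zero).1
    (by rw [rightNorm_sq_re, star_one, mul_one, hφ, Complex.one_re])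

lemma rightNorm_sum_sum_smul_le (φ : QuasiLocal p →ₚ[ℂ] ℂ) {c : Fin d → Fin d → ℂ} {κ : ℝ}
    (hc : ∀ i j, ‖c i j‖ ≤ κ) {A : Fin d → Fin d → QuasiLocal p} {b : Fin d → Fin d → ℝ}
    (hA : ∀ i j, rightNorm φ (A i j) ≤ b i j) :
    rightNorm φ (∑ i, ∑ j, c i j • A i j) ≤ ∑ i, ∑ j, κ * b i j := by
  refine (rightNorm_sum_le _ _ _).trans (Finset.sum_le_sum fun i _ =>
    (rightNorm_sum_le _ _ _).trans (Finset.sum_le_sum fun j _ => ?_))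
  rw [rightNorm_smul]
  exact mul_le_mul (hc i j) (hA i j) (rightNorm_nonneg _ _) ((norm_nonneg _).trans (hc i j))

/-- The intensive part of the source term splits into centred intensive observables and a scalar;
the scalar vanishes in the limit because the covariance matrix is the limit of the local ones. -/
lemma LindbladData.exists_rightNorm_source_le (G : LindbladData p m)
    (h : HasNormalFluctuations ω x) (hx : ∀ i, (x i).IsHermitian) (hinv : G.Preserves ω)
    {𝓛 : Matrix (Fin d) (Fin d) ℝ} (hloc : G.IsLocalOn x 𝓛) (a : Fin d → ℝ) (t κ : ℝ) :
    ∃ β : ℕ → ℝ, Tendsto β atTop (𝓝 0) ∧ ∀ N, ∀ u, (hu : 0 ≤ u) → u ≤ t →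
      ∀ v v' : Fin d → ℝ, v' = 𝓛ᵀ *ᵥ v → (∀ i, |v i| ≤ κ) → (∀ i, |v' i| ≤ κ) →
      rightNorm (evolvedFunctional h.isState G x a N hu)
        (((v' ⬝ᵥ (covMatrix ω x *ᵥ v) : ℝ) : ℂ) • (1 : QuasiLocal p) -
            (1 / 2 : ℂ) • ⁅fluctVec ω x N v, fluctVec ω x N v'⁆ -
            secondOrder (G.hamiltonian N) (G.kossakowski N) (G.kraus N)
              (fluctVec ω x N v) (fluctVec ω x N v)) ≤ β N := by
  set hω := h.isState
  choose β₁ hβ₁ hβ₁' using fun i j => (isIntensive_siteAverage hω h.translationInvariant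
    h.clustering ⁅x i, x j⁆).exists_rightNorm_evolvedFunctional_le hx G hinv a t
  choose β₂ hβ₂ hβ₂' using fun i j => (G.isIntensive_secondOrder hω h.translationInvariant
    h.clustering (x i) (x j)).exists_rightNorm_evolvedFunctional_le hx G hinv a t
  have hcov : ∀ i j, Tendsto (fun N => ‖(covMatrix ω x i j : ℂ) - (1 / 2 : ℂ) *
      ω (fluct ω N (x i) * fluct ω N (x j) + fluct ω N (x j) * fluct ω N (x i))‖)
      atTop (𝓝 0) := fun i j => by
    simpa using ((isCovariance_covMatrix h hx i j).const_sub (covMatrix ω x i j : ℂ)).norm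
  refine ⟨fun N => (∑ i, ∑ j, κ ^ 2 * β₁ i j N) + (∑ i, ∑ j, κ ^ 2 * β₂ i j N) +
      ∑ i, ∑ j, κ ^ 2 * ‖(covMatrix ω x i j : ℂ) - (1 / 2 : ℂ) *
        ω (fluct ω N (x i) * fluct ω N (x j) + fluct ω N (x j) * fluct ω N (x i))‖, ?_, ?_⟩
  · have hz : ∀ g : Fin d → Fin d → ℕ → ℝ, (∀ i j, Tendsto (g i j) atTop (𝓝 0)) →
        Tendsto (fun N => ∑ i, ∑ j, κ ^ 2 * g i j N) atTop (𝓝 0) := fun g hg => by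
      simpa using tendsto_finsetSum Finset.univ fun i _ =>
        tendsto_finsetSum Finset.univ fun j _ => (hg i j).const_mul (κ ^ 2)
    simpa using ((hz _ hβ₁).add (hz _ hβ₂)).add (hz _ hcov)
  intro N u hu hut v v' hv' hv hvb
  set φ := evolvedFunctional hω G x a N hu with hφ
  set F := fun i => fluct ω N (x i) with hF
  set C := fun i j => siteAverage ⁅x i, x j⁆ N with hC
  set Θ := fun i j => secondOrder (G.hamiltonian N) (G.kossakowski N) (G.kraus N) (F i) (F j)
    with hΘ
  set z := fun i j => (covMatrix ω x i j : ℂ) - (1 / 2 : ℂ) * ω (F i * F j + F j * F i) with hz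
  have hΘω : ∑ i, ∑ j, ((v i : ℂ) * (v j : ℂ)) * ω (Θ i j) =
      ∑ i, ∑ j, ((v i : ℂ) * (v' j : ℂ)) * ω (F j * F i) := by
    have h1 := G.apply_secondOrder_fluctVec hω hinv hloc N v
    rw [secondOrder_fluctVec, ← hv'] at h1
    simp only [map_sum, map_smul, smul_eq_mul] at h1
    rw [show (∑ i, ∑ j, ((v i : ℂ) * (v j : ℂ)) * ω (Θ i j)) = _ from h1, fluctVec, fluctVec,
      Finset.sum_mul_sum, Finset.sum_comm]
    simp only [map_sum, smul_mul_smul_comm, map_smul, smul_eq_mul]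
    refine Finset.sum_congr rfl fun i _ => Finset.sum_congr rfl fun j _ => ?_
    rw [mul_comm (v' j : ℂ)]
  have hCω : ∀ i j, ω (C i j) = ω (F i * F j) - ω (F j * F i) := fun i j => by
    rw [hC, ← map_sub, ← Ring.lie_def]
    exact congrArg ω (lie_fluct_fluct N (x i) (x j)).symm
  have hSv : ((v' ⬝ᵥ (covMatrix ω x *ᵥ v) : ℝ) : ℂ) =
      ∑ i, ∑ j, ((v i : ℂ) * (v' j : ℂ)) * (covMatrix ω x i j : ℂ) := by
    rw [dotProduct_mulVec_swap (covMatrix_transpose h hx)]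
    simp only [dotProduct, Matrix.mulVec, Finset.mul_sum, Complex.ofReal_sum, Complex.ofReal_mul]
    refine Finset.sum_congr rfl fun i _ => Finset.sum_congr rfl fun j _ => ?_
    ring
  have hscal : ((v' ⬝ᵥ (covMatrix ω x *ᵥ v) : ℝ) : ℂ) =
      (∑ i, ∑ j, ((v i : ℂ) * (v' j : ℂ)) * z i j) +
        (1 / 2 : ℂ) * (∑ i, ∑ j, ((v i : ℂ) * (v' j : ℂ)) * ω (C i j)) +
        ∑ i, ∑ j, ((v i : ℂ) * (v j : ℂ)) * ω (Θ i j) := by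
    rw [hΘω, hSv]
    simp only [Finset.mul_sum, ← Finset.sum_add_distrib]
    refine Finset.sum_congr rfl fun i _ => Finset.sum_congr rfl fun j _ => ?_
    rw [hCω, hz]
    simp only [map_add]
    ring
  have hdec : ((v' ⬝ᵥ (covMatrix ω x *ᵥ v) : ℝ) : ℂ) • (1 : QuasiLocal p) -
      (1 / 2 : ℂ) • ⁅fluctVec ω x N v, fluctVec ω x N v'⁆ -
      secondOrder (G.hamiltonian N) (G.kossakowski N) (G.kraus N)
        (fluctVec ω x N v) (fluctVec ω x N v) =
      (-(1 / 2 : ℂ)) • (∑ i, ∑ j, ((v i : ℂ) * (v' j : ℂ)) • (C i j - ω (C i j) • 1)) +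
      (-1 : ℂ) • (∑ i, ∑ j, ((v i : ℂ) * (v j : ℂ)) • (Θ i j - ω (Θ i j) • 1)) +
      ∑ i, ∑ j, ((v i : ℂ) * (v' j : ℂ)) • (z i j • (1 : QuasiLocal p)) := by
    rw [hscal, lie_fluctVec_fluctVec, secondOrder_fluctVec]
    simp only [smul_sub, Finset.sum_sub_distrib, smul_smul, ← Finset.sum_smul]
    module
  have hb : ∀ w w' : Fin d → ℝ, (∀ i, |w i| ≤ κ) → (∀ i, |w' i| ≤ κ) → ∀ i j,
      ‖(w i : ℂ) * (w' j : ℂ)‖ ≤ κ ^ 2 := fun w w' hw hw' i j => by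
    rw [norm_mul, Complex.norm_real, Complex.norm_real, pow_two]
    exact mul_le_mul (hw i) (hw' j) (norm_nonneg _) ((abs_nonneg _).trans (hw i))
  have hφ1 : φ 1 = 1 := evolvedFunctional_one hω hx G a N hu
  have b1 := rightNorm_sum_sum_smul_le φ (hb v v' hv hvb) fun i j => hβ₁' i j N u hu hut
  have b2 := rightNorm_sum_sum_smul_le φ (hb v v hv hv) fun i j => hβ₂' i j N u hu hut
  have b3 := rightNorm_sum_sum_smul_le φ (hb v v' hv hvb)
    (A := fun i j => z i j • (1 : QuasiLocal p)) (b := fun i j => ‖z i j‖) fun i j => by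
      rw [rightNorm_smul, rightNorm_one φ hφ1, mul_one]
  rw [hdec]
  refine (rightNorm_add_le _ _ _).trans (add_le_add ((rightNorm_add_le _ _ _).trans
    (add_le_add ?_ ?_)) b3)
  · rw [rightNorm_smul]
    have h0 := rightNorm_nonneg φ
      (∑ i, ∑ j, ((v i : ℂ) * (v' j : ℂ)) • (C i j - ω (C i j) • (1 : QuasiLocal p)))
    refine le_trans ?_ b1
    norm_num
    linarith
  · rw [rightNorm_smul, norm_neg, norm_one, one_mul]
    exact b2

end Source

/-! ### Convergence to the mesoscopic dynamics -/

section DeviationLimit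

variable {p m d : ℕ} {ω : QuasiLocal p →ₗ[ℂ] ℂ} {x : Fin d → Matrix (Fin p) (Fin p) ℂ}

lemma star_localWeyl_mul (hω : IsState ω) (hx : ∀ i, (x i).IsHermitian) (N : ℕ)
    (r : Fin d → ℝ) : star (localWeyl ω x N r) * localWeyl ω x N r = 1 := by
  rw [localWeyl, fluctVec_eq_fluct,
    star_exp_of_skew (smul_fluct_skew hω (combo_isHermitian hx r) N), exp_neg_mul_exp]

lemma deviation_zero (G : LindbladData p m) (𝓛 S : Matrix (Fin d) (Fin d) ℝ) (N : ℕ)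
    (r : Fin d → ℝ) : deviation G ω x 𝓛 S N 0 r = 0 := by
  simp [deviation, interpolating, damping, mesoY, mesoX_zero, G.evolution_zero]

/-- A common bound on bounded times for the orbit of `r` under `𝒳_sᵗʳ`, for its velocity and for
the damping factor. -/
lemma exists_orbit_bound (𝓛 : Matrix (Fin d) (Fin d) ℝ) {S : Matrix (Fin d) (Fin d) ℝ}
    (hS : Sᵀ = S) (r : Fin d → ℝ) (t : ℝ) :
    ∃ K : ℝ, 0 ≤ K ∧ ∀ s ∈ Set.Icc 0 t, (∀ i, |((mesoX 𝓛 s)ᵀ *ᵥ r) i| ≤ K) ∧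
      (∀ i, |(𝓛ᵀ *ᵥ ((mesoX 𝓛 s)ᵀ *ᵥ r)) i| ≤ K) ∧ |damping 𝓛 S s r| ≤ K := by
  have hc : Continuous fun s => (mesoX 𝓛 s)ᵀ *ᵥ r :=
    continuous_iff_continuousAt.2 fun s =>
      (hasDerivAt_mesoX_transpose_mulVec 𝓛 r s).continuousAt
  have hd : Continuous fun s => damping 𝓛 S s r :=
    continuous_iff_continuousAt.2 fun s => (hasDerivAt_damping 𝓛 hS r s).continuousAt
  have hc' : Continuous fun s => 𝓛ᵀ *ᵥ ((mesoX 𝓛 s)ᵀ *ᵥ r) := continuous_const.matrix_mulVec hc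
  obtain ⟨K, hK⟩ := (isCompact_Icc (a := (0 : ℝ)) (b := t)).exists_bound_of_continuousOn
    ((hc.prodMk hc').prodMk hd).continuousOn
  refine ⟨max K 0, le_max_right _ _, fun s hs => ?_⟩
  have h := (hK s hs).trans (le_max_left K 0)
  simp only [norm_prod_le_iff] at h
  exact ⟨fun i => (norm_le_pi_norm _ i).trans h.1.1, fun i => (norm_le_pi_norm _ i).trans h.1.2,
    h.2⟩

/-- The deviation vanishes in the seminorm `X ↦ ω(W_N(a) X X† W_N(a)†)^{1/2}`: it starts from
zero, and the source term of its evolution equation tends to zero uniformly on bounded times, in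
the seminorms that occur in the perturbation estimate for Lindblad evolutions. -/
theorem tendsto_rightNorm_deviation (h : HasNormalFluctuations ω x)
    (hx : ∀ i, (x i).IsHermitian) (G : LindbladData p m) {𝓛 : Matrix (Fin d) (Fin d) ℝ}
    (hloc : G.IsLocalOn x 𝓛) (hinv : G.Preserves ω) (a r : Fin d → ℝ) {t : ℝ} (ht : 0 ≤ t) :
    Tendsto (fun N => rightNorm h.isState.toPositive
      (localWeyl ω x N a * deviation G ω x 𝓛 (covMatrix ω x) N t r)) atTop (𝓝 0) := by
  set hω := h.isState
  set S := covMatrix ω x with hSdef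
  have hS : Sᵀ = S := covMatrix_transpose h hx
  obtain ⟨K, hK0, hK⟩ := exists_orbit_bound 𝓛 hS r t
  obtain ⟨β, hβ, hβ'⟩ := G.exists_rightNorm_source_le h hx hinv hloc a t K
  set κ : ℝ := 2 * (K * ∑ i, ‖site 0 (x i)‖) with hκ
  set ε : ℕ → ℝ := fun N => K * (β N + scale N * (κ ^ 3 * (1 + G.cubicConst))) with hε
  have hε0 : Tendsto ε atTop (𝓝 0) := by
    simpa using (hβ.add (tendsto_scale.mul_const _)).const_mul K
  have hlim : Tendsto (fun N => Real.sqrt (ε N ^ 2 * t * Real.exp t)) atTop (𝓝 0) := by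
    simpa using (((hε0.pow 2).mul_const t).mul_const (Real.exp t)).sqrt
  refine squeeze_zero (fun N => rightNorm_nonneg _ _) (fun N => Real.le_sqrt_of_sq_le ?_) hlim
  set f : ℝ → QuasiLocal p := fun s => deviation G ω x 𝓛 S N s r with hf
  have hR : ∀ s, 0 ≤ s → s ≤ t → ∀ u, (hu : 0 ≤ u) → u ≤ t → ∃ R : QuasiLocal p,
      HasDerivAt f (G.generator N (f s) + R) s ∧
        rightNorm (evolvedFunctional hω G x a N hu) R ≤ ε N := by
    intro s hs hst u hu hut
    obtain ⟨hv, hv', hd⟩ := hK s ⟨hs, hst⟩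
    obtain ⟨ρ, hρ, hder⟩ := G.exists_hasDerivAt_deviation hω hx hinv hloc hS N r s rfl rfl
      (κ := κ) (mul_le_mul_of_nonneg_left (norm_site_zero_combo_le x hv) zero_le_two)
      (mul_le_mul_of_nonneg_left (norm_site_zero_combo_le x hv') zero_le_two)
    refine ⟨_, hder, ?_⟩
    rw [rightNorm_smul, rightNorm_mul_unitary _ _ (localWeyl_mul_star hω hx N _),
      Complex.norm_real]
    refine mul_le_mul hd ((rightNorm_add_le _ _ _).trans (add_le_add
      (hβ' N u hu hut _ _ rfl hv hv') ((rightNorm_le_norm _ ?_ _).trans ?_)))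
      (rightNorm_nonneg _ _) hK0
    · exact evolvedFunctional_one hω hx G a N hu
    · rw [← mul_assoc]
      exact hρ
  -- The source term is defined for every real time, as required below, through the derivative.
  have hdiff : ∀ s, DifferentiableAt ℝ f s := fun s => by
    obtain ⟨ρ, -, hder⟩ := G.exists_hasDerivAt_deviation hω hx hinv hloc hS N r s rfl rfl
      (le_max_left _ _) (le_max_right _ _)
    exact hder.differentiableAt
  set φ := evolvedFunctional hω G x a N le_rfl with hφ
  have hφa : ∀ X, φ X = ω (localWeyl ω x N a * X * star (localWeyl ω x N a)) := fun X => by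
    rw [hφ, evolvedFunctional_apply, G.evolution_zero]
  have hφc : Continuous φ := by
    have e : ⇑φ = fun X => ω (localWeyl ω x N a * X * star (localWeyl ω x N a)) := funext hφa
    rw [e]
    exact hω.continuous.comp (by fun_prop)
  have key := lindblad_perturbation_le (G.hamiltonian_isSelfAdjoint N)
    (G.kossakowski_posSemidef N) (G.kraus N) φ hφc ht (f := f)
    (R := fun s => deriv f s - G.generator N (f s))
    (fun s => by
      rw [← G.generator_eq_lindblad, add_sub_cancel]
      exact (hdiff s).hasDerivAt)
    (deviation_zero G 𝓛 S N r) (C := ε N ^ 2) fun s hs => by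
      obtain ⟨R, hR1, hR2⟩ := hR s hs.1 hs.2 (t - s) (sub_nonneg.2 hs.2) (by linarith [hs.1])
      rw [hR1.deriv, add_sub_cancel_left, ← G.evolution_eq, hφa,
        ← evolvedFunctional_apply hω G a N (sub_nonneg.2 hs.2), ← rightNorm_sq_re]
      exact pow_le_pow_left₀ (rightNorm_nonneg _ _) hR2 2
  rw [hφa] at key
  rw [rightNorm_sq_re, hω.toPositive_apply, star_mul]
  simpa only [mul_assoc] using key

theorem tendsto_apply_deviation_mul_star (h : HasNormalFluctuations ω x)
    (hx : ∀ i, (x i).IsHermitian) (G : LindbladData p m) {𝓛 : Matrix (Fin d) (Fin d) ℝ}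
    (hloc : G.IsLocalOn x 𝓛) (hinv : G.Preserves ω) (a r : Fin d → ℝ) {t : ℝ} (ht : 0 ≤ t) :
    Tendsto (fun N : ℕ => ω (localWeyl ω x N a * deviation G ω x 𝓛 (covMatrix ω x) N t r *
      star (deviation G ω x 𝓛 (covMatrix ω x) N t r) * star (localWeyl ω x N a)))
      atTop (𝓝 0) := by
  have h1 := (Complex.continuous_ofReal.tendsto _).comp
    ((tendsto_rightNorm_deviation h hx G hloc hinv a r ht).pow 2)
  rw [zero_pow two_ne_zero, Complex.ofReal_zero] at h1
  refine h1.congr fun N => ?_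
  rw [Function.comp_apply, rightNorm_sq, h.isState.toPositive_apply, star_mul]
  simp only [mul_assoc]

/-- Convergence of the Weyl correlation functions, by the Cauchy–Schwarz inequality and the
unitarity of `W_N(b)`. -/
theorem tendsto_apply_evolution_sub (h : HasNormalFluctuations ω x)
    (hx : ∀ i, (x i).IsHermitian) (G : LindbladData p m) {𝓛 : Matrix (Fin d) (Fin d) ℝ}
    (hloc : G.IsLocalOn x 𝓛) (hinv : G.Preserves ω) (a b r : Fin d → ℝ) {t : ℝ} (ht : 0 ≤ t) :
    Tendsto (fun N : ℕ => ω (localWeyl ω x N a * G.evolution N t (localWeyl ω x N r) *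
        localWeyl ω x N b) - (damping 𝓛 (covMatrix ω x) t r : ℂ) * ω (localWeyl ω x N a *
          localWeyl ω x N ((mesoX 𝓛 t)ᵀ *ᵥ r) * localWeyl ω x N b)) atTop (𝓝 0) := by
  refine squeeze_zero_norm (fun N => ?_) (tendsto_rightNorm_deviation h hx G hloc hinv a r ht)
  have e : ω (localWeyl ω x N a * G.evolution N t (localWeyl ω x N r) * localWeyl ω x N b) -
      (damping 𝓛 (covMatrix ω x) t r : ℂ) * ω (localWeyl ω x N a *
        localWeyl ω x N ((mesoX 𝓛 t)ᵀ *ᵥ r) * localWeyl ω x N b) =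
      -ω (localWeyl ω x N a * deviation G ω x 𝓛 (covMatrix ω x) N t r * localWeyl ω x N b) := by
    rw [deviation, interpolating, mul_sub, sub_mul, map_sub, mul_smul_comm, smul_mul_assoc,
      map_smul, smul_eq_mul, neg_sub]
  have hb : rightNorm h.isState.toPositive (star (localWeyl ω x N b)) = 1 := by
    have h1 : h.isState.toPositive 1 = 1 := h.isState.map_one
    rw [← one_mul (star (localWeyl ω x N b)), rightNorm_mul_unitary _ _
      (by rw [star_star, star_localWeyl_mul h.isState hx]), rightNorm_one _ h1]
  rw [e, norm_neg]
  refine (norm_apply_mul_le h.isState.toPositive _ _).trans (le_of_eq ?_)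
  rw [hb, mul_one]

end DeviationLimit

/-! ### Entrywise exponentials of positive semidefinite matrices -/

section EntrywiseExp

variable {κ : Type*} [Fintype κ]

lemma posSemidef_map_pow {P : Matrix κ κ ℂ} (hP : P.PosSemidef) (k : ℕ) :
    (P.map fun z => z ^ k).PosSemidef := by
  induction k with
  | zero =>
    have e : (P.map fun z => z ^ 0) = Matrix.vecMulVec (fun _ => 1) (star fun _ => 1) := by
      ext i j
      simp [Matrix.vecMulVec_apply]
    rw [e]
    exact Matrix.posSemidef_vecMulVec_self_star _
  | succ k ih =>
    have e : (P.map fun z => z ^ (k + 1)) = (P.map fun z => z ^ k) ⊙ P := by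
      ext i j
      simp [pow_succ]
    rw [e]
    exact ih.hadamard hP

/-- The entrywise exponential of a positive semidefinite matrix is positive semidefinite, as a
series of Hadamard powers. -/
lemma posSemidef_map_exp {P : Matrix κ κ ℂ} (hP : P.PosSemidef) :
    (P.map Complex.exp).PosSemidef := by
  refine Matrix.PosSemidef.of_dotProduct_mulVec_nonneg ?_ fun u => ?_
  · ext i j
    rw [Matrix.conjTranspose_apply, Matrix.map_apply, Matrix.map_apply, Complex.star_def,
      ← Complex.exp_conj, ← Complex.star_def, hP.isHermitian.apply]
  have hexp : ∀ z : ℂ, HasSum (fun k : ℕ => (k.factorial : ℂ)⁻¹ * z ^ k) (Complex.exp z) :=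
    fun z => by
      have h := NormedSpace.exp_series_hasSum_exp' (𝕂 := ℂ) z
      rw [← Complex.exp_eq_exp_ℂ] at h
      exact h
  have hs : HasSum (fun k : ℕ => (k.factorial : ℂ)⁻¹ *
      (star u ⬝ᵥ ((P.map fun z => z ^ k) *ᵥ u))) (star u ⬝ᵥ ((P.map Complex.exp) *ᵥ u)) := by
    simp only [dotProduct, Matrix.mulVec, Matrix.map_apply, Finset.mul_sum]
    refine hasSum_sum fun i _ => hasSum_sum fun j _ => ?_
    have h := (hexp (P i j)).mul_left (star u i * u j)
    rw [show star u i * (Complex.exp (P i j) * u j) =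
      star u i * u j * Complex.exp (P i j) by ac_rfl]
    exact h.congr_fun fun k => by ac_rfl
  refine hs.nonneg fun k => mul_nonneg ?_ ((posSemidef_map_pow hP k).dotProduct_mulVec_nonneg u)
  rw [← Complex.ofReal_natCast, ← Complex.ofReal_inv, Complex.zero_le_real]
  positivity

end EntrywiseExp

/-! ### The involution of the Weyl algebra -/

namespace WeylAlgebra

variable {d : ℕ} {s : Matrix (Fin d) (Fin d) ℝ}

lemma smul_mul' (c : ℂ) (a b : WeylAlgebra s) : (c • a) * b = c • (a * b) := by
  change mulMap s (c • a) b = c • mulMap s a b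
  rw [map_smul, LinearMap.smul_apply]

lemma mul_smul' (c : ℂ) (a b : WeylAlgebra s) : a * (c • b) = c • (a * b) := by
  change mulMap s a (c • b) = c • mulMap s a b
  rw [map_smul]

lemma star_add' (a b : WeylAlgebra s) : star (a + b) = star a + star b := by
  have h : ∀ a b : (Fin d → ℝ) →₀ ℂ,
      Finsupp.mapRange star (star_zero ℂ) (Finsupp.mapDomain (fun r => -r) (a + b)) =
        Finsupp.mapRange star (star_zero ℂ) (Finsupp.mapDomain (fun r => -r) a) +
          Finsupp.mapRange star (star_zero ℂ) (Finsupp.mapDomain (fun r => -r) b) := fun a b => by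
    rw [Finsupp.mapDomain_add, Finsupp.mapRange_add (fun x y => star_add x y)]
  exact h a b

lemma star_smul' (c : ℂ) (a : WeylAlgebra s) : star (c • a) = star c • star a := by
  have h : ∀ a : (Fin d → ℝ) →₀ ℂ,
      Finsupp.mapRange star (star_zero ℂ) (Finsupp.mapDomain (fun r => -r) (c • a)) =
        star c • Finsupp.mapRange star (star_zero ℂ) (Finsupp.mapDomain (fun r => -r) a) :=
    fun a => by
      ext r
      rw [Finsupp.mapDomain_smul]
      simp
  exact h a

lemma star_zero' : star (0 : WeylAlgebra s) = 0 := by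
  rw [← zero_smul ℂ (0 : WeylAlgebra s), star_smul', star_zero, zero_smul, zero_smul]

lemma star_sum' {ι : Type*} (t : Finset ι) (f : ι → WeylAlgebra s) :
    star (∑ i ∈ t, f i) = ∑ i ∈ t, star (f i) := by
  classical
  induction t using Finset.induction_on with
  | empty => rw [Finset.sum_empty, Finset.sum_empty, star_zero']
  | insert i t hi ih => rw [Finset.sum_insert hi, Finset.sum_insert hi, star_add', ih]

lemma dotProduct_mulVec_skew (hs : sᵀ = -s) (u w : Fin d → ℝ) :
    u ⬝ᵥ (s *ᵥ w) = -(w ⬝ᵥ (s *ᵥ u)) := by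
  rw [Matrix.dotProduct_mulVec, ← Matrix.mulVec_transpose, hs, dotProduct_comm,
    Matrix.neg_mulVec, dotProduct_neg]

lemma star_phase (hs : sᵀ = -s) (r r' : Fin d → ℝ) : star (phase s r r') = phase s (-r') (-r) := by
  rw [phase, phase, Complex.star_def, ← Complex.exp_conj, Matrix.mulVec_neg, neg_dotProduct_neg,
    dotProduct_mulVec_skew hs r]
  simp only [map_mul, map_neg, map_div₀, Complex.conj_I, Complex.conj_ofReal, map_ofNat]
  congr 1
  push_cast
  ring

lemma star_mul_W (hs : sᵀ = -s) (r r' : Fin d → ℝ) :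
    star (W s r * W s r') = star (W s r') * star (W s r) := by
  rw [W_mul_W, star_smul', star_W, star_W, star_W, W_mul_W, star_phase hs, neg_add_rev]

lemma star_mul' (hs : sᵀ = -s) (a b : WeylAlgebra s) : star (a * b) = star b * star a := by
  induction a using induction_W with
  | zero => rw [zero_mul, star_zero', mul_zero]
  | add _ _ h h' => rw [add_mul, star_add', h, h', star_add', mul_add]
  | smul α r =>
    induction b using induction_W with
    | zero => rw [mul_zero, star_zero', zero_mul]
    | add _ _ h h' => rw [mul_add, star_add', h, h', star_add', add_mul]
    | smul β r' =>
      rw [smul_mul', mul_smul', star_smul', star_smul', star_mul_W hs, star_smul', star_smul',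
        smul_mul', mul_smul', smul_comm]

/-- A form `∑ K_{ij} y_i† y_j` with positive semidefinite `K` is a sum of squares. -/
lemma exists_sum_star_mul_self {κ : Type*} [Fintype κ] {K : Matrix κ κ ℂ} (hK : K.PosSemidef)
    (y : κ → WeylAlgebra s) : ∃ (m : ℕ) (c : Fin m → WeylAlgebra s),
      ∑ i, ∑ j, K i j • (star (y i) * y j) = ∑ l, star (c l) * c l := by
  classical
  open scoped MatrixOrder in
  obtain ⟨B, hB⟩ := CStarAlgebra.nonneg_iff_eq_star_mul_self.mp hK.nonneg
  rw [Matrix.star_eq_conjTranspose] at hB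
  subst hB
  refine ⟨Fintype.card κ, fun l => ∑ i, B ((Fintype.equivFin κ).symm l) i • y i, ?_⟩
  rw [(Fintype.equivFin κ).symm.sum_comp fun l => star (∑ i, B l i • y i) * ∑ i, B l i • y i]
  simp only [star_sum', star_smul', Finset.sum_mul_sum, smul_mul', mul_smul', smul_smul,
    Matrix.mul_apply, Matrix.conjTranspose_apply, Finset.sum_smul]
  rw [Finset.sum_congr rfl fun a _ => Finset.sum_comm, Finset.sum_comm]
  refine Finset.sum_congr rfl fun l _ => Finset.sum_congr rfl fun i _ =>
    Finset.sum_congr rfl fun j _ => ?_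
  rw [mul_comm]

/-- The coefficients of an element of the Weyl algebra in the basis of the `W(r)`. -/
def coeff (a : WeylAlgebra s) : (Fin d → ℝ) →₀ ℂ := a

lemma eq_sum_W (a : WeylAlgebra s) {T : Finset (Fin d → ℝ)} (hT : (coeff a).support ⊆ T) :
    a = ∑ r : T, coeff a r • W s r := by
  rw [Finset.sum_coe_sort T fun r => coeff a r • W s r,
    ← Finsupp.sum_of_support_subset (coeff a) hT (fun r z => (z • W s r : WeylAlgebra s))
      fun r _ => zero_smul ℂ _]
  refine (Finsupp.sum_single (coeff a)).symm.trans ?_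
  exact Finsupp.sum_congr fun r _ => (Finsupp.smul_single_one r _).symm

end WeylAlgebra

/-! ### Quasi-free maps -/

namespace WeylAlgebra

variable {d : ℕ} {s : Matrix (Fin d) (Fin d) ℝ}

lemma quasiFreeMap_W (𝓛 S : Matrix (Fin d) (Fin d) ℝ) (t : ℝ) (r : Fin d → ℝ) :
    quasiFreeMap s 𝓛 S t (W s r) = (damping 𝓛 S t r : ℂ) • W s ((mesoX 𝓛 t)ᵀ *ᵥ r) := by
  rw [quasiFreeMap, lift_W]

lemma quasiFreeMap_zero (𝓛 S : Matrix (Fin d) (Fin d) ℝ) :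
    quasiFreeMap s 𝓛 S 0 = LinearMap.id := by
  refine hom_ext fun r => ?_
  simp [quasiFreeMap_W, damping, mesoY, mesoX_zero]

lemma quasiFreeMap_one (𝓛 S : Matrix (Fin d) (Fin d) ℝ) (t : ℝ) :
    quasiFreeMap s 𝓛 S t 1 = 1 := by
  change quasiFreeMap s 𝓛 S t (W s 0) = W s 0
  simp [quasiFreeMap_W, damping]

lemma quasiFreeMap_add (𝓛 S : Matrix (Fin d) (Fin d) ℝ) (t u : ℝ) :
    quasiFreeMap s 𝓛 S (t + u) = quasiFreeMap s 𝓛 S t ∘ₗ quasiFreeMap s 𝓛 S u := by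
  refine hom_ext fun r => ?_
  have hv : (mesoX 𝓛 (t + u))ᵀ *ᵥ r = (mesoX 𝓛 t)ᵀ *ᵥ ((mesoX 𝓛 u)ᵀ *ᵥ r) := by
    rw [add_comm, mesoX_add, Matrix.transpose_mul, Matrix.mulVec_mulVec]
  rw [LinearMap.comp_apply, quasiFreeMap_W, quasiFreeMap_W, map_smul, quasiFreeMap_W, smul_smul,
    hv]
  congr 1
  rw [damping_eq, damping_eq, damping_eq, hv, ← Complex.ofReal_mul, ← Real.exp_add]
  congr 2
  ring

/-- The exponent `(r, (M - 𝒳_t M 𝒳_tᵗʳ) r')`, `M = Σ + (i/2) σ`, of the kernel of `Φ_t`. -/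
def kernelExponent (s 𝓛 S : Matrix (Fin d) (Fin d) ℝ) (t : ℝ) (r r' : Fin d → ℝ) : ℂ :=
  ((r ⬝ᵥ (S *ᵥ r') - ((mesoX 𝓛 t)ᵀ *ᵥ r) ⬝ᵥ (S *ᵥ ((mesoX 𝓛 t)ᵀ *ᵥ r')) : ℝ) : ℂ) +
    Complex.I / 2 *
      ((r ⬝ᵥ (s *ᵥ r') - ((mesoX 𝓛 t)ᵀ *ᵥ r) ⬝ᵥ (s *ᵥ ((mesoX 𝓛 t)ᵀ *ᵥ r')) : ℝ) : ℂ)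

/-- The action of `Φ_t` on `W(r)† W(r')`, in terms of a kernel of exponential form. -/
lemma quasiFreeMap_star_mul {S : Matrix (Fin d) (Fin d) ℝ} (hS : Sᵀ = S)
    (𝓛 : Matrix (Fin d) (Fin d) ℝ) (t : ℝ) (r r' : Fin d → ℝ) :
    quasiFreeMap s 𝓛 S t (star (W s r) * W s r') =
      ((damping 𝓛 S t r : ℂ) * damping 𝓛 S t r' * Complex.exp (kernelExponent s 𝓛 S t r r')) •
        (star (W s ((mesoX 𝓛 t)ᵀ *ᵥ r)) * W s ((mesoX 𝓛 t)ᵀ *ᵥ r')) := by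
  rw [star_W, star_W, W_mul_W, W_mul_W, map_smul, quasiFreeMap_W, smul_smul, smul_smul,
    Matrix.mulVec_add, Matrix.mulVec_neg]
  congr 1
  rw [damping_eq, damping_eq, damping_eq, Matrix.mulVec_add, Matrix.mulVec_neg]
  set v := (mesoX 𝓛 t)ᵀ *ᵥ r
  set v' := (mesoX 𝓛 t)ᵀ *ᵥ r'
  rw [phase, phase, kernelExponent, Complex.ofReal_exp, Complex.ofReal_exp, Complex.ofReal_exp,
    ← Complex.exp_add, ← Complex.exp_add, ← Complex.exp_add, ← Complex.exp_add]
  congr 1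
  simp only [Matrix.mulVec_add, Matrix.mulVec_neg, add_dotProduct, dotProduct_add, neg_dotProduct,
    dotProduct_neg]
  rw [dotProduct_mulVec_swap hS v' v, dotProduct_mulVec_swap hS r' r]
  push_cast
  ring

lemma ofReal_dotProduct_mulVec (S s : Matrix (Fin d) (Fin d) ℝ) (v w : Fin d → ℝ) :
    (Complex.ofReal ∘ v) ⬝ᵥ ((Matrix.of fun i j => (S i j : ℂ) + Complex.I / 2 * (s i j : ℂ)) *ᵥ
      (Complex.ofReal ∘ w)) =
      ((v ⬝ᵥ (S *ᵥ w) : ℝ) : ℂ) + Complex.I / 2 * ((v ⬝ᵥ (s *ᵥ w) : ℝ) : ℂ) := by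
  simp only [dotProduct, Matrix.mulVec, Matrix.of_apply, Function.comp_apply, Complex.ofReal_sum,
    Complex.ofReal_mul, Finset.mul_sum, ← Finset.sum_add_distrib]
  refine Finset.sum_congr rfl fun i _ => Finset.sum_congr rfl fun j _ => ?_
  ring

lemma posSemidef_kernelExponent {𝓛 S : Matrix (Fin d) (Fin d) ℝ} {t : ℝ}
    {M : Matrix (Fin d) (Fin d) ℂ}
    (hM : M = Matrix.of fun i j => (S i j : ℂ) + Complex.I / 2 * (s i j : ℂ))
    (hP : (M - (mesoX 𝓛 t).map Complex.ofReal * M *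
      ((mesoX 𝓛 t).map Complex.ofReal)ᵀ).PosSemidef)
    {κ : Type*} [Fintype κ] (r : κ → Fin d → ℝ) :
    (Matrix.of fun a b => kernelExponent s 𝓛 S t (r a) (r b)).PosSemidef := by
  have h := hP.conjTranspose_mul_mul_same (Matrix.of fun i a => (r a i : ℂ))
  have e : ∀ a b, ((Matrix.of fun i a => (r a i : ℂ))ᴴ * (M - (mesoX 𝓛 t).map Complex.ofReal * M *
      ((mesoX 𝓛 t).map Complex.ofReal)ᵀ) * Matrix.of fun i a => (r a i : ℂ)) a b =
      kernelExponent s 𝓛 S t (r a) (r b) := by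
    intro a b
    have hX : ∀ c, ((mesoX 𝓛 t).map Complex.ofReal)ᵀ *ᵥ (Complex.ofReal ∘ r c) =
        Complex.ofReal ∘ ((mesoX 𝓛 t)ᵀ *ᵥ r c) := by
      intro c
      funext i
      simp [Matrix.mulVec, dotProduct]
    have h1 : ((Matrix.of fun i a => (r a i : ℂ))ᴴ * (M - (mesoX 𝓛 t).map Complex.ofReal * M *
      ((mesoX 𝓛 t).map Complex.ofReal)ᵀ) * Matrix.of fun i a => (r a i : ℂ)) a b =
      (Complex.ofReal ∘ r a) ⬝ᵥ ((M - (mesoX 𝓛 t).map Complex.ofReal * M *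
      ((mesoX 𝓛 t).map Complex.ofReal)ᵀ) *ᵥ (Complex.ofReal ∘ r b)) := by
      rw [Matrix.mul_assoc, Matrix.mul_apply]
      simp only [dotProduct, Matrix.mulVec, Matrix.conjTranspose_apply, Matrix.of_apply,
        Complex.star_def, Complex.conj_ofReal, Function.comp_apply, Matrix.mul_apply]
    rw [h1, Matrix.sub_mulVec, dotProduct_sub, ← Matrix.mulVec_mulVec, ← Matrix.mulVec_mulVec,
      Matrix.dotProduct_mulVec _ ((mesoX 𝓛 t).map Complex.ofReal), ← Matrix.mulVec_transpose,
      hX, hX, hM, ofReal_dotProduct_mulVec, ofReal_dotProduct_mulVec, kernelExponent]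
    push_cast
    ring
  convert h using 1
  ext a b
  exact (e a b).symm

/-- The kernel `damping(r) damping(r') exp(P(r, r'))` with positive semidefinite exponent `P` is
positive semidefinite; a factorisation of it turns `∑ b_i† Φ(a_i† a_j) b_j` into squares. -/
theorem isCompletelyPositive_quasiFreeMap {𝓛 S : Matrix (Fin d) (Fin d) ℝ} (hS : Sᵀ = S)
    (hs : sᵀ = -s) {t : ℝ} {M : Matrix (Fin d) (Fin d) ℂ}
    (hM : M = Matrix.of fun i j => (S i j : ℂ) + Complex.I / 2 * (s i j : ℂ))
    (hP : (M - (mesoX 𝓛 t).map Complex.ofReal * M *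
      ((mesoX 𝓛 t).map Complex.ofReal)ᵀ).PosSemidef) :
    IsCompletelyPositive (quasiFreeMap s 𝓛 S t) := by
  classical
  intro n a b
  set T : Finset (Fin d → ℝ) := Finset.univ.biUnion fun i => (coeff (a i)).support
  set α : Fin n → (Fin d → ℝ) → ℂ := fun i => coeff (a i)
  have ha : ∀ i, a i = ∑ r : T, α i r • W s r := fun i =>
    eq_sum_W (a i) (Finset.subset_biUnion_of_mem
      (fun i => (coeff (a i)).support) (Finset.mem_univ i))
  set E : Matrix T T ℂ := Matrix.of fun r r' => Complex.exp (kernelExponent s 𝓛 S t r r') with hE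
  have hEpos : E.PosSemidef :=
    posSemidef_map_exp (posSemidef_kernelExponent hM hP fun r : T => (r : Fin d → ℝ))
  obtain ⟨m, c, hc⟩ := exists_sum_star_mul_self (s := s) hEpos fun r : T =>
    ∑ j, ((damping 𝓛 S t r : ℂ) * α j r) • (W s ((mesoX 𝓛 t)ᵀ *ᵥ r) * b j)
  refine ⟨m, c, ?_⟩
  rw [← hc]
  have hΦ : ∀ i j, quasiFreeMap s 𝓛 S t (star (a i) * a j) = ∑ r : T, ∑ r' : T,
      (α j r' * star (α i r) * ((damping 𝓛 S t r : ℂ) * damping 𝓛 S t r' * E r r')) •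
        (star (W s ((mesoX 𝓛 t)ᵀ *ᵥ r)) * W s ((mesoX 𝓛 t)ᵀ *ᵥ r')) := by
    intro i j
    rw [ha i, ha j, star_sum', Finset.sum_mul_sum]
    simp only [map_sum, star_smul', smul_mul', mul_smul', map_smul, smul_smul,
      quasiFreeMap_star_mul hS]
    rfl
  simp only [hΦ, Finset.mul_sum, Finset.sum_mul, star_sum', star_smul', star_mul' hs, smul_mul',
    mul_smul', smul_smul, Finset.smul_sum]
  have hcomm : ∀ g : Fin n → Fin n → T → T → WeylAlgebra s,
      ∑ i, ∑ j, ∑ r, ∑ r', g i j r r' = ∑ r, ∑ r', ∑ j, ∑ i, g i j r r' := fun g => by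
    rw [Finset.sum_congr rfl fun i _ => Finset.sum_comm, Finset.sum_comm]
    refine Finset.sum_congr rfl fun r _ => ?_
    rw [Finset.sum_congr rfl fun i _ => Finset.sum_comm, Finset.sum_comm]
    exact Finset.sum_congr rfl fun r' _ => Finset.sum_comm
  rw [hcomm]
  refine Finset.sum_congr rfl fun r _ => Finset.sum_congr rfl fun r' _ =>
    Finset.sum_congr rfl fun j _ => Finset.sum_congr rfl fun i _ => ?_
  rw [show star (b i) * (star (W s ((mesoX 𝓛 t)ᵀ *ᵥ r)) * W s ((mesoX 𝓛 t)ᵀ *ᵥ r')) * b j =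
    star (b i) * star (W s ((mesoX 𝓛 t)ᵀ *ᵥ r)) * (W s ((mesoX 𝓛 t)ᵀ *ᵥ r') * b j) by
      simp only [mul_assoc]]
  congr 1
  simp only [Complex.star_def, map_mul, Complex.conj_ofReal]
  ring

end WeylAlgebra

end SpinChain

end

theorem mainTheorem1 {p m d : ℕ}
    -- the microscopic state and the set `χ = {x₁, …, x_d}` of hermitian single-site observables
    (ω : QuasiLocal p →ₗ[ℂ] ℂ) (x : Fin d → Matrix (Fin p) (Fin p) ℂ)
    (hx : ∀ i, (x i).IsHermitian) (hω : HasNormalFluctuations ω x)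
    -- the Lindblad generator
    (G : LindbladData p m) (𝓛 : Matrix (Fin d) (Fin d) ℝ)
    (hloc : G.IsLocalOn x 𝓛) (hinv : G.Preserves ω) :
    -- the covariance matrix `S = Σ_ω` and the form `s = σ_ω` exist as limits, and
    ∃ S s : Matrix (Fin d) (Fin d) ℝ, IsCovariance ω x S ∧ IsSymplecticForm ω x s ∧
      -- the convergence theorem
      (∀ (a r : Fin d → ℝ) (t : ℝ), 0 ≤ t →
        Tendsto (fun N : ℕ => ω (localWeyl ω x N a * deviation G ω x 𝓛 S N t r *
          star (deviation G ω x 𝓛 S N t r) * star (localWeyl ω x N a))) atTop (𝓝 0)) ∧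
      -- hence all Weyl correlation functions of `Φ_t^N` are asymptotically those of `Ψ_t`
      (∀ (a b r : Fin d → ℝ) (t : ℝ), 0 ≤ t →
        Tendsto (fun N : ℕ => ω (localWeyl ω x N a * G.evolution N t (localWeyl ω x N r) *
            localWeyl ω x N b) -
          (damping 𝓛 S t r : ℂ) * ω (localWeyl ω x N a *
            localWeyl ω x N ((mesoX 𝓛 t)ᵀ *ᵥ r) * localWeyl ω x N b)) atTop (𝓝 0)) ∧
      -- the maps `Φ_t` form a semigroup of completely positive unital maps on the Weyl algebra
      WeylAlgebra.quasiFreeMap s 𝓛 S 0 = LinearMap.id ∧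
      (∀ t u : ℝ, 0 ≤ t → 0 ≤ u → WeylAlgebra.quasiFreeMap s 𝓛 S (t + u) =
        WeylAlgebra.quasiFreeMap s 𝓛 S t ∘ₗ WeylAlgebra.quasiFreeMap s 𝓛 S u) ∧
      (∀ t : ℝ, 0 ≤ t → WeylAlgebra.quasiFreeMap s 𝓛 S t 1 = 1 ∧
        WeylAlgebra.IsCompletelyPositive (WeylAlgebra.quasiFreeMap s 𝓛 S t)) := by
  refine ⟨covMatrix ω x, sympMatrix ω x, isCovariance_covMatrix hω hx,
    isSymplecticForm_sympMatrix hω hx,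
    fun a r t ht => tendsto_apply_deviation_mul_star hω hx G hloc hinv a r ht,
    fun a b r t ht => tendsto_apply_evolution_sub hω hx G hloc hinv a b r ht,
    WeylAlgebra.quasiFreeMap_zero _ _, fun t u _ _ => WeylAlgebra.quasiFreeMap_add _ _ t u,
    fun t ht => ⟨WeylAlgebra.quasiFreeMap_one _ _ t, ?_⟩⟩
  have hP := posSemidef_sub_mesoX (limitCov_isHermitian hω hx)
    (limitCov_dissipative hω hx G hloc hinv) ht
  refine WeylAlgebra.isCompletelyPositive_quasiFreeMap (covMatrix_transpose hω hx)
    (sympMatrix_transpose hω hx) (Matrix.ext fun i j => ?_) hP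
  rw [limitCov_eq, Matrix.of_apply]
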